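/- **Circuit model (LAQCC).** Qubits are placed on the vertices of a rectangular grid. A circuit consists of finitely many rounds. Each round runs (i) a classical Boolean circuit with AND- and OR-gates of fan-in two, NOT-gates and constants, whose inputs are the measurement outcomes of all previous rounds; (ii) a quantum circuit, made of layers of gates acting on pairwise disjoint qubits, where each gate is an arbitrary single-qubit unitary or a CNOT between neighbouring grid qubits, and each gate may be controlled by one wire of the classical circuit of that round; (iii) a computational-basis measurement of a subset of the qubits. A family of such circuits with $n$ output qubits is in LAQCC if the number of rounds and the depth of every quantum circuit are $O(1)$, every classical circuit has depth $O(\log n)$ (that is, at most $c(\lfloor\log_2 \max(n,1)\rfloor+1)$ for a constant $c$), and all quantum and classical circuits have size polynomial in $n$ (no uniformity of the family is required). A circuit *deterministically prepares* a pure state $|\varphi\rangle$ of $n$ qubits if, started on the all-zeroes state of the grid, for all measurement outcomes of nonzero probability its final state is, up to a global phase, $|\varphi\rangle$ on the $n$ designated output qubits and $|0\rangle$ on every other qubit. **Theorem.** There is an LAQCC family of circuits $(A_q)$, with $A_q$ having $\lceil\log_2 q\rceil$ output qubits, such that for every integer $q\ge 1$ the circuit $A_q$ deterministically (with no failure probability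 and no approximation error) prepares the uniform superposition $$\frac{1}{\sqrt q}\sum_{i=0}^{q-1}|i\rangle ,$$ where $|i\rangle$ is the binary encoding of $i$ on $\lceil\log_2 q\rceil$ qubits. The total number of qubits of $A_q$, ancilla qubits included, is at most $C(\log_2 q)^2$ for a constant $C$ that does not depend on $q$. -/

import Mathlib

namespace LAQCC

/-! ### Boolean circuits of fan-in at most two -/

/-- A gate of a Boolean circuit whose input wires are taken from `W`. -/
inductive BoolGate (W : Type) : Type
  | const (b : Bool) : BoolGate W
  | not (u : W) : BoolGate W
  | and (u v : W) : BoolGate W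
  | or (u v : W) : BoolGate W

namespace BoolGate

/-- The value of a gate, given the values of the wires. -/
def eval {W : Type} (val : W → Bool) : BoolGate W → Bool
  | const b => b
  | not u => !(val u)
  | and u v => val u && val v
  | or u v => val u || val v

/-- The depth of a gate, given the depths of the wires. -/
def depth {W : Type} (d : W → ℕ) : BoolGate W → ℕ
  | const _ => 0
  | not u => d u + 1
  | and u v => max (d u) (d v) + 1
  | or u v => max (d u) (d v) + 1

end BoolGate

/-- A Boolean circuit with input variables `ι` and with `k` gates, listed in topological order:
every gate reads input variables and earlier gates (of arbitrary fan-out). Its size is `k`. -/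
inductive BoolCircuit (ι : Type) : ℕ → Type
  | empty : BoolCircuit ι 0
  | snoc {k : ℕ} (C : BoolCircuit ι k) (g : BoolGate (ι ⊕ Fin k)) : BoolCircuit ι (k + 1)

namespace BoolCircuit

/-- The values of the gates on the input `x`. -/
def value {ι : Type} (x : ι → Bool) : {k : ℕ} → BoolCircuit ι k → Fin k → Bool
  | _, empty => Fin.elim0
  | _, snoc C g =>
      Fin.snoc (α := fun _ => Bool) (value x C) (g.eval (Sum.elim x (value x C)))

/-- The depths of the gates; input variables have depth `0`. -/
def gateDepth {ι : Type} : {k : ℕ} → BoolCircuit ι k → Fin k → ℕ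
  | _, empty => Fin.elim0
  | _, snoc C g =>
      Fin.snoc (α := fun _ => ℕ) (gateDepth C) (g.depth (Sum.elim (fun _ => 0) (gateDepth C)))

/-- The depth of the circuit. -/
def depth {ι : Type} {k : ℕ} (C : BoolCircuit ι k) : ℕ :=
  Finset.univ.sup C.gateDepth

/-- The values of all wires (input variables and gates) on the input `x`. -/
def wires {ι : Type} {k : ℕ} (C : BoolCircuit ι k) (x : ι → Bool) : ι ⊕ Fin k → Bool :=
  Sum.elim x (C.value x)

end BoolCircuit

/-! ### Quantum gates on qubits placed on the vertices of a graph -/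

/-- A vector of amplitudes over the computational basis of the qubits `Q`. -/
abbrev QState (Q : Type) : Type := (Q → Bool) → ℂ

/-- The all-zeroes state. -/
def zeroState (Q : Type) [Fintype Q] [DecidableEq Q] : QState Q :=
  fun x => if x = fun _ => false then 1 else 0

/-- The gate set: all single-qubit unitaries, and the CNOT gate between neighbouring qubits. -/
inductive QGate {Q : Type} (G : SimpleGraph Q) : Type
  | single (u : Matrix.unitaryGroup Bool ℂ) (p : Q) : QGate G
  | cnot (control target : Q) (h : G.Adj control target) : QGate G

namespace QGate

/-- The qubits a gate acts on. -/
def support {Q : Type} [DecidableEq Q] {G : SimpleGraph Q} : QGate G → Finset Q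
  | single _ p => {p}
  | cnot c t _ => {c, t}

/-- The unitary action of a gate on amplitude vectors. -/
def apply {Q : Type} [DecidableEq Q] {G : SimpleGraph Q} : QGate G → QState Q → QState Q
  | single u p, ψ => fun x =>
      ∑ b : Bool, (u : Matrix Bool Bool ℂ) (x p) b * ψ (Function.update x p b)
  | cnot c t _, ψ => fun x => ψ (Function.update x t (xor (x t) (x c)))

end QGate

/-- A quantum gate that may be controlled by one classical bit, taken from a wire in `W`. -/
structure CtrlGate {Q : Type} (G : SimpleGraph Q) (W : Type) where
  gate : QGate G
  ctrl : Option W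

/-- The action of a possibly controlled gate, given the values of the classical wires: a
controlled gate is applied if and only if its control bit is `true`. -/
def CtrlGate.apply {Q : Type} [DecidableEq Q] {G : SimpleGraph Q} {W : Type}
    (val : W → Bool) (g : CtrlGate G W) (ψ : QState Q) : QState Q :=
  match g.ctrl with
  | none => g.gate.apply ψ
  | some w => if val w = true then g.gate.apply ψ else ψ

/-- A depth-one quantum circuit: gates acting on pairwise disjoint sets of qubits. -/
structure QLayer {Q : Type} [DecidableEq Q] (G : SimpleGraph Q) (W : Type) where
  gates : List (CtrlGate G W)
  disjoint : gates.Pairwise fun g g' => Disjoint g.gate.support g'.gate.support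

/-- The action of a depth-one circuit. -/
def QLayer.apply {Q : Type} [DecidableEq Q] {G : SimpleGraph Q} {W : Type}
    (val : W → Bool) (L : QLayer G W) (ψ : QState Q) : QState Q :=
  L.gates.foldl (fun φ g => g.apply val φ) ψ

/-- The (unnormalised) state after the qubits in `M` have been measured in the computational
basis with outcomes `o`; its squared norm is the probability of these outcomes. -/
def project {Q : Type} [DecidableEq Q] (M : Finset Q) (o : Q → Bool) (ψ : QState Q) : QState Q :=
  fun x => if ∀ p ∈ M, x p = o p then ψ x else 0

/-! ### Alternating quantum-classical circuits -/

/-- One round: a classical circuit, then a quantum circuit with gates controlled by wires of the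
classical circuit, then the measurement of a subset of the qubits.
The input variable `(t, p)` of the classical circuit is the outcome of the measurement of the
qubit `p` at the end of round `t`; it reads `false` if no such measurement has been made yet. -/
structure Round {Q : Type} [DecidableEq Q] (G : SimpleGraph Q) where
  classicalSize : ℕ
  classical : BoolCircuit (ℕ × Q) classicalSize
  layers : List (QLayer G ((ℕ × Q) ⊕ Fin classicalSize))
  measured : Finset Q

namespace Round

/-- The number of layers of the quantum circuit of a round. -/
def quantumDepth {Q : Type} [DecidableEq Q] {G : SimpleGraph Q} (r : Round G) : ℕ :=
  r.layers.length

/-- The number of gates of the quantum circuit of a round. -/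
def quantumSize {Q : Type} [DecidableEq Q] {G : SimpleGraph Q} (r : Round G) : ℕ :=
  (r.layers.map fun L => L.gates.length).sum

/-- The action of the quantum circuit of a round, given the record `past` of the earlier
measurement outcomes. -/
def quantum {Q : Type} [DecidableEq Q] {G : SimpleGraph Q} (r : Round G)
    (past : ℕ × Q → Bool) (ψ : QState Q) : QState Q :=
  r.layers.foldl (fun φ L => L.apply (r.classical.wires past) φ) ψ

end Round

/-- The (unnormalised) state resulting from `ψ` by running the given rounds, the first of which
has the number `t`, on the branch in which every measurement of a qubit `p` in a round `s` has the
outcome `o s p`. The record `past` holds the outcomes of the rounds before `t`. -/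
def runFrom {Q : Type} [DecidableEq Q] {G : SimpleGraph Q} (o : ℕ → Q → Bool) :
    List (Round G) → ℕ → (ℕ × Q → Bool) → QState Q → QState Q
  | [], _, _, ψ => ψ
  | r :: rs, t, past, ψ =>
      runFrom o rs (t + 1)
        (fun a => if a.1 = t then decide (a.2 ∈ r.measured) && o t a.2 else past a)
        (project r.measured (o t) (r.quantum past ψ))

/-- The (unnormalised) final state of the given rounds on the all-zeroes state, on the branch with
measurement outcomes `o`. -/
def finalState {Q : Type} [Fintype Q] [DecidableEq Q] {G : SimpleGraph Q} (rounds : List (Round G))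
    (o : ℕ → Q → Bool) : QState Q :=
  runFrom o rounds 0 (fun _ => false) (zeroState Q)

/-- The state `φ` on the qubits `out 0, …, out (n - 1)`, tensored with the zero state on all other
qubits. -/
def embed {Q : Type} [Fintype Q] [DecidableEq Q] {n : ℕ} (out : Fin n ↪ Q) (φ : QState (Fin n)) :
    QState Q :=
  fun x => if ∀ p, (∀ j, out j ≠ p) → x p = false then φ (fun j => x (out j)) else 0

/-- The given rounds deterministically prepare the pure state `φ` on the qubits `out`: for all
measurement outcomes, the final state is `φ` on the qubits `out` and `0` on all other qubits, up to
normalisation and a global phase (the scalar is zero for the outcomes of probability zero). -/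
def RoundsPrepare {Q : Type} [Fintype Q] [DecidableEq Q] {G : SimpleGraph Q} {n : ℕ}
    (rounds : List (Round G)) (out : Fin n ↪ Q) (φ : QState (Fin n)) : Prop :=
  ∀ o : ℕ → Q → Bool, ∃ a : ℂ, finalState rounds o = a • embed out φ

/-- The grid with `h` rows and `w` columns. -/
abbrev grid (h w : ℕ) : SimpleGraph (Fin h × Fin w) :=
  (SimpleGraph.pathGraph h).boxProd (SimpleGraph.pathGraph w)

/-- An alternating quantum-classical circuit on a grid of qubits, with `n` output qubits. -/
structure Circuit (n : ℕ) where
  height : ℕ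
  width : ℕ
  rounds : List (Round (grid height width))
  output : Fin n ↪ Fin height × Fin width

/-- The number of all qubits of a circuit, ancilla qubits included. -/
def Circuit.numQubits {n : ℕ} (A : Circuit n) : ℕ := A.height * A.width

/-- The circuit deterministically prepares the pure state `φ` on its output qubits. -/
def Circuit.Prepares {n : ℕ} (A : Circuit n) (φ : QState (Fin n)) : Prop :=
  RoundsPrepare A.rounds A.output φ

/-- A family of circuits with `n i` output qubits is in LAQCC if it has a constant number of rounds,
the quantum circuits of the rounds have constant depth and size polynomial in `n i`, and the
classical circuits have depth `O(log (n i))` and size polynomial in `n i`. -/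
def IsLAQCC {I : Type} (n : I → ℕ) (A : (i : I) → Circuit (n i)) : Prop :=
  ∃ c : ℕ, ∀ i : I, (A i).rounds.length ≤ c ∧ ∀ r ∈ (A i).rounds,
    r.quantumDepth ≤ c ∧ r.quantumSize ≤ c * (n i + 1) ^ c ∧
    r.classical.depth ≤ c * (Nat.log 2 (n i) + 1) ∧ r.classicalSize ≤ c * (n i + 1) ^ c

/-! ### The uniform superposition -/

/-- The computational basis state `|i⟩` on `n` qubits; the qubit `j` holds the bit of weight
`2 ^ j` of the number `i`. -/
def ket (n i : ℕ) : QState (Fin n) :=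
  fun x => if ∀ j : Fin n, x j = i.testBit j then 1 else 0

/-- The uniform superposition of `|0⟩, …, |q - 1⟩` on `⌈log₂ q⌉` qubits. -/
noncomputable def uniformSuperposition (q : ℕ) : QState (Fin (Nat.clog 2 q)) :=
  ((Real.sqrt q : ℝ) : ℂ)⁻¹ • ∑ i ∈ Finset.range q, ket (Nat.clog 2 q) i

end LAQCC

/-! The state comes from exact amplitude amplification. Let n = ⌈log₂ q⌉. Put n qubits in uniform
superposition and rotate one more so that the numbers below q have total weight exactly 1/4 =
sin²(π/6); a single Grover step then moves all the weight onto them (`amplification`,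
`runs_uniform`). Both reflections are sign oracles for "less than a constant", with constants q and
1, so the task is to compare exactly in constant depth (`runs_lt`).

Comparison finds the highest bit at which a number differs from the constant. Each flag needed for
this says that a count of violated conditions is zero, that is, that an affine form in the bits is
divisible by a large enough 2^m. Such divisibility is tested without error (`runs_affine`): rotate
register qubit k by π·w/2^k. If 2^m divides w, all registers stay 0; otherwise the register at the
2-adic valuation of w is certainly 1. "All registers are 0" becomes a flag through character
orthogonality: the signs of the parities of all 2^m subsets of registers sum to 2^m or 0, hence a
rotation by π or 0 (`runs_zeroFlags`). A flag costs m + 2^m scratch qubits. Splitting the bits into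
about √n blocks of about √n bits makes the expensive flags few, so that only O(n) logical qubits are
used.

All of this consists of a bounded number of tensor products of single-qubit gates and diagonal
phases quadratic in the bits (`Runs`). A quadratic phase reduces to phases on parities of pairs,
which are performed on a grid of side 2N for N logical qubits: qubit i is fanned out along a row,
qubit j along a column, and they meet next to a common neighbour (`lrealizable_diagonal`). Fan-out
over any distance takes constant depth by measurement: parities of neighbouring sites are measured,
and sites are corrected by parities of outcomes, computed by classical circuits of logarithmic depth
(`realizable_fanOut`, `realizable_fanIn`). Every branch yields the same operation up to a scalar, so
nothing can fail, and O(n) logical qubits give O(n²) grid vertices. -/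

namespace LAQCC

/-! ### Boolean circuits computing parities -/

namespace BoolCircuit

variable {ι : Type}

/-- The depths of all wires; input variables have depth `0`. -/
def wireDepth {k : ℕ} (C : BoolCircuit ι k) : ι ⊕ Fin k → ℕ :=
  Sum.elim (fun _ => 0) C.gateDepth

/-- The circuit `C'` has, along `e`, copies of all wires of `C`. -/
def Extends {k k' : ℕ} (C : BoolCircuit ι k) (C' : BoolCircuit ι k')
    (e : ι ⊕ Fin k → ι ⊕ Fin k') : Prop :=
  ∀ w, (∀ x, C'.wires x (e w) = C.wires x w) ∧ C'.wireDepth (e w) = C.wireDepth w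

theorem Extends.refl {k : ℕ} (C : BoolCircuit ι k) : C.Extends C id := fun _ => ⟨fun _ => rfl, rfl⟩

theorem Extends.trans {k₁ k₂ k₃ : ℕ} {C₁ : BoolCircuit ι k₁} {C₂ : BoolCircuit ι k₂}
    {C₃ : BoolCircuit ι k₃} {e : ι ⊕ Fin k₁ → ι ⊕ Fin k₂} {f : ι ⊕ Fin k₂ → ι ⊕ Fin k₃}
    (h : C₁.Extends C₂ e) (h' : C₂.Extends C₃ f) : C₁.Extends C₃ (f ∘ e) := fun w =>
  ⟨fun x => ((h' (e w)).1 x).trans ((h w).1 x), (h' (e w)).2.trans (h w).2⟩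

/-- The existential form hides the index shift: later constructions only transport wires along `e`
and keep the uniform depth bound `D`. -/
theorem exists_gate {k : ℕ} (C : BoolCircuit ι k) (g : BoolGate (ι ⊕ Fin k)) {D : ℕ}
    (hC : ∀ w, C.wireDepth w ≤ D) (hg : g.depth C.wireDepth ≤ D) :
    ∃ (C' : BoolCircuit ι (k + 1)) (e : ι ⊕ Fin k → ι ⊕ Fin (k + 1)) (w : ι ⊕ Fin (k + 1)),
      C.Extends C' e ∧ (∀ x, C'.wires x w = g.eval (C.wires x)) ∧
      C'.wireDepth w = g.depth C.wireDepth ∧ ∀ w, C'.wireDepth w ≤ D := by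
  refine ⟨C.snoc g, Sum.map id Fin.castSucc, Sum.inr (Fin.last k), ?_, ?_, ?_, ?_⟩
  · rintro (i | j)
    · exact ⟨fun _ => rfl, rfl⟩
    · simp [wires, value, wireDepth, gateDepth]
  · intro x
    simp [wires, value]
  · simp [wireDepth, gateDepth]
  · rintro (i | j)
    · simp [wireDepth]
    · refine Fin.lastCases ?_ (fun j => ?_) j
      · simpa [wireDepth, gateDepth] using hg
      · simpa [wireDepth, gateDepth] using hC (Sum.inr j)

/-- Uses u ⊕ v = (u ∨ v) ∧ ¬(u ∧ v): four gates, three on the longest path. -/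
theorem exists_xor {k : ℕ} (C : BoolCircuit ι k) (u v : ι ⊕ Fin k) {d D : ℕ}
    (hC : ∀ w, C.wireDepth w ≤ D) (hu : C.wireDepth u ≤ d) (hv : C.wireDepth v ≤ d)
    (hd : d + 3 ≤ D) :
    ∃ (C' : BoolCircuit ι (k + 4)) (e : ι ⊕ Fin k → ι ⊕ Fin (k + 4)) (w : ι ⊕ Fin (k + 4)),
      C.Extends C' e ∧ (∀ x, C'.wires x w = xor (C.wires x u) (C.wires x v)) ∧
      C'.wireDepth w ≤ d + 3 ∧ ∀ w, C'.wireDepth w ≤ D := by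
  obtain ⟨C₁, e₁, w₁, h₁, v₁, d₁, b₁⟩ :=
    C.exists_gate (.or u v) hC (by simp only [BoolGate.depth]; omega)
  obtain ⟨C₂, e₂, w₂, h₂, v₂, d₂, b₂⟩ :=
    C₁.exists_gate (.and (e₁ u) (e₁ v)) b₁
      (by simp only [BoolGate.depth, (h₁ u).2, (h₁ v).2]; omega)
  simp only [BoolGate.depth, (h₁ u).2, (h₁ v).2] at d₁ d₂
  obtain ⟨C₃, e₃, w₃, h₃, v₃, d₃, b₃⟩ :=
    C₂.exists_gate (.not w₂) b₂ (by simp only [BoolGate.depth]; omega)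
  simp only [BoolGate.depth] at d₃
  have e₁₃ : C₃.wireDepth (e₃ (e₂ w₁)) = C₁.wireDepth w₁ := by rw [(h₃ _).2, (h₂ _).2]
  obtain ⟨C₄, e₄, w₄, h₄, v₄, d₄, b₄⟩ :=
    C₃.exists_gate (.and (e₃ (e₂ w₁)) w₃) b₃ (by simp only [BoolGate.depth]; omega)
  simp only [BoolGate.depth] at d₄
  refine ⟨C₄, _, w₄, ((h₁.trans h₂).trans h₃).trans h₄, fun x => ?_, by omega, b₄⟩
  rw [v₄]
  simp only [BoolGate.eval]
  rw [(h₃ _).1, (h₂ _).1, v₁, v₃]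
  simp only [BoolGate.eval]
  rw [v₂]
  simp only [BoolGate.eval]
  rw [(h₁ _).1, (h₁ _).1]
  cases C.wires x u <;> cases C.wires x v <;> rfl

/-- A balanced tree, splitting the list in halves. The slack 4 in the size bound pays for the gates
joining two subtrees. The bound `D` for all wires is separate from the bound for the new one: trees
built side by side all start from the inputs, so depths do not add up. -/
theorem exists_xor_list (l : ℕ) : ∀ {k : ℕ} (C : BoolCircuit ι k) {D : ℕ}, 3 * l ≤ D →
    (∀ w, C.wireDepth w ≤ D) → ∀ S : List ι, S.length ≤ 2 ^ l →
    ∃ (k' : ℕ) (C' : BoolCircuit ι k') (e : ι ⊕ Fin k → ι ⊕ Fin k') (w : ι ⊕ Fin k'),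
      k' + 4 ≤ k + 5 * 2 ^ l ∧ C.Extends C' e ∧
      (∀ x, C'.wires x w = (S.map x).foldr xor false) ∧
      C'.wireDepth w ≤ 3 * l ∧ ∀ w, C'.wireDepth w ≤ D := by
  induction l with
  | zero =>
    intro k C D hD hC S hS
    rcases S with _ | ⟨a, _ | ⟨b, S⟩⟩
    · obtain ⟨C₁, e₁, w₁, h₁, v₁, d₁, b₁⟩ :=
        C.exists_gate (.const false) hC (Nat.zero_le _)
      exact ⟨_, C₁, e₁, w₁, by omega, h₁, v₁, d₁.le, b₁⟩
    · exact ⟨_, C, id, Sum.inl a, by omega, .refl C, fun x => by simp [wires], by simp [wireDepth],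
        hC⟩
    · simp at hS
  | succ l ih =>
    intro k C D hD hC S hS
    have hp : 2 ^ (l + 1) = 2 ^ l + 2 ^ l := by ring
    obtain ⟨k₁, C₁, e₁, w₁, s₁, h₁, v₁, d₁, b₁⟩ :=
      ih C (by omega) hC (S.take (2 ^ l)) (by simp)
    obtain ⟨k₂, C₂, e₂, w₂, s₂, h₂, v₂, d₂, b₂⟩ :=
      ih C₁ (by omega) b₁ (S.drop (2 ^ l)) (by simp; omega)
    obtain ⟨C₃, e₃, w₃, h₃, v₃, d₃, b₃⟩ :=
      C₂.exists_xor (e₂ w₁) w₂ b₂ (by rw [(h₂ w₁).2]; exact d₁) d₂ (by omega)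
    refine ⟨_, C₃, _, w₃, by omega, (h₁.trans h₂).trans h₃, fun x => ?_, by omega, b₃⟩
    rw [v₃, (h₂ w₁).1, v₁, v₂]
    conv_rhs => rw [← List.take_append_drop (2 ^ l) S, List.map_append, List.foldr_append]
    generalize (List.map x (S.take (2 ^ l))) = A
    generalize List.foldr xor false (List.map x (S.drop (2 ^ l))) = b
    induction A with
    | nil => simp
    | cons a A ihA => simp [← ihA]

end BoolCircuit

/-- The parity of the number of elements of `S` at which `f` is true. -/
noncomputable def parity {α : Type} (S : Finset α) (f : α → Bool) : Bool :=
  (S.toList.map f).foldr xor false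

theorem parity_insert {α : Type} [DecidableEq α] {S : Finset α} {a : α} (h : a ∉ S)
    (f : α → Bool) : parity (insert a S) f = xor (f a) (parity S f) := by
  have hp : ((insert a S).toList.map f).Perm ((a :: S.toList).map f) :=
    (Finset.toList_insert h).map f
  have hc : LeftCommutative (xor : Bool → Bool → Bool) := ⟨by decide⟩
  simpa [parity] using hp.foldr_eq (f := xor) false

theorem parity_empty {α : Type} (f : α → Bool) : parity ∅ f = false := by
  simp [parity]

theorem parity_singleton {α : Type} (a : α) (f : α → Bool) : parity {a} f = f a := by
  simp [parity]

theorem parity_map {α β : Type} (S : Finset α) (g : α ↪ β) (f : β → Bool) :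
    parity (S.map g) f = parity S (f ∘ g) := by
  classical
  induction S using Finset.induction_on with
  | empty => simp [parity_empty]
  | insert a S h ih => rw [Finset.map_insert, parity_insert (by simpa using h), parity_insert h, ih,
      Function.comp_apply]

/-- Many parities of at most `2 ^ l` inputs each, computed by one circuit of depth `3 * l`. -/
theorem BoolCircuit.exists_parities {ι κ : Type} [Fintype κ] (S : κ → Finset ι) (l : ℕ)
    (hS : ∀ j, (S j).card ≤ 2 ^ l) :
    ∃ (k : ℕ) (C : BoolCircuit ι k) (w : κ → ι ⊕ Fin k),
      k ≤ Fintype.card κ * (5 * 2 ^ l) ∧ C.depth ≤ 3 * l ∧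
      ∀ x j, C.wires x (w j) = parity (S j) x := by
  classical
  rcases isEmpty_or_nonempty κ with hκ | hκ
  · exact ⟨0, .empty, hκ.elim, by simp, by simp [BoolCircuit.depth],
      fun _ j => hκ.elim j⟩
  obtain ⟨j₀⟩ := hκ
  by_cases hi : Nonempty ι
  swap
  · refine ⟨1, .snoc .empty (.const false), fun _ => Sum.inr 0, ?_, ?_, ?_⟩
    · have : 0 < Fintype.card κ := Fintype.card_pos_iff.2 ⟨j₀⟩
      have : 0 < 2 ^ l := by positivity
      nlinarith
    · simp [BoolCircuit.depth, BoolCircuit.gateDepth, BoolGate.depth, Fin.snoc]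
    · intro x j
      have : S j = ∅ := Finset.eq_empty_of_forall_notMem fun a => (hi ⟨a⟩).elim
      simp [this, parity_empty, BoolCircuit.wires, BoolCircuit.value, BoolGate.eval, Fin.snoc]
  obtain ⟨i₀⟩ := hi
  have key : ∀ s : Finset κ, ∃ (k : ℕ) (C : BoolCircuit ι k) (w : κ → ι ⊕ Fin k),
      k ≤ s.card * (5 * 2 ^ l) ∧ (∀ w, C.wireDepth w ≤ 3 * l) ∧
      ∀ x, ∀ j ∈ s, C.wires x (w j) = parity (S j) x := by
    intro s
    induction s using Finset.induction_on with
    | empty =>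
      refine ⟨0, .empty, fun _ => Sum.inl i₀, by simp, ?_, by simp⟩
      rintro (i | j)
      · simp [BoolCircuit.wireDepth]
      · exact j.elim0
    | insert j s hj ih =>
      obtain ⟨k, C, w, hk, hC, hw⟩ := ih
      obtain ⟨k', C', e, w', hk', he, hv, -, hC'⟩ :=
        BoolCircuit.exists_xor_list l C le_rfl hC (S j).toList (by simpa using hS j)
      refine ⟨k', C', fun i => if i = j then w' else e (w i), ?_, hC', fun x i hi => ?_⟩
      · rw [Finset.card_insert_of_notMem hj, add_mul]
        omega
      · by_cases hij : i = j
        · subst hij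
          simpa [parity] using hv x
        · have := hw x i (Finset.mem_of_mem_insert_of_ne hi hij)
          simp [hij, (he _).1, this]
  obtain ⟨k, C, w, hk, hC, hw⟩ := key Finset.univ
  exact ⟨k, C, w, by simpa using hk, Finset.sup_le fun j _ => hC (Sum.inr j),
    fun x j => hw x j (Finset.mem_univ j)⟩

open Function

set_option linter.unusedSectionVars false

/-! ### Linearity of the rounds -/

section Linearity

variable {Q : Type} [DecidableEq Q] {G : SimpleGraph Q}

theorem QGate.apply_smul (g : QGate G) (a : ℂ) (ψ : QState Q) :
    g.apply (a • ψ) = a • g.apply ψ := by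
  cases g with
  | single u p =>
    funext x
    simp only [QGate.apply, Pi.smul_apply, smul_eq_mul, Finset.mul_sum]
    exact Finset.sum_congr rfl fun b _ => by ring
  | cnot c t h => rfl

theorem CtrlGate.apply_smul {W : Type} (val : W → Bool) (g : CtrlGate G W) (a : ℂ)
    (ψ : QState Q) : g.apply val (a • ψ) = a • g.apply val ψ := by
  unfold CtrlGate.apply
  split
  · exact QGate.apply_smul _ _ _
  · split_ifs
    · exact QGate.apply_smul _ _ _
    · rfl

theorem QLayer.apply_smul {W : Type} (val : W → Bool) (L : QLayer G W) (a : ℂ)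
    (ψ : QState Q) : L.apply val (a • ψ) = a • L.apply val ψ := by
  unfold QLayer.apply
  generalize L.gates = l
  induction l generalizing ψ with
  | nil => rfl
  | cons g l ih => simp only [List.foldl_cons, CtrlGate.apply_smul, ih]

theorem Round.quantum_smul (r : Round G) (past : ℕ × Q → Bool) (a : ℂ) (ψ : QState Q) :
    r.quantum past (a • ψ) = a • r.quantum past ψ := by
  unfold Round.quantum
  generalize r.layers = l
  induction l generalizing ψ with
  | nil => rfl
  | cons g l ih => simp only [List.foldl_cons, QLayer.apply_smul, ih]

theorem project_smul (M : Finset Q) (o : Q → Bool) (a : ℂ) (ψ : QState Q) :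
    project M o (a • ψ) = a • project M o ψ := by
  funext x
  simp only [project, Pi.smul_apply, smul_eq_mul]
  split_ifs <;> simp

theorem runFrom_smul (o : ℕ → Q → Bool) (rs : List (Round G)) : ∀ (t : ℕ) (past : ℕ × Q → Bool)
    (a : ℂ) (ψ : QState Q), runFrom o rs t past (a • ψ) = a • runFrom o rs t past ψ := by
  induction rs with
  | nil => intros; rfl
  | cons r rs ih =>
    intro t past a ψ
    simp only [runFrom, Round.quantum_smul, project_smul, ih]

/-- The record handed to the second program depends on the branch but not on the state, so the two
programs compose as operations. -/
theorem runFrom_append (o : ℕ → Q → Bool) (rs rs' : List (Round G)) :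
    ∀ (t : ℕ) (past : ℕ × Q → Bool), ∃ past' : ℕ × Q → Bool, ∀ ψ : QState Q,
      runFrom o (rs ++ rs') t past ψ =
        runFrom o rs' (t + rs.length) past' (runFrom o rs t past ψ) := by
  induction rs with
  | nil => exact fun t past => ⟨past, fun ψ => rfl⟩
  | cons r rs ih =>
    intro t past
    obtain ⟨past', h⟩ := ih (t + 1)
      (fun a => if a.1 = t then decide (a.2 ∈ r.measured) && o t a.2 else past a)
    refine ⟨past', fun ψ => ?_⟩
    simp only [List.cons_append, runFrom, h, List.length_cons]
    congr 1
    omega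

end Linearity

/-! ### Realizable operations -/

section Realizable

variable {Q : Type} [DecidableEq Q] (G : SimpleGraph Q)

/-- Bounds on the resources that are used by a round. -/
structure RoundBound {G : SimpleGraph Q} (q d s : ℕ) (r : Round G) : Prop where
  quantumDepth_le : r.quantumDepth ≤ q
  depth_le : r.classical.depth ≤ d
  size_le : r.classicalSize ≤ s

/-- The operation `F` on the states that are supported on `X` can be performed, up to scalars, by
at most `n` rounds that start at any time and in any branch. The quantum circuits of the rounds have
depth at most `q`, the classical circuits have depth at most `d` and size at most `s`. -/
def Realizable (q d s n : ℕ) (X : Set (Q → Bool)) (F : QState Q → QState Q) : Prop :=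
  ∃ P : ℕ → List (Round G), ∀ t, (P t).length ≤ n ∧ (∀ r ∈ P t, RoundBound q d s r) ∧
    ∀ (past : ℕ × Q → Bool) (o : ℕ → Q → Bool), ∃ a : ℂ, ∀ ψ : QState Q,
      (∀ x, x ∉ X → ψ x = 0) → runFrom o (P t) t past ψ = a • F ψ

variable {G}

theorem Realizable.comp {q d s n n' : ℕ} {X Y : Set (Q → Bool)} {F H : QState Q → QState Q}
    (h : Realizable G q d s n X F) (h' : Realizable G q d s n' Y H)
    (hXY : ∀ ψ, (∀ x, x ∉ X → ψ x = 0) → ∀ x, x ∉ Y → F ψ x = 0) :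
    Realizable G q d s (n + n') X (fun ψ => H (F ψ)) := by
  obtain ⟨P, hP⟩ := h
  obtain ⟨P', hP'⟩ := h'
  refine ⟨fun t => P t ++ P' (t + (P t).length), fun t => ⟨?_, ?_, fun past o => ?_⟩⟩
  · have := (hP t).1
    have := (hP' (t + (P t).length)).1
    rw [List.length_append]
    omega
  · intro r hr
    rcases List.mem_append.1 hr with hr | hr
    · exact (hP _).2.1 r hr
    · exact (hP' _).2.1 r hr
  · obtain ⟨past', hp⟩ := runFrom_append o (P t) (P' (t + (P t).length)) t past
    obtain ⟨a, ha⟩ := (hP t).2.2 past o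
    obtain ⟨b, hb⟩ := (hP' (t + (P t).length)).2.2 past' o
    refine ⟨a * b, fun ψ hψ => ?_⟩
    rw [hp, ha ψ hψ, runFrom_smul, hb _ (hXY ψ hψ), smul_smul]

theorem Realizable.congr {q d s n n' : ℕ} {X Y : Set (Q → Bool)} {F H : QState Q → QState Q}
    (h : Realizable G q d s n X F) (hn : n ≤ n') (hY : Y ⊆ X)
    (hF : ∀ ψ, (∀ x, x ∉ Y → ψ x = 0) → F ψ = H ψ) : Realizable G q d s n' Y H := by
  obtain ⟨P, hP⟩ := h
  refine ⟨P, fun t => ⟨(hP t).1.trans hn, (hP t).2.1, fun past o => ?_⟩⟩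
  obtain ⟨a, ha⟩ := (hP t).2.2 past o
  exact ⟨a, fun ψ hψ => by rw [ha ψ fun x hx => hψ x fun hxY => hx (hY hxY), hF ψ hψ]⟩

end Realizable

/-! ### Gates and layers -/

section Layers

/-- The sign `-1` or `1`. -/
noncomputable def sgn (b : Bool) : ℂ := if b then -1 else 1

@[simp] theorem sgn_false : sgn false = 1 := rfl

@[simp] theorem sgn_true : sgn true = -1 := rfl

theorem sgn_mul_self (b : Bool) : sgn b * sgn b = 1 := by cases b <;> simp

theorem sgn_xor (a b : Bool) : sgn (xor a b) = sgn a * sgn b := by cases a <;> cases b <;> simp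

theorem sgn_parity_and {α : Type} (S : Finset α) (f : α → Bool) (b : Bool) :
    sgn (parity S f && b) = ∏ a ∈ S, sgn (f a && b) := by
  classical
  induction S using Finset.induction_on with
  | empty => simp [parity_empty]
  | insert a S h ih =>
    rw [Finset.prod_insert h, ← ih, parity_insert h, ← sgn_xor]
    congr 1
    cases f a <;> cases b <;> cases parity S f <;> rfl

theorem sqrt_two_inv_sq : ((√2 : ℝ) : ℂ)⁻¹ * ((√2 : ℝ) : ℂ)⁻¹ = 1 / 2 := by
  rw [← mul_inv, ← Complex.ofReal_mul, Real.mul_self_sqrt (by norm_num)]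
  norm_num

/-- The Hadamard gate. -/
noncomputable def hadamard : Matrix.unitaryGroup Bool ℂ :=
  ⟨Matrix.of fun a b => ((√2 : ℝ) : ℂ)⁻¹ * sgn (a && b), by
    rw [Matrix.mem_unitaryGroup_iff]
    have h := sqrt_two_inv_sq
    ext a b
    cases a <;> cases b <;>
      simp [Matrix.mul_apply, Matrix.star_apply, Complex.conj_ofReal] <;>
      linear_combination (2 : ℂ) * h⟩

theorem hadamard_apply (a b : Bool) :
    (hadamard : Matrix Bool Bool ℂ) a b = ((√2 : ℝ) : ℂ)⁻¹ * sgn (a && b) := rfl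

/-- The gate that flips a qubit. -/
def flipGate : Matrix.unitaryGroup Bool ℂ :=
  ⟨Matrix.of fun a b => if a = !b then 1 else 0, by
    rw [Matrix.mem_unitaryGroup_iff]
    ext a b
    cases a <;> cases b <;> simp [Matrix.mul_apply, Matrix.star_apply]⟩

/-- The gate that multiplies the amplitude of `|1⟩` by the phase of angle `θ`. -/
noncomputable def phaseGate (θ : ℝ) : Matrix.unitaryGroup Bool ℂ :=
  ⟨Matrix.diagonal fun b => if b then Complex.exp (θ * Complex.I) else 1, by
    rw [Matrix.mem_unitaryGroup_iff, Matrix.star_eq_conjTranspose, Matrix.diagonal_conjTranspose,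
      Matrix.diagonal_mul_diagonal, ← Matrix.diagonal_one]
    congr 1
    funext b
    cases b
    · simp
    · simp only [if_true, Pi.star_apply, RCLike.star_def, ← Complex.exp_conj, ← Complex.exp_add]
      simp⟩

theorem phaseGate_pi_apply (a b : Bool) :
    (phaseGate Real.pi : Matrix Bool Bool ℂ) a b = if a = b then sgn a else 0 := by
  cases a <;> cases b <;> simp [phaseGate, Complex.exp_pi_mul_I]

variable {Q : Type} [DecidableEq Q] {G : SimpleGraph Q} {κ W : Type} [Fintype κ]

/-- A layer that consists of a family of gates. -/
noncomputable def mkLayer (g : κ → CtrlGate G W)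
    (h : Pairwise fun k k' => Disjoint (g k).gate.support (g k').gate.support) : QLayer G W where
  gates := Finset.univ.toList.map g
  disjoint := List.pairwise_map.2
    ((Finset.nodup_toList Finset.univ).imp fun {_ _} hk => h hk)

theorem mkLayer_apply (g : κ → CtrlGate G W) (h) (val : W → Bool) (ψ : QState Q) :
    (mkLayer g h).apply val ψ =
      (Finset.univ : Finset κ).toList.foldl (fun φ k => (g k).apply val φ) ψ := by
  simp only [QLayer.apply, mkLayer, List.foldl_map]

theorem disjoint_singleton_support {t : κ → Q} (ht : Injective t) :
    Pairwise fun k k' => Disjoint ({t k} : Finset Q) {t k'} := fun _ _ h =>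
  Finset.disjoint_singleton.2 (ht.ne h)

theorem disjoint_pair_support {c t : κ → Q} (hc : Injective c) (ht : Injective t)
    (hct : ∀ k k', c k ≠ t k') :
    Pairwise fun k k' => Disjoint ({c k, t k} : Finset Q) {c k', t k'} := fun k k' h => by
  simp only [Finset.disjoint_insert_left, Finset.disjoint_singleton_left, Finset.mem_insert,
    Finset.mem_singleton, not_or]
  exact ⟨⟨hc.ne h, hct k k'⟩, (hct k' k).symm, ht.ne h⟩

/-- The layer of the gates `CNOT` from `c k` to `t k`. -/
noncomputable def cnotLayer (W : Type) (c t : κ → Q) (hc : Injective c) (ht : Injective t)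
    (hct : ∀ k k', c k ≠ t k') (hadj : ∀ k, G.Adj (c k) (t k)) : QLayer G W :=
  mkLayer (fun k => ⟨.cnot (c k) (t k) (hadj k), none⟩) (disjoint_pair_support hc ht hct)

/-- A layer of single-qubit gates. -/
noncomputable def singleLayer {W : Type} (u : κ → Matrix.unitaryGroup Bool ℂ) (t : κ → Q)
    (w : κ → Option W) (ht : Injective t) : QLayer G W :=
  mkLayer (fun k => ⟨.single (u k) (t k), w k⟩) (disjoint_singleton_support ht)

/-- Flips of distinct qubits whose conditions read no flipped qubit act simultaneously. The final
point `y` is described by its values, not by a formula, so that the induction can replace it by `y`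
with one flip undone. -/
theorem foldl_flip {A : κ → QState Q → QState Q} {t : κ → Q} {c : κ → (Q → Bool) → Bool}
    (hA : ∀ k ψ x, A k ψ x = ψ (update x (t k) (xor (x (t k)) (c k x))))
    (hc : ∀ k k' x b, c k (update x (t k') b) = c k x) (ht : Injective t) (l : List κ) :
    l.Nodup → ∀ (ψ : QState Q) (x y : Q → Bool), (∀ p, (∀ k ∈ l, t k ≠ p) → y p = x p) →
      (∀ k ∈ l, y (t k) = xor (x (t k)) (c k x)) → l.foldl (fun φ k => A k φ) ψ x = ψ y := by
  induction l with
  | nil =>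
    intro _ ψ x y h _
    rw [show y = x from funext fun p => h p (by simp)]
    rfl
  | cons k l ih =>
    intro hl ψ x y h h'
    obtain ⟨hk, hl⟩ := List.nodup_cons.1 hl
    have hne : ∀ k' ∈ l, t k' ≠ t k := fun k' hk' he => hk (ht he ▸ hk')
    have hcl : ∀ l' : List κ, ∀ z, (∀ p, (∀ k ∈ l', t k ≠ p) → z p = x p) → c k z = c k x := by
      intro l'
      induction l' with
      | nil => intro z hz; rw [show z = x from funext fun p => hz p (by simp)]
      | cons a l' ih' =>
        intro z hz
        rw [← hc k a z (x (t a))]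
        refine ih' _ fun p hp => ?_
        by_cases hpa : p = t a
        · subst hpa; simp
        · rw [update_of_ne hpa]
          exact hz p fun k hk => by
            rcases List.mem_cons.1 hk with rfl | hk
            · exact fun h => hpa h.symm
            · exact hp k hk
    rw [List.foldl_cons, ih hl (A k ψ) x (update y (t k) (x (t k))), hA]
    · congr 1
      rw [hc, hcl (k :: l) y h, update_self, update_idem, ← h' k (by simp), update_eq_self]
    · intro p hp
      by_cases hpk : p = t k
      · subst hpk; simp
      · rw [update_of_ne hpk]
        exact h p fun k' hk' => by
          rcases List.mem_cons.1 hk' with rfl | hk'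
          · exact fun h => hpk h.symm
          · exact hp k' hk'
    · intro k' hk'
      rw [update_of_ne (hne k' hk')]
      exact h' k' (by simp [hk'])

theorem foldl_flip_univ {A : κ → QState Q → QState Q} {t : κ → Q} {c : κ → (Q → Bool) → Bool}
    (hA : ∀ k ψ x, A k ψ x = ψ (update x (t k) (xor (x (t k)) (c k x))))
    (hc : ∀ k k' x b, c k (update x (t k') b) = c k x) (ht : Injective t) (ψ : QState Q) :
    (Finset.univ : Finset κ).toList.foldl (fun φ k => A k φ) ψ =
      fun x => ψ (extend t (fun k => xor (x (t k)) (c k x)) x) := by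
  funext x
  refine foldl_flip hA hc ht _ (Finset.nodup_toList _) ψ x _ (fun p hp => ?_) fun k _ => ?_
  · exact extend_apply' _ _ _ fun ⟨k, hk⟩ => hp k (by simp) hk
  · exact ht.extend_apply _ _ _

theorem cnotLayer_apply (c t : κ → Q) (hc : Injective c) (ht : Injective t)
    (hct : ∀ k k', c k ≠ t k') (hadj : ∀ k, G.Adj (c k) (t k)) (val : W → Bool) (ψ : QState Q) :
    (cnotLayer W c t hc ht hct hadj).apply val ψ =
      fun x => ψ (extend t (fun k => xor (x (t k)) (x (c k))) x) := by
  refine (mkLayer_apply _ _ val ψ).trans ?_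
  exact foldl_flip_univ (c := fun k x => x (c k)) (fun k ψ x => rfl)
    (fun k k' x b => update_of_ne (hct k k') _ _) ht ψ

theorem single_flipGate_apply (p : Q) (ψ : QState Q) (x : Q → Bool) :
    (QGate.single (G := G) flipGate p).apply ψ x = ψ (update x p (!(x p))) := by
  simp only [QGate.apply, flipGate, Fintype.sum_bool, Matrix.of_apply]
  cases x p <;> simp

theorem flipLayer_apply (t : κ → Q) (w : κ → W) (ht : Injective t) (val : W → Bool)
    (ψ : QState Q) :
    (singleLayer (G := G) (fun _ => flipGate) t (fun k => some (w k)) ht).apply val ψ =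
      fun x => ψ (extend t (fun k => xor (x (t k)) (val (w k))) x) := by
  refine (mkLayer_apply _ _ val ψ).trans ?_
  refine foldl_flip_univ (c := fun k _ => val (w k)) (fun k ψ x => ?_) (fun k k' x b => rfl) ht ψ
  simp only [CtrlGate.apply]
  cases h : val (w k)
  · simp [update_eq_self]
  · simp [single_flipGate_apply]

theorem foldl_phase {A : κ → QState Q → QState Q} {m : κ → (Q → Bool) → ℂ}
    (hA : ∀ k ψ x, A k ψ x = m k x * ψ x) (ψ : QState Q) :
    (Finset.univ : Finset κ).toList.foldl (fun φ k => A k φ) ψ = fun x => (∏ k, m k x) * ψ x := by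
  have key : ∀ (l : List κ) (ψ : QState Q), l.foldl (fun φ k => A k φ) ψ =
      fun x => (l.map fun k => m k x).prod * ψ x := by
    intro l
    induction l with
    | nil => intro ψ; simp
    | cons k l ih =>
      intro ψ
      rw [List.foldl_cons, ih]
      funext x
      rw [hA, List.map_cons, List.prod_cons]
      ring
  rw [key]
  funext x
  rw [Finset.prod_map_toList]

theorem signLayer_apply (t : κ → Q) (w : κ → W) (ht : Injective t) (val : W → Bool)
    (ψ : QState Q) :
    (singleLayer (G := G) (fun _ => phaseGate Real.pi) t (fun k => some (w k)) ht).apply val ψ =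
      fun x => (∏ k, sgn (val (w k) && x (t k))) * ψ x := by
  refine (mkLayer_apply _ _ val ψ).trans ?_
  refine foldl_phase (fun k ψ x => ?_) ψ
  simp only [CtrlGate.apply]
  cases h : val (w k)
  · simp
  · simp only [if_true, QGate.apply, Fintype.sum_bool, phaseGate_pi_apply]
    cases hx : x (t k) <;> simp [← hx, update_eq_self]

theorem phaseLayer_apply (θ : κ → ℝ) (t : κ → Q) (ht : Injective t) (val : W → Bool)
    (ψ : QState Q) :
    (singleLayer (G := G) (fun k => phaseGate (θ k)) t (fun _ => none) ht).apply val ψ =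
      fun x => (∏ k, if x (t k) then Complex.exp (θ k * Complex.I) else 1) * ψ x := by
  refine (mkLayer_apply _ _ val ψ).trans ?_
  refine foldl_phase (fun k ψ x => ?_) ψ
  simp only [CtrlGate.apply, QGate.apply, Fintype.sum_bool, phaseGate, Matrix.diagonal_apply]
  cases hx : x (t k) <;> simp [← hx, update_eq_self]

/-- A layer of Hadamard gates on qubits whose values are functions of the values of the other
qubits. -/
theorem hadamardLayer_apply (t : κ → Q) (ht : Injective t) (c : κ → (Q → Bool) → Bool)
    (hc : ∀ k k' x b, c k (update x (t k') b) = c k x) (val : W → Bool) (ψ : QState Q)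
    (hψ : ∀ x, ψ x ≠ 0 → ∀ k, x (t k) = c k x) :
    (singleLayer (G := G) (fun _ => hadamard) t (fun _ => none) ht).apply val ψ =
      fun x => (∏ k, ((√2 : ℝ) : ℂ)⁻¹ * sgn (x (t k) && c k x)) *
        ψ (extend t (fun k => c k x) x) := by
  refine (mkLayer_apply _ _ val ψ).trans ?_
  have hA : ∀ k (ψ : QState Q) x, (∀ x, ψ x ≠ 0 → x (t k) = c k x) →
      (CtrlGate.mk (QGate.single (G := G) hadamard (t k)) (none : Option W)).apply val ψ x =
        ((√2 : ℝ) : ℂ)⁻¹ * sgn (x (t k) && c k x) * ψ (update x (t k) (c k x)) := by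
    intro k ψ x hψ
    simp only [CtrlGate.apply, QGate.apply]
    -- On the support the qubit has the value `c k x`, so only one term of the Hadamard sum
    -- survives; it contributes a sign instead of a superposition of inputs.
    rw [Finset.sum_eq_single (c k x)]
    · rw [hadamard_apply]
    · intro b _ hb
      by_cases h : ψ (update x (t k) b) = 0
      · rw [h, mul_zero]
      · have := hψ _ h
        rw [update_self, hc] at this
        exact (hb this).elim
    · simp
  have key : ∀ l : List κ, l.Nodup → ∀ ψ : QState Q,
      (∀ x, ψ x ≠ 0 → ∀ k ∈ l, x (t k) = c k x) → ∀ x y : Q → Bool,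
      (∀ p, (∀ k ∈ l, t k ≠ p) → y p = x p) → (∀ k ∈ l, y (t k) = c k x) →
      l.foldl (fun φ k => (CtrlGate.mk (QGate.single (G := G) hadamard (t k))
        (none : Option W)).apply val φ) ψ x =
        (l.map fun k => ((√2 : ℝ) : ℂ)⁻¹ * sgn (x (t k) && c k x)).prod * ψ y := by
    intro l
    induction l with
    | nil =>
      intro _ ψ _ x y h _
      rw [show y = x from funext fun p => h p (by simp)]
      simp
    | cons k l ih =>
      intro hl ψ hψ x y h h'
      obtain ⟨hk, hl⟩ := List.nodup_cons.1 hl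
      have hne : ∀ k' ∈ l, t k' ≠ t k := fun k' hk' he => hk (ht he ▸ hk')
      have hcl : ∀ l' : List κ, ∀ z, (∀ p, (∀ k ∈ l', t k ≠ p) → z p = x p) → c k z = c k x := by
        intro l'
        induction l' with
        | nil => intro z hz; rw [show z = x from funext fun p => hz p (by simp)]
        | cons a l' ih' =>
          intro z hz
          rw [← hc k a z (x (t a))]
          refine ih' _ fun p hp => ?_
          by_cases hpa : p = t a
          · subst hpa; simp
          · rw [update_of_ne hpa]
            exact hz p fun k hk => by
              rcases List.mem_cons.1 hk with rfl | hk
              · exact fun h => hpa h.symm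
              · exact hp k hk
      have hyk : ∀ p, (∀ k' ∈ l, t k' ≠ p) → update y (t k) (x (t k)) p = x p := by
        intro p hp
        by_cases hpk : p = t k
        · subst hpk; simp
        · rw [update_of_ne hpk]
          exact h p fun k' hk' => by
            rcases List.mem_cons.1 hk' with rfl | hk'
            · exact fun h => hpk h.symm
            · exact hp k' hk'
      rw [List.foldl_cons, ih hl _ ?_ x (update y (t k) (x (t k))) hyk, hA k ψ _ ?_]
      · rw [hc, hcl (k :: l) y h, update_self, update_idem, ← h' k (by simp), update_eq_self,
          List.map_cons, List.prod_cons, h' k (by simp)]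
        ring
      · exact fun x hx => hψ x hx k (by simp)
      · intro k' hk'
        rw [update_of_ne (hne k' hk')]
        exact h' k' (by simp [hk'])
      · intro z hz k' hk'
        rw [hA k ψ _ fun x hx => hψ x hx k (by simp)] at hz
        have := hψ _ (right_ne_zero_of_mul hz) k' (by simp [hk'])
        rwa [update_of_ne (hne k' hk'), hc] at this
  funext x
  rw [key _ (Finset.nodup_toList _) ψ (fun x hx k _ => hψ x hx k) x
    (extend t (fun k => c k x) x), Finset.prod_map_toList]
  · exact fun p hp => extend_apply' _ _ _ fun ⟨k, hk⟩ => hp k (by simp) hk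
  · exact fun k _ => ht.extend_apply _ _ _

end Layers

/-! ### Fanning out qubits along paths -/

/-- Disjoint paths in a graph that start at the qubits `home a`. They alternate between link qubits
`lnk k` and sites `site k`: the link `lnk k` lies between `site k` and `par k`, which is another
site or the qubit `home (idx k)` where the path starts. The set `mask k` consists of the sites
between `home (idx k)` and `site k`, the latter included. -/
structure Fan {Q : Type} (G : SimpleGraph Q) (L κ : Type) [DecidableEq κ] where
  home : L → Q
  site : κ → Q
  lnk : κ → Q
  par : κ → Q
  idx : κ → L
  mask : κ → Finset κ
  home_inj : Injective home
  site_inj : Injective site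
  lnk_inj : Injective lnk
  par_inj : Injective par
  site_ne_lnk : ∀ k k', site k ≠ lnk k'
  par_ne_lnk : ∀ k k', par k ≠ lnk k'
  home_ne_site : ∀ a k, home a ≠ site k
  home_ne_lnk : ∀ a k, home a ≠ lnk k
  site_adj : ∀ k, G.Adj (site k) (lnk k)
  par_adj : ∀ k, G.Adj (par k) (lnk k)
  step : ∀ k, (par k = home (idx k) ∧ mask k = {k}) ∨
    ∃ k', par k = site k' ∧ idx k = idx k' ∧ k ∉ mask k' ∧ mask k = insert k (mask k')

namespace Fan

variable {Q : Type} [DecidableEq Q] {G : SimpleGraph Q} {L κ : Type} [Fintype L] [DecidableEq L]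
  [Fintype κ] [DecidableEq κ] (F : Fan G L κ)

/-- Copy the values of the homes to the sites. -/
noncomputable def copy (x : Q → Bool) : Q → Bool := extend F.site (fun k => x (F.home (F.idx k))) x

/-- Reset the sites. -/
noncomputable def clear (x : Q → Bool) : Q → Bool := extend F.site (fun _ => false) x

theorem copy_site (x : Q → Bool) (k : κ) : F.copy x (F.site k) = x (F.home (F.idx k)) :=
  F.site_inj.extend_apply _ _ _

theorem copy_of_ne (x : Q → Bool) {p : Q} (hp : ∀ k, F.site k ≠ p) : F.copy x p = x p :=
  extend_apply' _ _ _ fun ⟨k, hk⟩ => hp k hk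

theorem copy_home (x : Q → Bool) (a : L) : F.copy x (F.home a) = x (F.home a) :=
  F.copy_of_ne x fun k h => F.home_ne_site a k h.symm

theorem clear_site (x : Q → Bool) (k : κ) : F.clear x (F.site k) = false :=
  F.site_inj.extend_apply _ _ _

theorem clear_of_ne (x : Q → Bool) {p : Q} (hp : ∀ k, F.site k ≠ p) : F.clear x p = x p :=
  extend_apply' _ _ _ fun ⟨k, hk⟩ => hp k hk

theorem clear_home (x : Q → Bool) (a : L) : F.clear x (F.home a) = x (F.home a) :=
  F.clear_of_ne x fun k h => F.home_ne_site a k h.symm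

theorem site_cases (p : Q) : (∃ k, F.site k = p) ∨ ∀ k, F.site k ≠ p := by
  by_cases h : ∃ k, F.site k = p
  · exact .inl h
  · exact .inr fun k hk => h ⟨k, hk⟩

theorem clear_copy {x : Q → Bool} (hx : ∀ k, x (F.site k) = false) : F.clear (F.copy x) = x := by
  funext p
  rcases F.site_cases p with ⟨k, rfl⟩ | h
  · rw [clear_site, hx]
  · rw [F.clear_of_ne _ h, F.copy_of_ne _ h]

theorem copy_clear {x : Q → Bool} (hx : ∀ k, x (F.site k) = x (F.home (F.idx k))) :
    F.copy (F.clear x) = x := by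
  funext p
  rcases F.site_cases p with ⟨k, rfl⟩ | h
  · rw [copy_site, clear_home, hx]
  · rw [F.copy_of_ne _ h, F.clear_of_ne _ h]

/-- The states in which the sites and the links are zero. -/
def Fresh : Set (Q → Bool) := {x | ∀ k, x (F.site k) = false ∧ x (F.lnk k) = false}

/-- The states in which the sites are copies of the homes. -/
def Copied : Set (Q → Bool) := {x | ∀ k, x (F.site k) = x (F.home (F.idx k))}

open Classical in
/-- Fanning out the homes to the sites. -/
noncomputable def fanOut (ψ : QState Q) : QState Q :=
  fun x => if x ∈ F.Copied then ψ (F.clear x) else 0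

open Classical in
/-- The inverse operation. -/
noncomputable def fanIn (ψ : QState Q) : QState Q :=
  fun x => if ∀ k, x (F.site k) = false then ψ (F.copy x) else 0

/-- The sites are determined by the parities along the links. -/
theorem forall_xor_par_iff (x : Q → Bool) (s : κ → Bool) :
    (∀ k, xor (x (F.par k)) (x (F.site k)) = s k) ↔
      ∀ k, xor (x (F.site k)) (parity (F.mask k) s) = x (F.home (F.idx k)) := by
  -- Induction along the path: the mask of the parent is smaller by one element, and the parities
  -- telescope to the value at the home.
  have key : ∀ n k, (F.mask k).card = n → (∀ k, xor (x (F.par k)) (x (F.site k)) = s k) →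
      xor (x (F.site k)) (parity (F.mask k) s) = x (F.home (F.idx k)) := by
    intro n
    induction n using Nat.strong_induction_on with
    | _ n ih =>
      intro k hn h
      rcases F.step k with ⟨hp, hm⟩ | ⟨k', hp, hi, hk, hm⟩
      · rw [hm, parity_singleton, ← h k, ← hp]
        cases x (F.par k) <;> cases x (F.site k) <;> rfl
      · have := ih (F.mask k').card (by rw [← hn, hm, Finset.card_insert_of_notMem hk]; omega) k'
          rfl h
        rw [hm, parity_insert hk, hi, ← this, ← h k, hp]
        cases x (F.site k') <;> cases x (F.site k) <;> cases parity (F.mask k') s <;> rfl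
  refine ⟨fun h k => key _ k rfl h, fun h k => ?_⟩
  rcases F.step k with ⟨hp, hm⟩ | ⟨k', hp, hi, hk, hm⟩
  · have := h k
    rw [hm, parity_singleton] at this
    rw [hp, ← this]
    cases x (F.site k) <;> cases s k <;> rfl
  · have h₁ := h k
    have h₂ := h k'
    rw [hm, parity_insert hk, hi, ← h₂] at h₁
    rw [hp]
    revert h₁
    cases x (F.site k') <;> cases x (F.site k) <;> cases parity (F.mask k') s <;> cases s k <;> simp

/-! ### Fan-out and its inverse by measurement -/

theorem mem_wires_inl {ι : Type} {k : ℕ} (C : BoolCircuit ι k) (x : ι → Bool) (i : ι) :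
    C.wires x (Sum.inl i) = x i := rfl

/-- The first round of the fan-out: the parities along the links are measured. -/
noncomputable def outRound₁ : Round G where
  classicalSize := 0
  classical := .empty
  layers := [singleLayer (fun _ => hadamard) F.site (fun _ => none) F.site_inj,
    cnotLayer _ F.site F.lnk F.site_inj F.lnk_inj F.site_ne_lnk F.site_adj,
    cnotLayer _ F.par F.lnk F.par_inj F.lnk_inj F.par_ne_lnk F.par_adj]
  measured := Finset.univ.image F.lnk

/-- The second round of the fan-out: corrections. -/
noncomputable def outRound₂ (t : ℕ) {s : ℕ} (C : BoolCircuit (ℕ × Q) s)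
    (w : κ → (ℕ × Q) ⊕ Fin s) : Round G where
  classicalSize := s
  classical := C
  layers := [singleLayer (fun _ => flipGate) F.site (fun k => some (w k)) F.site_inj,
    singleLayer (fun _ => flipGate) F.lnk (fun k => some (Sum.inl (t, F.lnk k))) F.lnk_inj]
  measured := ∅

/-- The sites are put in |+⟩ and each link collects the parity of its two neighbours, so measuring
the links only fixes these parities. The factor does not depend on the outcomes: all of them are
equally likely. -/
theorem outRound₁_apply (past : ℕ × Q → Bool) (o : Q → Bool) (ψ : QState Q)
    (hψ : ∀ x, x ∉ F.Fresh → ψ x = 0) :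
    project F.outRound₁.measured o (F.outRound₁.quantum past ψ) = fun x =>
      if (∀ k, x (F.lnk k) = o (F.lnk k)) ∧ ∀ k, xor (x (F.par k)) (x (F.site k)) = x (F.lnk k)
      then (∏ _k : κ, ((√2 : ℝ) : ℂ)⁻¹) * ψ (F.clear (extend F.lnk (fun _ => false) x)) else 0 := by
  have hH := hadamardLayer_apply (G := G) F.site F.site_inj (fun _ _ => false)
    (fun _ _ _ _ => rfl) ((BoolCircuit.empty).wires past) ψ (fun x hx k => by
      by_contra h
      exact hx (hψ x fun hf => h (hf k).1))
  simp only [Round.quantum, outRound₁, List.foldl_cons, List.foldl_nil, hH, cnotLayer_apply,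
    Bool.and_false, sgn_false, mul_one]
  funext x
  simp only [project, Finset.mem_image, Finset.mem_univ, true_and, forall_exists_index,
    forall_apply_eq_imp_iff, ite_and]
  refine if_congr Iff.rfl ?_ rfl
  -- Amplitudes are pulled back, so the later layer of CNOT gates is undone first.
  set y := extend F.lnk (fun k => xor (x (F.lnk k)) (x (F.par k))) x with hy
  set z := extend F.lnk (fun k => xor (y (F.lnk k)) (y (F.site k))) y with hz
  have hys : ∀ k, y (F.site k) = x (F.site k) := fun k =>
    extend_apply' _ _ _ fun ⟨k', hk⟩ => F.site_ne_lnk k k' hk.symm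
  have hzl : ∀ k, z (F.lnk k) = xor (xor (x (F.lnk k)) (x (F.par k))) (x (F.site k)) := fun k => by
    rw [hz, F.lnk_inj.extend_apply, hys, hy, F.lnk_inj.extend_apply]
  have hzn : ∀ p, (∀ k, F.lnk k ≠ p) → z p = x p := fun p hp => by
    rw [hz, extend_apply' _ _ _ fun ⟨k, hk⟩ => hp k hk, hy,
      extend_apply' _ _ _ fun ⟨k, hk⟩ => hp k hk]
  have hcz : ∀ k, F.clear z (F.lnk k) = z (F.lnk k) := fun k =>
    F.clear_of_ne z fun k' => F.site_ne_lnk k' k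
  split_ifs with h
  · congr 2
    change F.clear z = _
    funext p
    rcases F.site_cases p with ⟨k, rfl⟩ | hp
    · rw [clear_site, clear_site]
    · rw [F.clear_of_ne _ hp, F.clear_of_ne _ hp]
      by_cases hl : ∃ k, F.lnk k = p
      · obtain ⟨k, rfl⟩ := hl
        rw [hzl, F.lnk_inj.extend_apply, ← h k]
        cases x (F.par k) <;> cases x (F.site k) <;> rfl
      · rw [extend_apply' _ _ _ hl, hzn p fun k hk => hl ⟨k, hk⟩]
  · have : ψ (F.clear z) = 0 := by
      by_contra hne
      refine h fun k => ?_
      by_contra hk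
      refine hne (hψ _ fun hf => hk ?_)
      have := (hf k).2
      rw [hcz, hzl] at this
      revert this
      cases x (F.par k) <;> cases x (F.site k) <;> cases x (F.lnk k) <;> simp
    change _ * ψ (F.clear z) = 0
    rw [this, mul_zero]

theorem project_empty (o : Q → Bool) (ψ : QState Q) : project ∅ o ψ = ψ := by
  funext x
  simp [project]

/-- Fanning out takes two rounds. -/
theorem realizable_fanOut {l : ℕ} (hl : ∀ k, (F.mask k).card ≤ 2 ^ l) {q : ℕ} (hq : 3 ≤ q) :
    Realizable G q (3 * l) (Fintype.card κ * (5 * 2 ^ l)) 2 F.Fresh F.fanOut := by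
  have hinj : ∀ t : ℕ, Injective fun k => (t, F.lnk k) := fun t k k' h =>
    F.lnk_inj (Prod.ext_iff.1 h).2
  choose s C w hs hd hw using fun t : ℕ => BoolCircuit.exists_parities
    (fun k => (F.mask k).map ⟨fun k => (t, F.lnk k), hinj t⟩) l (by simpa using hl)
  refine ⟨fun t => [F.outRound₁, F.outRound₂ t (C t) (w t)], fun t => ⟨by simp, ?_, ?_⟩⟩
  · intro r hr
    simp only [List.mem_cons, List.not_mem_nil, or_false] at hr
    rcases hr with rfl | rfl
    · exact ⟨by simpa [Round.quantumDepth, outRound₁] using hq,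
        by simp [outRound₁, BoolCircuit.depth], by simp [outRound₁]⟩
    · exact ⟨by simp [Round.quantumDepth, outRound₂]; omega, hd t, hs t⟩
  · intro past o
    -- One factor 1/√2 per site, the same in every branch.
    refine ⟨∏ _k : κ, ((√2 : ℝ) : ℂ)⁻¹, fun ψ hψ => ?_⟩
    simp only [runFrom]
    rw [F.outRound₁_apply past (o t) ψ hψ]
    set past' : ℕ × Q → Bool := fun a => if a.1 = t then
      decide (a.2 ∈ F.outRound₁.measured) && o t a.2 else past a with hpast
    have hp : ∀ k, past' (t, F.lnk k) = o t (F.lnk k) := fun k => by simp [hpast, outRound₁]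
    have hm : ∀ k, (C t).wires past' (w t k) = parity (F.mask k) fun k => o t (F.lnk k) := fun k => by
      rw [hw, parity_map]
      congr 1
      funext k
      exact hp k
    simp only [Round.quantum, outRound₂, List.foldl_cons, List.foldl_nil, flipLayer_apply,
      project_empty, mem_wires_inl, hp, hm]
    funext x
    set y := extend F.lnk (fun k => xor (x (F.lnk k)) (o t (F.lnk k))) x with hy
    set z := extend F.site (fun k => xor (y (F.site k))
      (parity (F.mask k) fun k => o t (F.lnk k))) y with hz
    have hyn : ∀ p, (∀ k, F.lnk k ≠ p) → y p = x p := fun p hp =>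
      extend_apply' _ _ _ fun ⟨k, hk⟩ => hp k hk
    have hzn : ∀ p, (∀ k, F.site k ≠ p) → z p = y p := fun p hp =>
      extend_apply' _ _ _ fun ⟨k, hk⟩ => hp k hk
    have hzl : ∀ k, z (F.lnk k) = xor (x (F.lnk k)) (o t (F.lnk k)) := fun k => by
      rw [hzn _ fun k' => F.site_ne_lnk k' k, hy, F.lnk_inj.extend_apply]
    have hzs : ∀ k, z (F.site k) = xor (x (F.site k))
        (parity (F.mask k) fun k => o t (F.lnk k)) := fun k => by
      rw [hz, F.site_inj.extend_apply, hyn _ fun k' h => F.site_ne_lnk k k' h.symm]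
    have hzh : ∀ a, z (F.home a) = x (F.home a) := fun a => by
      rw [hzn _ fun k' h => F.home_ne_site a k' h.symm, hyn _ fun k' h => F.home_ne_lnk a k' h.symm]
    have hclear : (∀ k, x (F.lnk k) = false) →
        F.clear (extend F.lnk (fun _ => false) z) = F.clear x := fun h0 => by
      funext p
      rcases F.site_cases p with ⟨k, rfl⟩ | hp
      · rw [clear_site, clear_site]
      · rw [F.clear_of_ne _ hp, F.clear_of_ne _ hp]
        by_cases hl : ∃ k, F.lnk k = p
        · obtain ⟨k, rfl⟩ := hl
          rw [F.lnk_inj.extend_apply, h0]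
        · rw [extend_apply' _ _ _ hl, hzn p hp, hyn p fun k hk => hl ⟨k, hk⟩]
    -- Flipping each site by the parity of the outcomes between it and its home turns the measured
    -- parity constraints into "site = home"; flipping the links by their outcomes resets them.
    have hiff : ((∀ k, z (F.lnk k) = o t (F.lnk k)) ∧
        ∀ k, xor (z (F.par k)) (z (F.site k)) = z (F.lnk k)) ↔
        (∀ k, x (F.lnk k) = false) ∧ x ∈ F.Copied := by
      have h1 : (∀ k, z (F.lnk k) = o t (F.lnk k)) ↔ ∀ k, x (F.lnk k) = false := by
        refine forall_congr' fun k => ?_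
        rw [hzl]
        cases x (F.lnk k) <;> cases o t (F.lnk k) <;> simp
      rw [h1]
      refine and_congr_right fun h0 => ?_
      have h2 : ∀ k, z (F.lnk k) = o t (F.lnk k) := h1.2 h0
      simp only [h2]
      rw [F.forall_xor_par_iff z fun k => o t (F.lnk k)]
      refine forall_congr' fun k => ?_
      rw [hzs, hzh]
      simp
    simp only [Pi.smul_apply, smul_eq_mul, fanOut]
    by_cases h : (∀ k, x (F.lnk k) = false) ∧ x ∈ F.Copied
    · rw [if_pos (hiff.2 h), if_pos h.2, hclear h.1]
    · rw [if_neg fun h' => h (hiff.1 h')]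
      split_ifs with hc
      · rw [hψ _ fun hf => h ⟨fun k => ?_, hc⟩, mul_zero]
        rw [← (hf k).2, F.clear_of_ne x fun k' => F.site_ne_lnk k' k]
      · rw [mul_zero]

/-- The first round of the inverse operation: the sites are measured in the Hadamard basis. -/
noncomputable def inRound₁ : Round G where
  classicalSize := 0
  classical := .empty
  layers := [singleLayer (fun _ => hadamard) F.site (fun _ => none) F.site_inj]
  measured := Finset.univ.image F.site

/-- The second round of the inverse operation: corrections. -/
noncomputable def inRound₂ (t : ℕ) {s : ℕ} (C : BoolCircuit (ℕ × Q) s)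
    (w : L → (ℕ × Q) ⊕ Fin s) : Round G where
  classicalSize := s
  classical := C
  layers := [singleLayer (fun _ => phaseGate Real.pi) F.home (fun a => some (w a)) F.home_inj,
    singleLayer (fun _ => flipGate) F.site (fun k => some (Sum.inl (t, F.site k))) F.site_inj]
  measured := ∅

/-- Undoing the fan-out takes two rounds. -/
theorem realizable_fanIn {l : ℕ} (hl : ∀ a, (Finset.univ.filter fun k => F.idx k = a).card ≤ 2 ^ l)
    {q : ℕ} (hq : 2 ≤ q) :
    Realizable G q (3 * l) (Fintype.card L * (5 * 2 ^ l)) 2 F.Copied F.fanIn := by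
  have hinj : ∀ t : ℕ, Injective fun k => (t, F.site k) := fun t k k' h =>
    F.site_inj (Prod.ext_iff.1 h).2
  choose s C w hs hd hw using fun t : ℕ => BoolCircuit.exists_parities
    (fun a => (Finset.univ.filter fun k => F.idx k = a).map ⟨fun k => (t, F.site k), hinj t⟩) l
    (by simpa using hl)
  refine ⟨fun t => [F.inRound₁, F.inRound₂ t (C t) (w t)], fun t => ⟨by simp, ?_, ?_⟩⟩
  · intro r hr
    simp only [List.mem_cons, List.not_mem_nil, or_false] at hr
    rcases hr with rfl | rfl
    · exact ⟨by simp [Round.quantumDepth, inRound₁]; omega,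
        by simp [inRound₁, BoolCircuit.depth], by simp [inRound₁]⟩
    · exact ⟨by simpa [Round.quantumDepth, inRound₂] using hq, hd t, hs t⟩
  · intro past o
    refine ⟨∏ _k : κ, ((√2 : ℝ) : ℂ)⁻¹, fun ψ hψ => ?_⟩
    simp only [runFrom]
    set past' : ℕ × Q → Bool := fun a => if a.1 = t then
      decide (a.2 ∈ F.inRound₁.measured) && o t a.2 else past a with hpast
    have hp : ∀ k, past' (t, F.site k) = o t (F.site k) := fun k => by simp [hpast, inRound₁]
    have hm : ∀ a, (C t).wires past' (w t a) =
        parity (Finset.univ.filter fun k => F.idx k = a) fun k => o t (F.site k) := fun k => by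
      rw [hw, parity_map]
      congr 1
      funext k
      exact hp k
    -- After a fan-out every site is a function of its home, so the Hadamard gate leaves the sign
    -- (-1)^(site · home).
    have hH := hadamardLayer_apply (G := G) F.site F.site_inj (fun k x => x (F.home (F.idx k)))
      (fun k k' x b => update_of_ne (F.home_ne_site _ _) _ _)
      ((BoolCircuit.empty).wires past) ψ (fun x hx k => by
        by_contra h
        exact hx (hψ x fun hf => h (hf k)))
    simp only [Round.quantum, inRound₁, inRound₂, List.foldl_cons, List.foldl_nil, hH,
      flipLayer_apply, signLayer_apply, project_empty, mem_wires_inl, hp, hm]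
    funext x
    set y := extend F.site (fun k => xor (x (F.site k)) (o t (F.site k))) x with hy
    have hys : ∀ k, y (F.site k) = xor (x (F.site k)) (o t (F.site k)) := fun k =>
      F.site_inj.extend_apply _ _ _
    have hyn : ∀ p, (∀ k, F.site k ≠ p) → y p = x p := fun p hp =>
      extend_apply' _ _ _ fun ⟨k, hk⟩ => hp k hk
    have hyh : ∀ a, y (F.home a) = x (F.home a) := fun a =>
      hyn _ fun k h => F.home_ne_site a k h.symm
    have hiff : (∀ p ∈ Finset.univ.image F.site, y p = o t p) ↔ ∀ k, x (F.site k) = false := by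
      simp only [Finset.mem_image, Finset.mem_univ, true_and, forall_exists_index,
        forall_apply_eq_imp_iff, hys]
      refine forall_congr' fun k => ?_
      cases x (F.site k) <;> cases o t (F.site k) <;> simp
    have hcopy : extend F.site (fun k => x (F.home (F.idx k))) y = F.copy x := by
      funext p
      rcases F.site_cases p with ⟨k, rfl⟩ | hp
      · rw [copy_site, F.site_inj.extend_apply]
      · rw [F.copy_of_ne _ hp, extend_apply' _ _ _ fun ⟨k, hk⟩ => hp k hk, hyn p hp]
    simp only [Pi.smul_apply, smul_eq_mul, fanIn, project, hiff, hyh]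
    split_ifs with h
    -- Each home gets one Z correction for the parity of the outcomes on its own sites. Grouping the
    -- sites by homes shows that the corrections cancel exactly the signs left by the measurements.
    · have hsgn : (∏ a, sgn (parity (Finset.univ.filter fun k => F.idx k = a)
          (fun k => o t (F.site k)) && x (F.home a))) =
          ∏ k, sgn (y (F.site k) && x (F.home (F.idx k))) := by
        rw [← Finset.prod_fiberwise Finset.univ F.idx]
        refine Finset.prod_congr rfl fun a _ => ?_
        rw [sgn_parity_and]
        refine Finset.prod_congr rfl fun k hk => ?_
        rw [(Finset.mem_filter.1 hk).2, hys, h k, Bool.false_xor]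
      rw [hcopy, hsgn, ← mul_assoc, ← Finset.prod_mul_distrib]
      congr 1
      refine Finset.prod_congr rfl fun k _ => ?_
      rw [mul_left_comm, sgn_mul_self, mul_one]
    · simp

/-- Phases that depend on the values of the sites become phases that depend on the values of the
homes. -/
theorem realizable_conj {l : ℕ} (hl : ∀ k, (F.mask k).card ≤ 2 ^ l)
    (hl' : ∀ a, (Finset.univ.filter fun k => F.idx k = a).card ≤ 2 ^ l) {q s n : ℕ} (hq : 3 ≤ q)
    (hs : Fintype.card κ * (5 * 2 ^ l) ≤ s) (hs' : Fintype.card L * (5 * 2 ^ l) ≤ s)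
    {Y : Set (Q → Bool)} {p : (Q → Bool) → ℂ}
    (h : Realizable G q (3 * l) s n Y fun ψ x => p x * ψ x) :
    Realizable G q (3 * l) s (n + 4) {x | x ∈ F.Fresh ∧ F.copy x ∈ Y}
      fun ψ x => p (F.copy x) * ψ x := by
  have mono : ∀ {s' n' : ℕ} {X : Set (Q → Bool)} {H : QState Q → QState Q}, s' ≤ s →
      Realizable G q (3 * l) s' n' X H → Realizable G q (3 * l) s n' X H :=
    fun hs ⟨P, hP⟩ => ⟨P, fun t => ⟨(hP t).1, fun r hr =>
      ⟨((hP t).2.1 r hr).1, ((hP t).2.1 r hr).2, ((hP t).2.1 r hr).3.trans hs⟩, (hP t).2.2⟩⟩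
  have h₁ := (mono hs (F.realizable_fanOut hl hq)).congr (Y := {x | x ∈ F.Fresh ∧ F.copy x ∈ Y})
    le_rfl (fun x hx => hx.1) (fun ψ _ => rfl)
  have h₂ := h₁.comp h (fun ψ hψ x hx => by
    unfold fanOut
    split_ifs with hc
    · refine hψ _ fun hf => hx ?_
      have := hf.2
      rwa [F.copy_clear hc] at this
    · rfl)
  -- A phase does not enlarge the support, so the sites are still copies of the homes and can be
  -- measured away. The rounds are 2 + n + 2.
  have h₃ := h₂.comp (mono hs' (F.realizable_fanIn hl' (by omega : 2 ≤ q))) (fun ψ hψ x hx => by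
    unfold fanOut
    rw [if_neg hx, mul_zero])
  refine h₃.congr (by omega) subset_rfl fun ψ hψ => ?_
  funext x
  have hcc : F.copy x ∈ F.Copied := fun k => by rw [copy_site, copy_home]
  simp only [fanIn, fanOut, hcc, if_true]
  split_ifs with h0
  · rw [F.clear_copy h0]
  · rw [hψ x fun hf => h0 fun k => (hf.1 k).1, mul_zero]

end Fan

/-! ### Interactions -/

section Interaction

variable {Q : Type} [DecidableEq Q] {G : SimpleGraph Q} {κ : Type} [Fintype κ]

/-- Phases that depend on the parities of pairs of qubits with a common neighbour. -/
theorem realizable_parityPhase {a b e : κ → Q} (ha : Injective a) (hb : Injective b)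
    (he : Injective e) (hae : ∀ k k', a k ≠ e k') (hbe : ∀ k k', b k ≠ e k')
    (hadj : ∀ k, G.Adj (a k) (e k)) (hadj' : ∀ k, G.Adj (b k) (e k)) (θ : κ → ℝ) {q d s : ℕ}
    (hq : 5 ≤ q) :
    Realizable G q d s 1 {x | ∀ k, x (e k) = false} fun ψ x =>
      (∏ k, if xor (x (a k)) (x (b k)) then Complex.exp (θ k * Complex.I) else 1) * ψ x := by
  -- The parity is collected in the idle neighbour `e`, receives its phase there and is uncomputed:
  -- five layers, no measurement.
  let r : Round G :=
    { classicalSize := 0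
      classical := .empty
      layers := [cnotLayer _ a e ha he hae hadj, cnotLayer _ b e hb he hbe hadj',
        singleLayer (fun k => phaseGate (θ k)) e (fun _ => none) he,
        cnotLayer _ b e hb he hbe hadj', cnotLayer _ a e ha he hae hadj]
      measured := ∅ }
  refine ⟨fun _ => [r], fun t => ⟨by simp, ?_, fun past o => ⟨1, fun ψ hψ => ?_⟩⟩⟩
  · intro r' hr
    rw [List.mem_singleton] at hr
    subst hr
    exact ⟨by simpa [Round.quantumDepth, r] using hq, by simp [r, BoolCircuit.depth], by simp [r]⟩
  · simp only [runFrom, Round.quantum, r, List.foldl_cons, List.foldl_nil, cnotLayer_apply,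
      phaseLayer_apply, Fan.project_empty, one_smul]
    funext x
    set f : (κ → Q) → (Q → Bool) → Q → Bool := fun a x =>
      extend e (fun k => xor (x (e k)) (x (a k))) x with hf
    change _ * ψ (f a (f b (f b (f a x)))) = _
    have fn : ∀ a x p, (∀ k, e k ≠ p) → f a x p = x p := fun a x p hp =>
      extend_apply' _ _ _ fun ⟨k, hk⟩ => hp k hk
    have fe : ∀ a x k, f a x (e k) = xor (x (e k)) (x (a k)) := fun a x k => he.extend_apply _ _ _
    have fa : ∀ a' : κ → Q, (∀ k k', a' k ≠ e k') → ∀ a x k, f a x (a' k) = x (a' k) :=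
      fun a' ha' a x k => fn a x _ fun k' h => ha' k k' h.symm
    have ff : ∀ a' : κ → Q, (∀ k k', a' k ≠ e k') → ∀ x, f a' (f a' x) = x := fun a' ha' x => by
      funext p
      by_cases hp : ∃ k, e k = p
      · obtain ⟨k, rfl⟩ := hp
        rw [fe, fe, fa a' ha']
        simp
      · rw [fn _ _ _ fun k hk => hp ⟨k, hk⟩, fn _ _ _ fun k hk => hp ⟨k, hk⟩]
    rw [ff b hbe, ff a hae]
    by_cases hx : ∀ k, x (e k) = false
    · congr 1
      refine Finset.prod_congr rfl fun k _ => ?_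
      have : f b (f a x) (e k) = xor (x (a k)) (x (b k)) := by
        rw [fe, fe, hx k, fa b hbe, Bool.false_xor]
      rw [← this]
    · rw [hψ x hx, mul_zero, mul_zero]

end Interaction

/-! ### Logical qubits -/

section Logical

open Matrix

variable {L : Type} [Fintype L] [DecidableEq L]

/-- The matrix of a tensor product of single-qubit operations. -/
def tensor (M : L → Matrix Bool Bool ℂ) : Matrix (L → Bool) (L → Bool) ℂ :=
  of fun x y => ∏ a, M a (x a) (y a)

theorem tensor_apply (M : L → Matrix Bool Bool ℂ) (x y : L → Bool) :
    tensor M x y = ∏ a, M a (x a) (y a) := rfl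

theorem tensor_mul (M N : L → Matrix Bool Bool ℂ) :
    tensor M * tensor N = tensor fun a => M a * N a := by
  ext x y
  simp only [Matrix.mul_apply, tensor_apply, ← Finset.prod_mul_distrib]
  rw [Finset.prod_univ_sum, Fintype.piFinset_univ]

theorem tensor_one : tensor (fun _ : L => 1) = 1 := by
  ext x y
  rw [tensor_apply, Matrix.one_apply]
  split_ifs with h
  · subst h
    simp
  · obtain ⟨a, ha⟩ := Function.ne_iff.1 h
    exact Finset.prod_eq_zero (Finset.mem_univ a) (Matrix.one_apply_ne ha)

theorem single_apply_eq_tensor {G : SimpleGraph L} (u : unitaryGroup Bool ℂ) (k : L)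
    (ψ : QState L) :
    (QGate.single (G := G) u k).apply ψ =
      tensor (fun a => if a = k then (u : Matrix Bool Bool ℂ) else 1) *ᵥ ψ := by
  funext x
  simp only [QGate.apply, Matrix.mulVec, dotProduct]
  rw [← Finset.sum_fiberwise Finset.univ (fun y : L → Bool => y k)]
  refine Finset.sum_congr rfl fun b _ => ?_
  rw [Finset.sum_eq_single (update x k b)]
  · rw [tensor_apply, Finset.prod_eq_single k]
    · simp
    · intro a _ ha
      rw [if_neg ha, update_of_ne ha, Matrix.one_apply_eq]
    · simp
  · intro y hy hne
    obtain ⟨a, ha⟩ := Function.ne_iff.1 hne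
    have hyk : y k = b := (Finset.mem_filter.1 hy).2
    have hak : a ≠ k := by
      rintro rfl
      simp [hyk] at ha
    rw [tensor_apply, Finset.prod_eq_zero (Finset.mem_univ a), zero_mul]
    rw [update_of_ne hak] at ha
    simp [hak, Matrix.one_apply_ne ha.symm]
  · intro h
    simp at h

theorem foldl_single_eq_tensor {G : SimpleGraph L} (u : L → unitaryGroup Bool ℂ)
    (ψ : QState L) :
    (Finset.univ : Finset L).toList.foldl
      (fun φ a => (QGate.single (G := G) (u a) a).apply φ) ψ =
      tensor (fun a => (u a : Matrix Bool Bool ℂ)) *ᵥ ψ := by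
  have key : ∀ l : List L, l.Nodup → ∀ ψ : QState L,
      l.foldl (fun φ a => (QGate.single (G := G) (u a) a).apply φ) ψ =
      tensor (fun a => if a ∈ l then (u a : Matrix Bool Bool ℂ) else 1) *ᵥ ψ := by
    intro l
    induction l with
    | nil => intro _ ψ; simp [tensor_one]
    | cons k l ih =>
      intro hl ψ
      obtain ⟨hk, hl⟩ := List.nodup_cons.1 hl
      rw [List.foldl_cons, ih hl, single_apply_eq_tensor, Matrix.mulVec_mulVec, tensor_mul]
      congr 2
      funext a
      by_cases hak : a = k
      · subst hak
        simp [hk]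
      · simp [hak]
  rw [key _ (Finset.nodup_toList _)]
  simp

/-- The phase that is the product of the phases of angles `θ a b` over all pairs of qubits whose
values differ. -/
noncomputable def pairPhase (θ : L → L → ℝ) (z : L → Bool) : ℂ :=
  ∏ ab : L × L, if xor (z ab.1) (z ab.2) then Complex.exp (θ ab.1 ab.2 * Complex.I) else 1

/-! ### Logical states placed on the grid -/

variable {Q : Type} [DecidableEq Q] {G : SimpleGraph Q} (home : L → Q)

/-- The basis states in which all qubits other than the homes are zero. -/
def homeStates : Set (Q → Bool) := {x | ∀ p, (∀ a, home a ≠ p) → x p = false}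

open Classical in
/-- The state `φ` on the homes, tensored with the zero state on all other qubits. -/
noncomputable def place (φ : QState L) : QState Q :=
  fun x => if x ∈ homeStates home then φ (fun a => x (home a)) else 0

/-- The amplitudes at the basis states in which all qubits other than the homes are zero. -/
noncomputable def unplace (ψ : QState Q) : QState L :=
  fun z => ψ (extend home z fun _ => false)

variable {home}

theorem unplace_place (hh : Injective home) (φ : QState L) : unplace home (place home φ) = φ := by
  funext z
  have : extend home z (fun _ => false) ∈ homeStates home := fun p hp =>
    extend_apply' _ _ _ fun ⟨a, ha⟩ => hp a ha
  simp only [unplace, place, this, if_true]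
  congr 1
  funext a
  exact hh.extend_apply _ _ _

theorem place_unplace (hh : Injective home) (ψ : QState Q)
    (hψ : ∀ x, x ∉ homeStates home → ψ x = 0) : place home (unplace home ψ) = ψ := by
  funext x
  unfold place unplace
  split_ifs with h
  · congr 1
    funext p
    by_cases hp : ∃ a, home a = p
    · obtain ⟨a, rfl⟩ := hp
      exact hh.extend_apply _ _ _
    · rw [extend_apply' _ _ _ hp, h p fun a ha => hp ⟨a, ha⟩]
  · exact (hψ x h).symm

theorem place_apply_of_notMem (φ : QState L) {x : Q → Bool} (hx : x ∉ homeStates home) :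
    place home φ x = 0 := if_neg hx

variable (G home)

/-- The operation with the given matrix on the homes is realizable. -/
def LRealizable (q d s n : ℕ) (M : Matrix (L → Bool) (L → Bool) ℂ) : Prop :=
  Realizable G q d s n (homeStates home) fun ψ => place home (M *ᵥ unplace home ψ)

variable {G home}

theorem LRealizable.mul (hh : Injective home) {q d s n n' : ℕ}
    {M M' : Matrix (L → Bool) (L → Bool) ℂ} (h' : LRealizable G home q d s n' M')
    (h : LRealizable G home q d s n M) : LRealizable G home q d s (n + n') (M' * M) := by
  refine (Realizable.comp h h' fun ψ _ x hx => place_apply_of_notMem _ hx).congr le_rfl subset_rfl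
    fun ψ _ => ?_
  rw [unplace_place hh, Matrix.mulVec_mulVec]

open Classical in
theorem place_single (hh : Injective home) (u : unitaryGroup Bool ℂ) (a : L) (φ : QState L) :
    (QGate.single (G := G) u (home a)).apply (place home φ) =
      place home ((QGate.single (G := (⊥ : SimpleGraph L)) u a).apply φ) := by
  funext x
  have h : ∀ b, update x (home a) b ∈ homeStates home ↔ x ∈ homeStates home := fun b =>
    forall_congr' fun p => forall_congr' fun hp => by rw [update_of_ne (hp a).symm]
  have h' : ∀ b, (fun a' => update x (home a) b (home a')) =
      update (fun a' => x (home a')) a b := fun b => by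
    funext a'
    by_cases haa : a' = a
    · subst haa; simp
    · rw [update_of_ne haa, update_of_ne (hh.ne haa)]
  have hp : ∀ b, place home φ (update x (home a) b) =
      if x ∈ homeStates home then φ (update (fun a' => x (home a')) a b) else 0 := fun b => by
    rw [place, h']
    exact if_congr (h b) rfl rfl
  simp only [QGate.apply, hp]
  simp only [place]
  split_ifs <;> simp

theorem lrealizable_tensor (hh : Injective home) (u : L → unitaryGroup Bool ℂ) {q d s : ℕ}
    (hq : 1 ≤ q) :
    LRealizable G home q d s 1 (tensor fun a => (u a : Matrix Bool Bool ℂ)) := by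
  let r : Round G :=
    { classicalSize := 0
      classical := .empty
      layers := [singleLayer u home (fun _ => none) hh]
      measured := ∅ }
  refine ⟨fun _ => [r], fun t => ⟨by simp, ?_, fun past o => ⟨1, fun ψ hψ => ?_⟩⟩⟩
  · intro r' hr
    rw [List.mem_singleton] at hr
    subst hr
    exact ⟨by simpa [Round.quantumDepth, r] using hq, by simp [r, BoolCircuit.depth], by simp [r]⟩
  · simp only [runFrom, Round.quantum, r, List.foldl_cons, List.foldl_nil, Fan.project_empty,
      one_smul]
    refine (mkLayer_apply _ _ _ ψ).trans ?_
    -- Logical qubits carry no adjacency; the graph is immaterial because only single-qubit gates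
    -- occur.
    rw [← foldl_single_eq_tensor (G := ⊥)]
    conv_lhs => rw [← place_unplace hh ψ hψ]
    generalize unplace home ψ = φ
    generalize (Finset.univ : Finset L).toList = l
    induction l generalizing φ with
    | nil => rfl
    | cons a l ih =>
      rw [List.foldl_cons, List.foldl_cons, ← ih]
      congr 1
      exact place_single (G := G) hh (u a) a φ

end Logical

/-! ### Geometry of the grid -/

section Geometry

variable {N : ℕ}

/-- A vertex of the grid. -/
def vtx (i j : ℕ) (h : i < 2 * N ∧ j < 2 * N) : Fin (2 * N) × Fin (2 * N) := (⟨i, h.1⟩, ⟨j, h.2⟩)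

theorem vtx_inj {i j i' j' : ℕ} (h : i < 2 * N ∧ j < 2 * N) (h' : i' < 2 * N ∧ j' < 2 * N) :
    vtx i j h = vtx i' j' h' ↔ i = i' ∧ j = j' := by
  simp [vtx]

theorem grid_adj_vtx {i j i' j' : ℕ} (h : i < 2 * N ∧ j < 2 * N) (h' : i' < 2 * N ∧ j' < 2 * N)
    (ha : (i = i' ∧ (j + 1 = j' ∨ j' + 1 = j)) ∨ (j = j' ∧ (i + 1 = i' ∨ i' + 1 = i))) :
    (grid (2 * N) (2 * N)).Adj (vtx i j h) (vtx i' j' h') := by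
  simp only [grid, SimpleGraph.boxProd_adj, SimpleGraph.pathGraph_adj, vtx, Fin.mk.injEq]
  tauto

/-- Pairs of numbers below `N` in increasing order. -/
abbrev OrdPair (N : ℕ) : Type := {k : Fin N × Fin N // k.1 < k.2}

theorem OrdPair.ext_val {k k' : OrdPair N} (h : k.1.1.val = k'.1.1.val)
    (h' : k.1.2.val = k'.1.2.val) : k = k' :=
  Subtype.ext (Prod.ext (Fin.ext h) (Fin.ext h'))

theorem OrdPair.lt (k : OrdPair N) : k.1.1.val < k.1.2.val ∧ k.1.2.val < N := ⟨k.2, k.1.2.2⟩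

variable {L : Type} (σ : L ≃ Fin N)

/-- The home of a logical qubit. -/
def homeVtx (a : L) : Fin (2 * N) × Fin (2 * N) :=
  vtx (2 * (σ a).val) (2 * (σ a).val + 1) (by have := (σ a).2; omega)

theorem homeVtx_injective : Injective (homeVtx σ) := fun a b h => by
  rw [homeVtx, homeVtx, vtx_inj] at h
  exact σ.injective (Fin.ext (by omega))

/-- The paths along the rows of the grid. -/
def rowFan : Fan (grid (2 * N) (2 * N)) L (OrdPair N) where
  home := homeVtx σ
  site k := vtx (2 * k.1.1.val) (2 * k.1.2.val + 1) (by have := k.lt; omega)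
  lnk k := vtx (2 * k.1.1.val) (2 * k.1.2.val) (by have := k.lt; omega)
  -- For a pair (i, i + 1) this vertex is the home (2i, 2i + 1); otherwise it is the preceding site
  -- of the row.
  par k := vtx (2 * k.1.1.val) (2 * k.1.2.val - 1) (by have := k.lt; omega)
  idx k := σ.symm k.1.1
  mask k := Finset.univ.filter fun k' => k'.1.1 = k.1.1 ∧ k'.1.2 ≤ k.1.2
  home_inj := homeVtx_injective σ
  site_inj k k' h := by
    rw [vtx_inj] at h
    exact OrdPair.ext_val (by omega) (by omega)
  lnk_inj k k' h := by
    rw [vtx_inj] at h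
    exact OrdPair.ext_val (by omega) (by omega)
  par_inj k k' h := by
    rw [vtx_inj] at h
    have := k.lt
    have := k'.lt
    exact OrdPair.ext_val (by omega) (by omega)
  site_ne_lnk k k' h := by
    rw [vtx_inj] at h
    omega
  par_ne_lnk k k' h := by
    rw [vtx_inj] at h
    have := k.lt
    omega
  home_ne_site a k h := by
    rw [homeVtx, vtx_inj] at h
    have := k.lt
    omega
  home_ne_lnk a k h := by
    rw [homeVtx, vtx_inj] at h
    omega
  site_adj k := grid_adj_vtx _ _ (by omega)
  par_adj k := grid_adj_vtx _ _ (by have := k.lt; omega)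
  step k := by
    have hk := k.lt
    by_cases h : k.1.1.val + 1 = k.1.2.val
    · left
      refine ⟨?_, ?_⟩
      · rw [homeVtx, vtx_inj]
        simp only [Equiv.apply_symm_apply, true_and]
        omega
      · ext k'
        have hk' := k'.lt
        simp only [Finset.mem_filter, Finset.mem_univ, true_and, Finset.mem_singleton]
        refine ⟨fun h' => OrdPair.ext_val (by rw [h'.1]) ?_, by rintro rfl; simp⟩
        have h1 := congrArg Fin.val h'.1
        have h2 : k'.1.2.val ≤ k.1.2.val := h'.2
        omega
    · right
      refine ⟨⟨(k.1.1, ⟨k.1.2.val - 1, by omega⟩), ?_⟩, ?_, rfl, ?_, ?_⟩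
      · change k.1.1.val < k.1.2.val - 1
        omega
      · rw [vtx_inj]
        refine ⟨rfl, ?_⟩
        change 2 * k.1.2.val - 1 = 2 * (k.1.2.val - 1) + 1
        omega
      · intro h'
        have h2 : k.1.2.val ≤ k.1.2.val - 1 := (Finset.mem_filter.1 h').2.2
        omega
      · ext k'
        have hk' := k'.lt
        simp only [Finset.mem_filter, Finset.mem_univ, true_and, Finset.mem_insert, Fin.le_def]
        constructor
        · rintro ⟨h1, h2⟩
          have h1' := congrArg Fin.val h1
          by_cases h3 : k'.1.2.val = k.1.2.val
          · exact .inl (OrdPair.ext_val h1' h3)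
          · exact .inr ⟨h1, by omega⟩
        · rintro (rfl | ⟨h1, h2⟩)
          · exact ⟨rfl, le_rfl⟩
          · exact ⟨h1, by omega⟩

/-- The paths along the columns of the grid. -/
def colFan : Fan (grid (2 * N) (2 * N)) L (OrdPair N) where
  home := homeVtx σ
  site k := vtx (2 * k.1.1.val + 1) (2 * k.1.2.val) (by have := k.lt; omega)
  lnk k := vtx (2 * k.1.1.val + 2) (2 * k.1.2.val) (by have := k.lt; omega)
  -- The path of qubit j uses column 2j, but its home (2j, 2j + 1) lies one column to the right; the
  -- path turns at the link (2j, 2j).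
  par k := vtx (if k.1.1.val + 1 = k.1.2.val then 2 * k.1.2.val else 2 * k.1.1.val + 3)
    (if k.1.1.val + 1 = k.1.2.val then 2 * k.1.2.val + 1 else 2 * k.1.2.val)
    (by have := k.lt; split_ifs <;> omega)
  idx k := σ.symm k.1.2
  mask k := Finset.univ.filter fun k' => k'.1.2 = k.1.2 ∧ k.1.1 ≤ k'.1.1
  home_inj := homeVtx_injective σ
  site_inj k k' h := by
    rw [vtx_inj] at h
    exact OrdPair.ext_val (by omega) (by omega)
  lnk_inj k k' h := by
    rw [vtx_inj] at h
    exact OrdPair.ext_val (by omega) (by omega)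
  par_inj k k' h := by
    rw [vtx_inj] at h
    have := k.lt
    have := k'.lt
    exact OrdPair.ext_val (by split_ifs at h <;> omega) (by split_ifs at h <;> omega)
  site_ne_lnk k k' h := by
    rw [vtx_inj] at h
    omega
  par_ne_lnk k k' h := by
    rw [vtx_inj] at h
    have := k.lt
    split_ifs at h <;> omega
  home_ne_site a k h := by
    rw [homeVtx, vtx_inj] at h
    omega
  home_ne_lnk a k h := by
    rw [homeVtx, vtx_inj] at h
    omega
  site_adj k := grid_adj_vtx _ _ (by omega)
  par_adj k := grid_adj_vtx _ _ (by have := k.lt; split_ifs <;> omega)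
  step k := by
    have hk := k.lt
    by_cases h : k.1.1.val + 1 = k.1.2.val
    · left
      refine ⟨?_, ?_⟩
      · rw [homeVtx, vtx_inj]
        simp only [Equiv.apply_symm_apply, h, if_true, and_self]
      · ext k'
        have hk' := k'.lt
        simp only [Finset.mem_filter, Finset.mem_univ, true_and, Finset.mem_singleton]
        refine ⟨fun h' => OrdPair.ext_val ?_ (by rw [h'.1]), by rintro rfl; simp⟩
        have h1 := congrArg Fin.val h'.1
        have h2 : k.1.1.val ≤ k'.1.1.val := h'.2
        omega
    · right
      refine ⟨⟨(⟨k.1.1.val + 1, by omega⟩, k.1.2), ?_⟩, ?_, rfl, ?_, ?_⟩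
      · change k.1.1.val + 1 < k.1.2.val
        omega
      · rw [vtx_inj, if_neg h, if_neg h]
        exact ⟨by ring, rfl⟩
      · intro h'
        have h2 : k.1.1.val + 1 ≤ k.1.1.val := (Finset.mem_filter.1 h').2.2
        omega
      · ext k'
        have hk' := k'.lt
        simp only [Finset.mem_filter, Finset.mem_univ, true_and, Finset.mem_insert, Fin.le_def]
        constructor
        · rintro ⟨h1, h2⟩
          have h1' := congrArg Fin.val h1
          by_cases h3 : k'.1.1.val = k.1.1.val
          · exact .inl (OrdPair.ext_val h3 h1')
          · exact .inr ⟨h1, by omega⟩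
        · rintro (rfl | ⟨h1, h2⟩)
          · exact ⟨rfl, le_rfl⟩
          · exact ⟨h1, by omega⟩

/-- Each unordered pair of logical qubits meets only once on the grid, so its two ordered phases are
applied together. Diagonal pairs contribute 1, since a bit never differs from itself. -/
theorem prod_ordPair (f : Fin N × Fin N → ℂ) (hf : ∀ i, f (i, i) = 1) :
    ∏ k : OrdPair N, f k.1 * f k.1.swap = ∏ ij, f ij := by
  have h₁ : ∏ k : OrdPair N, f k.1 * f k.1.swap =
      ∏ ij ∈ Finset.univ.filter (fun ij : Fin N × Fin N => ij.1 < ij.2), f ij * f ij.swap :=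
    (Finset.prod_subtype _ (by simp) fun ij => f ij * f ij.swap).symm
  have h₂ : ∏ ij ∈ Finset.univ.filter (fun ij : Fin N × Fin N => ij.1 < ij.2), f ij.swap =
      ∏ ij ∈ Finset.univ.filter (fun ij : Fin N × Fin N => ¬ ij.1 < ij.2), f ij := by
    rw [← Finset.prod_filter_mul_prod_filter_not
      (Finset.univ.filter fun ij : Fin N × Fin N => ¬ ij.1 < ij.2) (fun ij : Fin N × Fin N => ij.2 < ij.1)]
    rw [Finset.prod_eq_one (s := Finset.filter (fun ij : Fin N × Fin N => ¬ ij.2 < ij.1) _), mul_one]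
    · refine Finset.prod_bij (fun ij _ => ij.swap) ?_ ?_ ?_ ?_
      · intro ij h
        simp only [Finset.mem_filter, Finset.mem_univ, true_and] at h
        simpa using ⟨h.le, h⟩
      · intro a _ b _ h
        exact Prod.swap_injective h
      · intro ij h
        simp only [Finset.mem_filter, Finset.mem_univ, true_and] at h
        exact ⟨ij.swap, by simpa using h.2, by simp⟩
      · intros; rfl
    · rintro ⟨i, j⟩ h
      simp only [Finset.mem_filter, Finset.mem_univ, true_and, not_lt] at h
      rw [le_antisymm h.2 h.1]
      exact hf _
  rw [h₁, Finset.prod_mul_distrib, h₂, Finset.prod_filter_mul_prod_filter_not]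

variable [Fintype L] [DecidableEq L]

/-- For i < j the row copy of qubit i at (2i, 2j + 1) and the column copy of qubit j at (2i + 1, 2j)
are both adjacent to the row link (2i, 2j). That link is zero again once the fan-outs are done, so
it can carry the parity. Row and column links may coincide, as fan-out resets them. The nine rounds
are 1 + 4 + 4. -/
theorem lrealizable_diagonal (θ : L → L → ℝ) {l : ℕ} (hl : N * N ≤ 2 ^ l) :
    LRealizable (grid (2 * N) (2 * N)) (homeVtx σ) 5 (3 * l) (N * N * (5 * 2 ^ l)) 9
      (Matrix.diagonal (pairPhase θ)) := by
  have hκ : Fintype.card (OrdPair N) ≤ N * N := by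
    refine (Fintype.card_subtype_le _).trans ?_
    simp
  have hL : Fintype.card L ≤ N * N := by
    rw [Fintype.card_congr σ, Fintype.card_fin]
    exact Nat.le_mul_self N
  have hcard : ∀ S : Finset (OrdPair N), S.card ≤ 2 ^ l := fun S =>
    (Finset.card_le_univ S).trans (hκ.trans hl)
  have h₀ := realizable_parityPhase (d := 3 * l) (s := N * N * (5 * 2 ^ l)) (rowFan σ).site_inj
    (colFan σ).site_inj (rowFan σ).lnk_inj
    (rowFan σ).site_ne_lnk (fun k k' h => by rw [rowFan, colFan, vtx_inj] at h; omega)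
    (rowFan σ).site_adj (fun k => grid_adj_vtx (by have := k.lt; omega) (by have := k.lt; omega)
      (by omega))
    (fun k : OrdPair N => θ (σ.symm k.1.1) (σ.symm k.1.2) + θ (σ.symm k.1.2) (σ.symm k.1.1))
    (le_refl 5)
  have h₁ := (colFan σ).realizable_conj (fun k => hcard _) (fun a => hcard _) (by norm_num)
    (Nat.mul_le_mul_right _ hκ) (Nat.mul_le_mul_right _ hL) h₀
  have h₂ := (rowFan σ).realizable_conj (fun k => hcard _) (fun a => hcard _) (by norm_num)
    (Nat.mul_le_mul_right _ hκ) (Nat.mul_le_mul_right _ hL) h₁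
  have hrs : ∀ k k', (colFan σ).site k' ≠ (rowFan σ).site k := fun k k' h => by
    rw [rowFan, colFan, vtx_inj] at h
    omega
  refine h₂.congr le_rfl ?_ fun ψ hψ => ?_
  · intro x hx
    refine ⟨fun k => ⟨hx _ fun a => (rowFan σ).home_ne_site a k,
      hx _ fun a => (rowFan σ).home_ne_lnk a k⟩, fun k => ⟨?_, ?_⟩, fun k => ?_⟩
    · rw [(rowFan σ).copy_of_ne _ fun k' h => hrs k' k h.symm]
      exact hx _ fun a => (colFan σ).home_ne_site a k
    · rw [(rowFan σ).copy_of_ne _ fun k' h => by rw [rowFan, colFan, vtx_inj] at h; omega]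
      exact hx _ fun a => (colFan σ).home_ne_lnk a k
    · rw [(colFan σ).copy_of_ne _ fun k' h => by rw [rowFan, colFan, vtx_inj] at h; omega,
        (rowFan σ).copy_of_ne _ fun k' => (rowFan σ).site_ne_lnk k' k]
      exact hx _ fun a => (rowFan σ).home_ne_lnk a k
  · funext x
    unfold place
    split_ifs with h
    · rw [Matrix.mulVec_diagonal]
      have hx : unplace (homeVtx σ) ψ (fun a => x (homeVtx σ a)) = ψ x := by
        have := congrFun (place_unplace (homeVtx_injective σ) ψ hψ) x
        rwa [place, if_pos h] at this
      rw [hx]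
      congr 1
      rw [pairPhase, ← (Equiv.prodCongr σ.symm σ.symm).prod_comp, ← prod_ordPair]
      · refine Finset.prod_congr rfl fun k _ => ?_
        rw [(colFan σ).copy_of_ne _ fun k' => hrs k k', (rowFan σ).copy_site, (colFan σ).copy_site]
        change (if xor (x (homeVtx σ (σ.symm k.1.1)))
          ((rowFan σ).copy x ((rowFan σ).home (σ.symm k.1.2))) = true then _ else _) = _
        rw [(rowFan σ).copy_home]
        change (if xor (x (homeVtx σ (σ.symm k.1.1))) (x (homeVtx σ (σ.symm k.1.2))) = true
          then _ else _) = _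
        simp only [Equiv.prodCongr_apply, Prod.map_fst, Prod.map_snd, Prod.fst_swap, Prod.snd_swap]
        rw [Bool.xor_comm (x (homeVtx σ (σ.symm k.1.2)))]
        split_ifs
        · rw [← Complex.exp_add]
          push_cast
          ring_nf
        · simp
      · intro i
        simp
    · rw [hψ x h, mul_zero]

end Geometry

open Matrix

/-! ### Products of a bounded number of logical operations -/

section Runs

variable {L : Type} [Fintype L] [DecidableEq L]

/-- Products of `n` operations, each of which is a tensor product of single-qubit unitaries or a
product of phases that depend on the parities of pairs of qubits. -/
inductive Runs : ℕ → Matrix (L → Bool) (L → Bool) ℂ → Prop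
  | tensor (u : L → unitaryGroup Bool ℂ) : Runs 1 (tensor fun a => (u a : Matrix Bool Bool ℂ))
  | pairPhase (θ : L → L → ℝ) : Runs 1 (diagonal (pairPhase θ))
  | mul {m n : ℕ} {M N : Matrix (L → Bool) (L → Bool) ℂ} : Runs m M → Runs n N →
      Runs (n + m) (M * N)

/-- A diagonal factor costs nine rounds; a tensor product needs one and is charged the same. -/
theorem Runs.lrealizable {N : ℕ} (σ : L ≃ Fin N) {l : ℕ} (hl : N * N ≤ 2 ^ l) {n : ℕ}
    {M : Matrix (L → Bool) (L → Bool) ℂ} (h : Runs n M) :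
    LRealizable (grid (2 * N) (2 * N)) (homeVtx σ) 5 (3 * l) (N * N * (5 * 2 ^ l)) (9 * n) M := by
  induction h with
  | tensor u =>
    exact Realizable.congr (lrealizable_tensor (homeVtx_injective σ) u (by norm_num)) (by norm_num)
      subset_rfl fun _ _ => rfl
  | pairPhase θ => exact lrealizable_diagonal σ θ hl
  | mul _ _ ih ih' =>
    rw [mul_add]
    exact ih.mul (homeVtx_injective σ) ih'

/-- The number `0` or `1` of a bit. -/
def bit (b : Bool) : ℝ := if b then 1 else 0

@[simp] theorem bit_false : bit false = 0 := rfl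

@[simp] theorem bit_true : bit true = 1 := rfl

theorem tensor_diagonal (d : L → Bool → ℂ) :
    tensor (fun a => diagonal (d a)) = diagonal fun x => ∏ a, d a (x a) := by
  ext x y
  rw [tensor_apply, diagonal_apply]
  split_ifs with h
  · subst h
    simp
  · obtain ⟨a, ha⟩ := Function.ne_iff.1 h
    exact Finset.prod_eq_zero (Finset.mem_univ a) (diagonal_apply_ne _ ha)

theorem phaseGate_coe (θ : ℝ) : (phaseGate θ : Matrix Bool Bool ℂ) =
    diagonal fun b => Complex.exp ((θ * bit b : ℝ) * Complex.I) := by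
  refine congrArg diagonal (funext fun b => ?_)
  cases b <;> simp

theorem prod_exp_mul_I {α : Type} (s : Finset α) (f : α → ℝ) :
    ∏ a ∈ s, Complex.exp ((f a : ℂ) * Complex.I) =
      Complex.exp (((∑ a ∈ s, f a : ℝ) : ℂ) * Complex.I) := by
  rw [← Complex.exp_sum, Complex.ofReal_sum, Finset.sum_mul]

/-- Phases whose angle is a quadratic form in the values of the qubits. -/
noncomputable def quadPhase (c : L → ℝ) (θ : L → L → ℝ) (z : L → Bool) : ℂ :=
  Complex.exp (((∑ a, c a * bit (z a) + ∑ a, ∑ b, θ a b * (bit (z a) * bit (z b)) : ℝ) : ℂ) *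
    Complex.I)

/-- For bits, ab = (a + b - (a ⊕ b))/2: the parity terms form a `pairPhase`, and the linear
remainder is a layer of single-qubit phases. -/
theorem runs_quadPhase (c : L → ℝ) (θ : L → L → ℝ) : Runs 2 (diagonal (quadPhase c θ)) := by
  have h := (Runs.pairPhase fun a b => -(θ a b / 2)).mul
    (Runs.tensor fun a => phaseGate (c a + ∑ b, (θ a b + θ b a) / 2))
  convert h using 1
  simp only [phaseGate_coe]
  rw [tensor_diagonal, diagonal_mul_diagonal]
  congr 1
  funext z
  have hp : pairPhase (fun a b => -(θ a b / 2)) z = Complex.exp (((∑ ab : L × L,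
      -(θ ab.1 ab.2 / 2) * bit (xor (z ab.1) (z ab.2)) : ℝ) : ℂ) * Complex.I) := by
    rw [pairPhase, ← prod_exp_mul_I]
    refine Finset.prod_congr rfl fun ab _ => ?_
    cases xor (z ab.1) (z ab.2) <;> simp
  rw [hp, prod_exp_mul_I, quadPhase, ← Complex.exp_add, ← add_mul, ← Complex.ofReal_add]
  congr 3
  have hx : ∀ a b : Bool, bit (xor a b) = bit a + bit b - 2 * (bit a * bit b) := by
    intro a b
    cases a <;> cases b <;> norm_num
  have h₁ : ∑ a, (c a + ∑ b, (θ a b + θ b a) / 2) * bit (z a) = ∑ a, c a * bit (z a) +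
      (∑ a, ∑ b, θ a b / 2 * bit (z a) + ∑ a, ∑ b, θ a b / 2 * bit (z b)) := by
    rw [Finset.sum_comm (f := fun a b => θ a b / 2 * bit (z b)), ← Finset.sum_add_distrib,
      ← Finset.sum_add_distrib]
    refine Finset.sum_congr rfl fun a _ => ?_
    rw [← Finset.sum_add_distrib, add_mul, Finset.sum_mul]
    congr 1
    exact Finset.sum_congr rfl fun b _ => by ring
  rw [h₁, Fintype.sum_prod_type, add_left_comm]
  congr 1
  rw [← Finset.sum_add_distrib, ← Finset.sum_add_distrib]
  refine Finset.sum_congr rfl fun a _ => ?_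
  rw [← Finset.sum_add_distrib, ← Finset.sum_add_distrib]
  refine Finset.sum_congr rfl fun b _ => ?_
  rw [hx]
  ring

end Runs

/-! ### Controlled rotations -/

section Rotation

variable {L J : Type} [Fintype L] [DecidableEq L] [Fintype J]

/-- The matrix of the phase of angle `α` conjugated by the Hadamard gate. -/
noncomputable def hphase (α : ℝ) : Matrix Bool Bool ℂ :=
  (hadamard : Matrix Bool Bool ℂ) * (phaseGate α : Matrix Bool Bool ℂ) *
    (hadamard : Matrix Bool Bool ℂ)

theorem hphase_apply (α : ℝ) (a b : Bool) :
    hphase α a b = (1 + sgn a * sgn b * Complex.exp (α * Complex.I)) / 2 := by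
  have h := sqrt_two_inv_sq
  rw [hphase, Matrix.mul_apply]
  simp only [Fintype.sum_bool, Matrix.mul_apply, phaseGate_coe, diagonal_apply, hadamard_apply]
  cases a <;> cases b <;> simp <;>
    first
    | linear_combination (1 + Complex.exp (α * Complex.I)) * h
    | linear_combination (1 - Complex.exp (α * Complex.I)) * h

theorem exp_int_mul_pi (n : ℤ) :
    Complex.exp (((Real.pi * n : ℝ) : ℂ) * Complex.I) = sgn (decide (Odd n)) := by
  have : ((Real.pi * n : ℝ) : ℂ) * Complex.I = n * (Real.pi * Complex.I) := by
    push_cast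
    ring
  rw [this, Complex.exp_int_mul, Complex.exp_pi_mul_I]
  by_cases h : Odd n
  · simp [h, h.neg_one_zpow]
  · simp [h, (Int.not_odd_iff_even.1 h).neg_one_zpow]

/-- This is the source of exactness: at integral multiples of π the rotation is the identity or the
bit flip. -/
theorem hphase_pi_mul_int (n : ℤ) (a b : Bool) :
    hphase (Real.pi * n) a b = if a = xor b (decide (Odd n)) then 1 else 0 := by
  rw [hphase_apply, exp_int_mul_pi]
  cases a <;> cases b <;> cases decide (Odd n) <;> norm_num

open Classical in
/-- The Hadamard gate on the qubits `t j`. -/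
noncomputable def hadamardOn (t : J → L) : Matrix (L → Bool) (L → Bool) ℂ :=
  tensor fun a => ((if a ∈ Set.range t then hadamard else 1 : unitaryGroup Bool ℂ) :
    Matrix Bool Bool ℂ)

theorem hadamard_mul_self :
    (hadamard : Matrix Bool Bool ℂ) * (hadamard : Matrix Bool Bool ℂ) = 1 := by
  have h := sqrt_two_inv_sq
  ext a b
  cases a <;> cases b <;> simp [Matrix.mul_apply, hadamard_apply] <;>
    linear_combination (2 : ℂ) * h

theorem hadamardOn_mul_self (t : J → L) : hadamardOn t * hadamardOn t = 1 := by
  rw [hadamardOn, tensor_mul, ← tensor_one]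
  congr 1
  funext a
  split_ifs
  · exact hadamard_mul_self
  · simp

/-- The angle of a controlled rotation. -/
noncomputable def angle (c : J → ℝ) (θ : J → L → ℝ) (x : L → Bool) (j : J) : ℝ :=
  c j + ∑ a, θ j a * bit (x a)

/-- The phase of a controlled rotation. -/
noncomputable def rotPhase (t : J → L) (c : J → ℝ) (θ : J → L → ℝ) (z : L → Bool) : ℂ :=
  Complex.exp (((∑ j, angle c θ z j * bit (z (t j)) : ℝ) : ℂ) * Complex.I)

/-- Controlled rotations of the qubits `t j`. -/
noncomputable def rot (t : J → L) (c : J → ℝ) (θ : J → L → ℝ) :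
    Matrix (L → Bool) (L → Bool) ℂ :=
  hadamardOn t * diagonal (rotPhase t c θ) * hadamardOn t

/-- An angle affine in the bits, times the target bit, is a quadratic form; with the Hadamard layers
the count is 1 + 2 + 1. -/
theorem runs_rot (t : J → L) (c : J → ℝ) (θ : J → L → ℝ) : Runs 4 (rot t c θ) := by
  have hH : Runs 1 (hadamardOn t) := .tensor _
  have hD : Runs 2 (diagonal (rotPhase t c θ)) := by
    convert runs_quadPhase (fun a => ∑ j, if t j = a then c j else 0)
      (fun a b => ∑ j, if t j = a then θ j b else 0) using 2
    funext z
    rw [rotPhase, quadPhase]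
    congr 3
    simp only [Finset.sum_mul, ite_mul, zero_mul]
    rw [Finset.sum_comm]
    simp only [Finset.sum_ite_eq, Finset.mem_univ, if_true]
    have : ∀ a, ∑ b, ∑ j, (if t j = a then θ j b * (bit (z a) * bit (z b)) else 0) =
        ∑ j, if t j = a then ∑ b, θ j b * (bit (z a) * bit (z b)) else 0 := fun a => by
      rw [Finset.sum_comm]
      refine Finset.sum_congr rfl fun j _ => ?_
      split_ifs <;> simp
    simp only [this]
    rw [Finset.sum_comm]
    simp only [Finset.sum_ite_eq, Finset.mem_univ, if_true]
    rw [← Finset.sum_add_distrib]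
    refine Finset.sum_congr rfl fun j _ => ?_
    rw [angle, add_mul, Finset.sum_mul]
    congr 1
    exact Finset.sum_congr rfl fun a _ => by ring
  exact (hH.mul hD).mul hH

theorem rot_neg_mul_rot (t : J → L) (c : J → ℝ) (θ : J → L → ℝ) :
    rot t (-c) (-θ) * rot t c θ = 1 := by
  have hd : diagonal (rotPhase t (-c) (-θ)) * diagonal (rotPhase t c θ) = 1 := by
    rw [diagonal_mul_diagonal, ← diagonal_one]
    congr 1
    funext z
    rw [rotPhase, rotPhase, ← Complex.exp_add, ← add_mul, ← Complex.ofReal_add,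
      ← Finset.sum_add_distrib, Finset.sum_eq_zero, Complex.ofReal_zero, zero_mul, Complex.exp_zero]
    intro j _
    simp only [angle, Pi.neg_apply, neg_mul, Finset.sum_neg_distrib]
    ring
  calc rot t (-c) (-θ) * rot t c θ
      = hadamardOn t * diagonal (rotPhase t (-c) (-θ)) * (hadamardOn t * hadamardOn t) *
        diagonal (rotPhase t c θ) * hadamardOn t := by simp only [rot, Matrix.mul_assoc]
    _ = hadamardOn t * (diagonal (rotPhase t (-c) (-θ)) * diagonal (rotPhase t c θ)) *
        hadamardOn t := by rw [hadamardOn_mul_self, Matrix.mul_one]; simp only [Matrix.mul_assoc]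
    _ = 1 := by rw [hd, Matrix.mul_one, hadamardOn_mul_self]

/-- A controlled rotation acts on a basis state as a tensor product. -/
theorem rot_apply {t : J → L} (ht : Injective t) (c : J → ℝ) {θ : J → L → ℝ}
    (hθ : ∀ j j', θ j (t j') = 0) (y x : L → Bool) :
    rot t c θ y x = tensor (extend t (fun j => hphase (angle c θ x j)) fun _ => 1) y x := by
  classical
  set D : L → Matrix Bool Bool ℂ := extend t (fun j =>
    (phaseGate (angle c θ x j) : Matrix Bool Bool ℂ)) (fun _ => 1) with hD
  set H : L → Matrix Bool Bool ℂ := fun a =>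
    ((if a ∈ Set.range t then hadamard else 1 : unitaryGroup Bool ℂ) : Matrix Bool Bool ℂ) with hH
  have hH1 : ∀ a, (∀ j, t j ≠ a) → H a = 1 := fun a ha => by
    have ha' : a ∉ Set.range t := fun ⟨j, hj⟩ => ha j hj
    simp only [hH, if_neg ha']
    rfl
  have hK : (extend t (fun j => hphase (angle c θ x j)) fun _ => 1) = fun a => H a * D a * H a := by
    funext a
    by_cases ha : ∃ j, t j = a
    · obtain ⟨j, rfl⟩ := ha
      simp only [hH, hD, ht.extend_apply, Set.mem_range_self, if_true]
      rfl
    · simp [hD, extend_apply' _ _ _ ha, hH1 a fun j hj => ha ⟨j, hj⟩]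
  have hDd : tensor D = diagonal fun z => Complex.exp
      (((∑ j, angle c θ x j * bit (z (t j)) : ℝ) : ℂ) * Complex.I) := by
    have : D = fun a => diagonal fun b => Complex.exp
        ((((extend t (fun j => angle c θ x j) fun _ => 0) a * bit b : ℝ) : ℂ) * Complex.I) := by
      funext a
      by_cases ha : ∃ j, t j = a
      · obtain ⟨j, rfl⟩ := ha
        simp only [hD, ht.extend_apply, phaseGate_coe]
      · simp [hD, extend_apply' _ _ _ ha]
    rw [this, tensor_diagonal]
    congr 1
    funext z
    rw [prod_exp_mul_I]
    congr 3
    rw [← Finset.sum_subset (Finset.subset_univ (Finset.univ.image t)),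
      Finset.sum_image fun _ _ _ _ h => ht h]
    · exact Finset.sum_congr rfl fun j _ => by rw [ht.extend_apply]
    · intro a _ ha
      rw [extend_apply' _ _ _ fun ⟨j, hj⟩ => ha (by simp [← hj]), zero_mul]
  rw [hK, ← tensor_mul, ← tensor_mul, hDd, rot, Matrix.mul_apply, Matrix.mul_apply]
  refine Finset.sum_congr rfl fun z _ => ?_
  rw [Matrix.mul_diagonal, Matrix.mul_diagonal]
  by_cases hz : tensor H z x = 0
  · rw [hz, mul_zero]
    change _ * tensor H z x = 0
    rw [hz, mul_zero]
  -- The Hadamard gates change targets only, and no angle reads a target, so the angles at the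
  -- intermediate state are those at `x`.
  · have hzx : ∀ a, (∀ j, t j ≠ a) → z a = x a := by
      intro a ha
      by_contra hne
      refine hz (Finset.prod_eq_zero (Finset.mem_univ a) ?_)
      rw [hH1 a ha, Matrix.one_apply_ne hne]
    have hang : ∀ j, angle c θ z j = angle c θ x j := fun j => by
      rw [angle, angle]
      congr 1
      refine Finset.sum_congr rfl fun a _ => ?_
      by_cases ha : ∃ j, t j = a
      · obtain ⟨j', rfl⟩ := ha
        rw [hθ, zero_mul, zero_mul]
      · rw [hzx a fun j hj => ha ⟨j, hj⟩]
    simp only [rotPhase, hang]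
    rfl

/-- The basis state `x`. -/
def basis (x : L → Bool) : QState L := Pi.single x 1

/-- Flip the qubits `t j` for which `b j` is true. -/
noncomputable def flipOn (t : J → L) (b : J → Bool) (x : L → Bool) : L → Bool :=
  extend t (fun j => xor (x (t j)) (b j)) x

theorem flipOn_apply {t : J → L} (ht : Injective t) (b : J → Bool) (x : L → Bool) (j : J) :
    flipOn t b x (t j) = xor (x (t j)) (b j) := ht.extend_apply _ _ _

theorem flipOn_of_ne {t : J → L} (b : J → Bool) (x : L → Bool) {a : L} (ha : ∀ j, t j ≠ a) :
    flipOn t b x a = x a := extend_apply' _ _ _ fun ⟨j, hj⟩ => ha j hj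

theorem flipOn_flipOn {t : J → L} (ht : Injective t) (b : J → Bool) (x : L → Bool) :
    flipOn t b (flipOn t b x) = x := by
  funext a
  by_cases ha : ∃ j, t j = a
  · obtain ⟨j, rfl⟩ := ha
    rw [flipOn_apply ht, flipOn_apply ht]
    simp
  · rw [flipOn_of_ne _ _ fun j hj => ha ⟨j, hj⟩, flipOn_of_ne _ _ fun j hj => ha ⟨j, hj⟩]

theorem mulVec_basis (M : Matrix (L → Bool) (L → Bool) ℂ) (x : L → Bool) :
    M *ᵥ basis x = fun y => M y x := by
  rw [basis, mulVec_single_one]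
  rfl

theorem eq_sum_basis (φ : QState L) : φ = ∑ y, φ y • basis y := by
  funext z
  simp [basis, Finset.sum_apply, Pi.single_apply]

/-- Rotations by multiples of `π` flip qubits. -/
theorem rot_mulVec_basis {t : J → L} (ht : Injective t) (c : J → ℝ) {θ : J → L → ℝ}
    (hθ : ∀ j j', θ j (t j') = 0) (x : L → Bool) (n : J → ℤ)
    (hn : ∀ j, angle c θ x j = Real.pi * n j) :
    rot t c θ *ᵥ basis x = basis (flipOn t (fun j => decide (Odd (n j))) x) := by
  rw [mulVec_basis]
  funext y
  rw [rot_apply ht c hθ, tensor_apply, basis, Pi.single_apply]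
  have h : ∀ a, extend t (fun j => hphase (angle c θ x j)) (fun _ => 1) a (y a) (x a) =
      if y a = flipOn t (fun j => decide (Odd (n j))) x a then 1 else 0 := by
    intro a
    by_cases ha : ∃ j, t j = a
    · obtain ⟨j, rfl⟩ := ha
      rw [ht.extend_apply, flipOn_apply ht, hn, hphase_pi_mul_int]
    · rw [extend_apply' _ _ _ ha, flipOn_of_ne _ _ fun j hj => ha ⟨j, hj⟩, Matrix.one_apply]
  simp only [h]
  split_ifs with hy
  · subst hy
    simp
  · obtain ⟨a, ha⟩ := Function.ne_iff.1 hy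
    exact Finset.prod_eq_zero (Finset.mem_univ a) (if_neg ha)

end Rotation

/-! ### Exact counting -/

section Counting

variable {L J : Type} [Fintype L] [DecidableEq L] [Fintype J] [DecidableEq J] {m : ℕ}

theorem flipOn_comm {J' : Type} [Fintype J'] {t : J → L} {t' : J' → L} (ht : Injective t) (ht' : Injective t')
    (h : ∀ j j', t j ≠ t' j') (b : J → Bool) (b' : J' → Bool) (x : L → Bool) :
    flipOn t b (flipOn t' b' x) = flipOn t' b' (flipOn t b x) := by
  funext a
  by_cases ha : ∃ j, t j = a
  · obtain ⟨j, rfl⟩ := ha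
    rw [flipOn_apply ht, flipOn_of_ne b' x fun j' hj => h j j' hj.symm,
      flipOn_of_ne b' _ fun j' hj => h j j' hj.symm, flipOn_apply ht]
  · rw [flipOn_of_ne b _ fun j hj => ha ⟨j, hj⟩]
    by_cases ha' : ∃ j, t' j = a
    · obtain ⟨j, rfl⟩ := ha'
      rw [flipOn_apply ht', flipOn_apply ht', flipOn_of_ne b _ fun j hj => ha ⟨j, hj⟩]
    · rw [flipOn_of_ne b' _ fun j hj => ha' ⟨j, hj⟩, flipOn_of_ne b' _ fun j hj => ha' ⟨j, hj⟩,
        flipOn_of_ne b _ fun j hj => ha ⟨j, hj⟩]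

/-- The integer `0` or `1` of a bit. -/
def ibit (b : Bool) : ℤ := if b then 1 else 0

@[simp] theorem ibit_false : ibit false = 0 := rfl

@[simp] theorem ibit_true : ibit true = 1 := rfl

theorem bit_eq (b : Bool) : bit b = ibit b := by cases b <;> simp

/-- The values of affine forms with integral coefficients. -/
def affine (C : J → ℤ) (W : J → L → ℤ) (x : L → Bool) (j : J) : ℤ :=
  C j + ∑ a, W j a * ibit (x a)

/-- The parity of the number of common elements of two sets. -/
def dotInt (S μ : Fin m → Bool) : ℤ := ∑ k, ibit (S k && μ k)

/-- Orthogonality of the characters of (ℤ/2)^m: the sum factors into the product over k of 1 +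
(-1)^(μ k). -/
theorem sum_sign_dotInt (μ : Fin m → Bool) :
    ∑ S : Fin m → Bool, (1 - 2 * bit (decide (Odd (dotInt S μ)))) =
      if ∀ k, μ k = false then (2 : ℝ) ^ m else 0 := by
  have h : ∀ S : Fin m → Bool, (1 - 2 * bit (decide (Odd (dotInt S μ)))) =
      ∏ k, if (S k && μ k) then (-1 : ℝ) else 1 := by
    intro S
    have : ∀ s : Finset (Fin m), (1 - 2 * bit (decide (Odd (∑ k ∈ s, ibit (S k && μ k))))) =
        ∏ k ∈ s, if (S k && μ k) then (-1 : ℝ) else 1 := by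
      intro s
      induction s using Finset.induction_on with
      | empty => simp
      | insert a s ha ih =>
        rw [Finset.sum_insert ha, Finset.prod_insert ha, ← ih]
        cases S a && μ a
        · simp
        · by_cases ho : Odd (∑ k ∈ s, ibit (S k && μ k))
          · have : ¬ Odd (1 + ∑ k ∈ s, ibit (S k && μ k)) :=
              Int.not_odd_iff_even.2 (odd_one.add_odd ho)
            simp [ho, this]
            norm_num
          · have : Odd (1 + ∑ k ∈ s, ibit (S k && μ k)) :=
              odd_one.add_even (Int.not_odd_iff_even.1 ho)
            simp [ho, this]
            norm_num
    exact this Finset.univ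
  simp only [h]
  have hp := Finset.prod_univ_sum (fun _ : Fin m => (Finset.univ : Finset Bool))
    (fun k b => if (b && μ k) then (-1 : ℝ) else 1)
  rw [Fintype.piFinset_univ] at hp
  rw [← hp]
  split_ifs with hμ
  · simp [hμ]
  · push Not at hμ
    obtain ⟨k, hk⟩ := hμ
    refine Finset.prod_eq_zero (Finset.mem_univ k) ?_
    have : μ k = true := by simpa using hk
    simp [this]

variable {fl : J → L} {reg : J × Fin m → L} {par : J × (Fin m → Bool) → L}

variable (reg par) in
/-- The coefficients of the computation of parities of sets of register qubits. -/
noncomputable def parCoeff (p : J × (Fin m → Bool)) (a : L) : ℝ :=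
  ∑ k, if p.2 k = true ∧ reg (p.1, k) = a then Real.pi else 0

variable (fl par) in
/-- The coefficients of the computation of flags from parities. -/
noncomputable def flagCoeff (j : J) (a : L) : ℝ :=
  ∑ S, if par (j, S) = a then -(2 * Real.pi / 2 ^ m) else 0

theorem angle_parCoeff (x : L → Bool) (p : J × (Fin m → Bool)) :
    angle 0 (parCoeff reg) x p = Real.pi * dotInt p.2 fun k => x (reg (p.1, k)) := by
  simp only [angle, parCoeff, Pi.zero_apply, zero_add, Finset.sum_mul, dotInt]
  rw [Finset.sum_comm]
  push_cast
  rw [Finset.mul_sum]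
  refine Finset.sum_congr rfl fun k _ => ?_
  rw [← bit_eq]
  cases h : p.2 k
  · simp
  · simp [ite_mul]

theorem angle_flagCoeff (x : L → Bool) (j : J) :
    angle (fun _ => Real.pi) (flagCoeff par) x j =
      Real.pi / 2 ^ m * ∑ S : Fin m → Bool, (1 - 2 * bit (x (par (j, S)))) := by
  simp only [angle, flagCoeff, Finset.sum_mul]
  rw [Finset.sum_comm, Finset.sum_sub_distrib, ← Finset.mul_sum]
  simp only [ite_mul, zero_mul, Finset.sum_ite_eq, Finset.mem_univ, if_true, ← Finset.mul_sum]
  simp only [Finset.sum_const, Finset.card_univ, Fintype.card_pi, Fintype.card_bool,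
    Finset.prod_const, Fintype.card_fin, nsmul_eq_mul]
  have : (2 : ℝ) ^ m ≠ 0 := by positivity
  push_cast
  field_simp
  ring

/-- An exact AND of m negated bits. The parities of all subsets of the registers are written down;
their signs sum to 2^m if the registers vanish and to 0 otherwise, so scaling by π/2^m
(`angle_flagCoeff`) rotates the flag by π or by 0; then the parities are erased. Three rotations of
four operations each. -/
theorem runs_zeroFlags (hfl : Injective fl) (hpar : Injective par)
    (hfp : ∀ j p, fl j ≠ par p) (hrf : ∀ p j, reg p ≠ fl j) (hrp : ∀ p q, reg p ≠ par q) :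
    ∃ B : Matrix (L → Bool) (L → Bool) ℂ, Runs 12 B ∧ ∀ y, (∀ p, y (par p) = false) →
      B *ᵥ basis y = basis (flipOn fl (fun j => decide (∀ k, y (reg (j, k)) = false)) y) := by
  refine ⟨rot par 0 (parCoeff reg) * (rot fl (fun _ => Real.pi) (flagCoeff par) *
    rot par 0 (parCoeff reg)), (runs_rot _ _ _).mul ((runs_rot _ _ _).mul (runs_rot _ _ _)),
    fun y hy => ?_⟩
  have hθ : ∀ p q, parCoeff reg p (par q) = 0 := fun p q =>
    Finset.sum_eq_zero fun k _ => if_neg fun h => hrp _ _ h.2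
  have hθ' : ∀ j j', flagCoeff par j (fl j') = 0 := fun j j' =>
    Finset.sum_eq_zero fun S _ => if_neg fun h => hfp _ _ h.symm
  set b : J × (Fin m → Bool) → Bool := fun p =>
    decide (Odd (dotInt p.2 fun k => y (reg (p.1, k)))) with hb
  have h₁ : rot par 0 (parCoeff reg) *ᵥ basis y = basis (flipOn par b y) :=
    rot_mulVec_basis hpar 0 hθ y _ fun p => angle_parCoeff y p
  have h₂ : rot fl (fun _ => Real.pi) (flagCoeff par) *ᵥ basis (flipOn par b y) =
      basis (flipOn fl (fun j => decide (∀ k, y (reg (j, k)) = false)) (flipOn par b y)) := by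
    have := rot_mulVec_basis hfl (fun _ => Real.pi) hθ' (flipOn par b y)
      (fun j => ibit (decide (∀ k, y (reg (j, k)) = false))) fun j => by
        rw [angle_flagCoeff]
        have hpb : ∀ S, flipOn par b y (par (j, S)) = b (j, S) := fun S => by
          rw [flipOn_apply hpar, hy, Bool.false_xor]
        simp only [hpb]
        simp only [hb]
        rw [sum_sign_dotInt fun k => y (reg (j, k))]
        split_ifs with h
        · have : (2 : ℝ) ^ m ≠ 0 := by positivity
          simp only [h, implies_true, decide_true, ibit_true]
          field_simp
          norm_num
        · simp only [h, decide_false, ibit_false]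
          norm_num
    rw [this]
    congr 2
    funext j
    cases decide (∀ k, y (reg (j, k)) = false) <;> decide
  rw [← Matrix.mulVec_mulVec, ← Matrix.mulVec_mulVec, h₁, h₂]
  set c : J → Bool := fun j => decide (∀ k, y (reg (j, k)) = false)
  rw [flipOn_comm hfl hpar hfp]
  -- The flags do not enter the parities, so the same rotation erases them.
  have h₃ : rot par 0 (parCoeff reg) *ᵥ basis (flipOn par b (flipOn fl c y)) =
      basis (flipOn par b (flipOn par b (flipOn fl c y))) := by
    refine rot_mulVec_basis hpar 0 hθ _
      (fun p => dotInt p.2 fun k => y (reg (p.1, k))) fun p => ?_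
    rw [angle_parCoeff]
    congr 2
    refine congrArg _ (funext fun k => ?_)
    rw [flipOn_of_ne _ _ fun q h => hrp _ _ h.symm, flipOn_of_ne _ _ fun q h => hrf _ _ h.symm]
  rw [h₃, flipOn_flipOn hpar]

theorem hphase_two_pi_mul_int (n : ℤ) (a b : Bool) :
    hphase (Real.pi * ((2 * n : ℤ) : ℝ)) a b = if a = b then 1 else 0 := by
  rw [hphase_pi_mul_int]
  have : ¬ Odd (2 * n) := Int.not_odd_iff_even.2 (even_two_mul n)
  simp [this]

theorem exists_odd_of_not_dvd {w : ℤ} (h : ¬ (2 : ℤ) ^ m ∣ w) :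
    ∃ k : Fin m, ∃ n : ℤ, Odd n ∧ w = 2 ^ k.val * n := by
  induction m generalizing w with
  | zero => simp at h
  | succ m ih =>
    rcases Int.even_or_odd' w with ⟨v, rfl | rfl⟩
    · obtain ⟨k, n, hn, hv⟩ := ih (w := v) fun hd => h (by
        rw [pow_succ']
        exact mul_dvd_mul_left 2 hd)
      exact ⟨k.succ, n, hn, by rw [hv, Fin.val_succ, pow_succ']; ring⟩
    · exact ⟨0, 2 * v + 1, odd_two_mul_add_one v, by simp⟩

/-- Flags that indicate whether the values of affine forms are divisible by `2 ^ m` can be computed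
with the help of `m + 2 ^ m` further qubits for each flag. -/
theorem runs_affine (hfl : Injective fl) (hreg : Injective reg) (hpar : Injective par)
    (hfp : ∀ j p, fl j ≠ par p) (hrf : ∀ p j, reg p ≠ fl j) (hrp : ∀ p q, reg p ≠ par q)
    (C : J → ℤ) (W : J → L → ℤ) (hWf : ∀ j j', W j (fl j') = 0) (hWr : ∀ j p, W j (reg p) = 0) :
    ∃ E : Matrix (L → Bool) (L → Bool) ℂ, Runs 20 E ∧
      ∀ x, (∀ p, x (reg p) = false) → (∀ p, x (par p) = false) →
        E *ᵥ basis x =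
          basis (flipOn fl (fun j => decide ((2 : ℤ) ^ m ∣ affine C W x j)) x) := by
  obtain ⟨B, hB, hBx⟩ := runs_zeroFlags hfl hpar hfp hrf hrp
  -- Register k of a form with value w is rotated by π·w/2^k.
  set c : J × Fin m → ℝ := fun p => Real.pi * C p.1 / 2 ^ p.2.val with hc
  set θ : J × Fin m → L → ℝ := fun p a => Real.pi * W p.1 a / 2 ^ p.2.val with hθ
  have hθr : ∀ p q, θ p (reg q) = 0 := fun p q => by simp [hθ, hWr]
  have hang : ∀ x p, angle c θ x p = Real.pi * (affine C W x p.1 : ℤ) / 2 ^ p.2.val := fun x p => by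
    simp only [angle, hc, hθ, affine, bit_eq]
    push_cast
    rw [mul_add, add_div, Finset.mul_sum, Finset.sum_div]
    congr 1
    exact Finset.sum_congr rfl fun a _ => by ring
  refine ⟨rot reg (-c) (-θ) * (B * rot reg c θ),
    (runs_rot reg (-c) (-θ)).mul (hB.mul (runs_rot reg c θ)), fun x hx hx' => ?_⟩
  set b : J → Bool := fun j => decide ((2 : ℤ) ^ m ∣ affine C W x j) with hb
  have hτ : ∀ x, affine C W (flipOn fl b x) = affine C W x := fun x => by
    funext j
    rw [affine, affine]
    congr 1
    refine Finset.sum_congr rfl fun a _ => ?_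
    by_cases ha : ∃ j, fl j = a
    · obtain ⟨j', rfl⟩ := ha
      rw [hWf, zero_mul, zero_mul]
    · rw [flipOn_of_ne _ _ fun j hj => ha ⟨j, hj⟩]
  -- The forms do not read the flags, so the rotation commutes with flipping them.
  have hR : ∀ y, rot reg c θ (flipOn fl b y) (flipOn fl b x) = rot reg c θ y x := fun y => by
    rw [rot_apply hreg c hθr, rot_apply hreg c hθr, tensor_apply, tensor_apply]
    refine Finset.prod_congr rfl fun a _ => ?_
    by_cases ha : ∃ p, reg p = a
    · obtain ⟨p, rfl⟩ := ha
      rw [hreg.extend_apply, hreg.extend_apply, hang, hang, hτ,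
        flipOn_of_ne _ _ fun j hj => hrf p j hj.symm, flipOn_of_ne _ _ fun j hj => hrf p j hj.symm]
    · rw [extend_apply' _ _ _ ha, extend_apply' _ _ _ ha, Matrix.one_apply, Matrix.one_apply]
      refine if_congr ?_ rfl rfl
      by_cases ha' : ∃ j, fl j = a
      · obtain ⟨j, rfl⟩ := ha'
        rw [flipOn_apply hfl, flipOn_apply hfl]
        simp
      · rw [flipOn_of_ne _ _ fun j hj => ha' ⟨j, hj⟩, flipOn_of_ne _ _ fun j hj => ha' ⟨j, hj⟩]
  -- The registers are in superposition, but every `y` of nonzero amplitude gives the same answer: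
  -- the registers of `j` all vanish exactly when 2^m divides the form. Hence the flags do not
  -- become entangled with the registers.
  have hBy : ∀ y, rot reg c θ y x • (B *ᵥ basis y) =
      rot reg c θ y x • basis (flipOn fl b y) := by
    intro y
    by_cases h0 : rot reg c θ y x = 0
    · rw [h0, zero_smul, zero_smul]
    · have hne : ∀ a, extend reg (fun p => hphase (angle c θ x p)) (fun _ => 1) a (y a) (x a) ≠ 0 :=
        fun a h => h0 (by
          rw [rot_apply hreg c hθr, tensor_apply]
          exact Finset.prod_eq_zero (Finset.mem_univ a) h)
      rw [hBx y fun p => ?_]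
      · congr 3
        funext j
        simp only [hb, decide_eq_decide]
        constructor
        · intro h
          by_contra hd
          -- With k the 2-adic valuation of the form, register k turns by an odd multiple of π and
          -- is certainly 1.
          obtain ⟨k, n, hn, hw⟩ := exists_odd_of_not_dvd hd
          refine hne (reg (j, k)) ?_
          have : angle c θ x (j, k) = Real.pi * n := by
            rw [hang]
            simp only [hw]
            push_cast
            field_simp
          rw [hreg.extend_apply, this, hphase_pi_mul_int, h k, hx]
          simp [hn]
        · rintro ⟨v, hv⟩ k
          by_contra hy
          refine hne (reg (j, k)) ?_
          -- When 2^m divides the form, all angles are multiples of 2π because k < m, so no register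
          -- can have changed.
          have : angle c θ x (j, k) = Real.pi * ((2 * (2 ^ (m - 1 - k.val) * v) : ℤ) : ℝ) := by
            have hm : m = k.val + (m - 1 - k.val) + 1 := by omega
            rw [hang]
            simp only [hv]
            push_cast
            rw [div_eq_iff (by positivity)]
            conv_lhs => rw [hm, pow_succ, pow_add]
            ring
          rw [hreg.extend_apply, this, hphase_two_pi_mul_int, hx, if_neg hy]
      · by_contra hp
        refine hne (par p) ?_
        rw [extend_apply' _ _ _ fun ⟨q, hq⟩ => hrp q p hq, hx']
        exact Matrix.one_apply_ne hp
  have hsum : ∀ x', rot reg c θ *ᵥ basis x' = ∑ y, rot reg c θ y x' • basis y := fun x' => by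
    rw [mulVec_basis]
    exact eq_sum_basis _
  have key : B *ᵥ (rot reg c θ *ᵥ basis x) = rot reg c θ *ᵥ basis (flipOn fl b x) := by
    rw [hsum, hsum, Matrix.mulVec_sum]
    simp only [Matrix.mulVec_smul, hBy]
    rw [← Equiv.sum_comp (Involutive.toPerm (flipOn fl b) (flipOn_flipOn hfl b))]
    refine Finset.sum_congr rfl fun y _ => ?_
    change rot reg c θ (flipOn fl b y) x • basis (flipOn fl b (flipOn fl b y)) = _
    rw [← hR (flipOn fl b y), flipOn_flipOn hfl]
  rw [← Matrix.mulVec_mulVec, ← Matrix.mulVec_mulVec, key, Matrix.mulVec_mulVec, rot_neg_mul_rot,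
    Matrix.one_mulVec]

end Counting

/-! ### Comparison with a constant -/

section Compare

/-- The form reads only the qubits `f p`, none of which is a flag, so the same operation sets and
erases the flags. Both directions are kept for the later uncomputation. -/
theorem runs_linear {L J P : Type} [Fintype L] [DecidableEq L] [Fintype J] [DecidableEq J]
    [Fintype P] {m : ℕ} {fl : J → L} {reg : J × Fin m → L} {par : J × (Fin m → Bool) → L}
    {f : P → L} (hfl : Injective fl) (hreg : Injective reg) (hpar : Injective par)
    (hfp : ∀ j p, fl j ≠ par p) (hrf : ∀ p j, reg p ≠ fl j) (hrp : ∀ p q, reg p ≠ par q)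
    (hf : ∀ p j, f p ≠ fl j) (hr : ∀ p q, f p ≠ reg q) (C : J → ℤ) (w : J → P → ℤ) :
    ∃ E : Matrix (L → Bool) (L → Bool) ℂ, Runs 20 E ∧
      ∀ x x', (∀ p, x (reg p) = false) → (∀ p, x (par p) = false) →
        x' = flipOn fl (fun j => decide ((2 : ℤ) ^ m ∣ C j + ∑ p, w j p * ibit (x (f p)))) x →
        E *ᵥ basis x = basis x' ∧ E *ᵥ basis x' = basis x := by
  obtain ⟨E, hE, h⟩ := runs_affine hfl hreg hpar hfp hrf hrp C
    (fun j a => ∑ p, if f p = a then w j p else 0)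
    (fun j j' => Finset.sum_eq_zero fun p _ => if_neg (hf p j'))
    (fun j q => Finset.sum_eq_zero fun p _ => if_neg (hr p q))
  have ha : ∀ x j, affine C (fun j a => ∑ p, if f p = a then w j p else 0) x j =
      C j + ∑ p, w j p * ibit (x (f p)) := fun x j => by
    simp only [affine, Finset.sum_mul, ite_mul, zero_mul]
    rw [Finset.sum_comm]
    simp
  simp only [ha] at h
  refine ⟨E, hE, fun x x' hx hx' hxx => ⟨hxx ▸ h x hx hx', ?_⟩⟩
  have hxf : ∀ p, x' (f p) = x (f p) := fun p => by
    rw [hxx, flipOn_of_ne _ _ fun j hj => hf p j hj.symm]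
  rw [h x' (fun p => ?_) fun p => ?_]
  · simp only [hxf]
    rw [hxx, flipOn_flipOn hfl]
  · rw [hxx, flipOn_of_ne _ _ fun j hj => hrf p j hj.symm, hx]
  · rw [hxx, flipOn_of_ne _ _ fun j hj => hfp j p hj, hx']

/-- A count of fewer than 2^m violations is divisible by 2^m only if it is 0; so a divisibility flag
is a conjunction of many conditions. -/
theorem two_pow_dvd_sum_ibit {P : Type} [Fintype P] {m : ℕ} (hP : Fintype.card P < 2 ^ m)
    (β : P → Bool) : (2 : ℤ) ^ m ∣ ∑ p, ibit (β p) ↔ ∀ p, β p = false := by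
  have h0 : ∀ p, 0 ≤ ibit (β p) := fun p => by cases β p <;> simp
  have h1 : ∑ p, ibit (β p) ≤ Fintype.card P := by
    have : ∀ p, ibit (β p) ≤ 1 := fun p => by cases β p <;> simp
    calc ∑ p, ibit (β p) ≤ ∑ _p : P, (1 : ℤ) := Finset.sum_le_sum fun p _ => this p
      _ = Fintype.card P := by simp
  constructor
  · intro h p
    have h2 : ∑ p, ibit (β p) = 0 := Int.eq_zero_of_dvd_of_nonneg_of_lt
      (Finset.sum_nonneg fun p _ => h0 p) (lt_of_le_of_lt h1 (by exact_mod_cast hP)) h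
    have := (Finset.sum_eq_zero_iff_of_nonneg fun p _ => h0 p).1 h2 p (Finset.mem_univ p)
    revert this
    cases β p <;> simp
  · intro h
    simp [h]

/-- The qubits of a comparison of numbers with `k * k` bits: the bits of the number, in `k` blocks
of `k` bits; flags for the blocks that are equal; for the highest block that is not equal; for the
bits that differ in this block; for the highest of these bits; and scratch qubits. -/
abbrev Lab (k m : ℕ) : Type :=
  (Fin k × Fin k) ⊕ Fin k ⊕ Fin k ⊕ (Fin k × Fin k) ⊕ Fin k ⊕ (Fin k × Fin m) ⊕
    (Fin k × (Fin m → Bool)) ⊕ ((Fin k × Fin k) × Fin 2) ⊕ ((Fin k × Fin k) × (Fin 2 → Bool))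

noncomputable instance (k m : ℕ) : DecidableEq (Lab k m) := Classical.decEq _

namespace Lab

variable {k m : ℕ}

/-- The bits of the number. -/
abbrev data (p : Fin k × Fin k) : Lab k m := .inl p
/-- The flags for the blocks that are equal. -/
abbrev same (p : Fin k) : Lab k m := .inr (.inl p)
/-- The flags for the highest block that is not equal. -/
abbrev top (p : Fin k) : Lab k m := .inr (.inr (.inl p))
/-- The flags for the differing bits of this block. -/
abbrev diff (p : Fin k × Fin k) : Lab k m := .inr (.inr (.inr (.inl p)))
/-- The flags for the highest differing bit. -/
abbrev low (p : Fin k) : Lab k m := .inr (.inr (.inr (.inr (.inl p))))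
/-- Registers for counting up to `k`. -/
abbrev reg (p : Fin k × Fin m) : Lab k m := .inr (.inr (.inr (.inr (.inr (.inl p)))))
/-- Parities of these registers. -/
abbrev par (p : Fin k × (Fin m → Bool)) : Lab k m :=
  .inr (.inr (.inr (.inr (.inr (.inr (.inl p))))))
/-- Registers for counting up to `2`. -/
abbrev reg' (p : (Fin k × Fin k) × Fin 2) : Lab k m :=
  .inr (.inr (.inr (.inr (.inr (.inr (.inr (.inl p)))))))
/-- Parities of these registers. -/
abbrev par' (p : (Fin k × Fin k) × (Fin 2 → Bool)) : Lab k m :=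
  .inr (.inr (.inr (.inr (.inr (.inr (.inr (.inr p)))))))

end Lab

open Lab

variable {k m : ℕ}

/-- Since c ⊕ x = c + (1 - 2c)x, the number of differing bits in a block is an affine form. -/
theorem runs_same (hk : k < 2 ^ m) (c : Fin k × Fin k → Bool) :
    ∃ E : Matrix (Lab k m → Bool) (Lab k m → Bool) ℂ, Runs 20 E ∧
      ∀ x x', (∀ p, x (reg p) = false) → (∀ p, x (par p) = false) →
        x' = flipOn same (fun B => decide (∀ i, xor (x (data (B, i))) (c (B, i)) = false)) x →
        E *ᵥ basis x = basis x' ∧ E *ᵥ basis x' = basis x := by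
  obtain ⟨E, hE, h⟩ := runs_linear (fl := same (k := k) (m := m)) (reg := reg) (par := par)
    (f := data) (fun _ _ h => by simpa using h) (fun _ _ h => by simpa using h)
    (fun _ _ h => by simpa using h) (by simp) (by simp) (by simp) (by simp) (by simp)
    (fun B => ∑ i, ibit (c (B, i)))
    (fun B p => if p.1 = B then (if c p then -1 else 1) else 0)
  refine ⟨E, hE, fun x x' hx hx' hxx => h x x' hx hx' ?_⟩
  rw [hxx]
  congr 1
  funext B
  rw [decide_eq_decide, ← two_pow_dvd_sum_ibit (by simpa using hk)]
  have : ∑ p : Fin k × Fin k, (if p.1 = B then (if c p then -1 else 1) else 0) *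
      ibit (x (data p)) = ∑ i, (if c (B, i) then -1 else 1) * ibit (x (data (B, i))) := by
    rw [Fintype.sum_prod_type, Finset.sum_eq_single B]
    · simp
    · intro B' _ hB
      simp [hB]
    · simp
  rw [this, ← Finset.sum_add_distrib]
  refine iff_of_eq (congrArg _ (Finset.sum_congr rfl fun i _ => ?_))
  cases c (B, i) <;> cases x (data (B, i)) <;> simp

/-- The violations counted are: the block itself agrees, or a higher block does not. -/
theorem runs_top (hk : k < 2 ^ m) :
    ∃ E : Matrix (Lab k m → Bool) (Lab k m → Bool) ℂ, Runs 20 E ∧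
      ∀ x x', (∀ p, x (reg p) = false) → (∀ p, x (par p) = false) →
        x' = flipOn top (fun B => decide (x (same B) = false ∧ ∀ B' > B, x (same B') = true)) x →
        E *ᵥ basis x = basis x' ∧ E *ᵥ basis x' = basis x := by
  obtain ⟨E, hE, h⟩ := runs_linear (fl := top (k := k) (m := m)) (reg := reg) (par := par)
    (f := same) (fun _ _ h => by simpa using h) (fun _ _ h => by simpa using h)
    (fun _ _ h => by simpa using h) (by simp) (by simp) (by simp) (by simp) (by simp)
    (fun B => ∑ B', if B < B' then 1 else 0)
    (fun B B' => if B' = B then 1 else if B < B' then -1 else 0)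
  refine ⟨E, hE, fun x x' hx hx' hxx => h x x' hx hx' ?_⟩
  rw [hxx]
  congr 1
  funext B
  rw [decide_eq_decide]
  have : ∑ B', (if B < B' then 1 else 0) +
      ∑ B', (if B' = B then 1 else if B < B' then -1 else 0) * ibit (x (same B')) =
      ∑ B', ibit (if B' = B then x (same B') else if B < B' then !(x (same B')) else false) := by
    rw [← Finset.sum_add_distrib]
    refine Finset.sum_congr rfl fun B' _ => ?_
    rcases lt_trichotomy B B' with hB | hB | hB
    · cases x (same B') <;> simp [hB, hB.ne']
    · simp [hB]
    · simp [hB.ne, hB.not_gt]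
  rw [this, two_pow_dvd_sum_ibit (by simpa using hk)]
  constructor
  · rintro ⟨h1, h2⟩ B'
    split_ifs with hB hB'
    · rw [hB, h1]
    · rw [h2 B' hB']; rfl
    · rfl
  · intro h
    refine ⟨by simpa using h B, fun B' hB' => ?_⟩
    simpa [(gt_iff_lt.1 hB').ne', gt_iff_lt.1 hB'] using h B'

/-- There are k² of these flags, so each may only have constantly many scratch qubits. The forms 1 -
top + x (for c = 1) and 2 - top - x (for c = 0) take values in {0, 1, 2}, so modulus 4 suffices. -/
theorem runs_diff (c : Fin k × Fin k → Bool) :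
    ∃ E : Matrix (Lab k m → Bool) (Lab k m → Bool) ℂ, Runs 20 E ∧
      ∀ x x', (∀ p, x (reg' p) = false) → (∀ p, x (par' p) = false) →
        x' = flipOn diff (fun p => x (top p.1) && xor (x (data p)) (c p)) x →
        E *ᵥ basis x = basis x' ∧ E *ᵥ basis x' = basis x := by
  obtain ⟨E, hE, h⟩ := runs_linear (fl := diff (k := k) (m := m)) (reg := reg') (par := par')
    (f := Sum.elim top data) (fun _ _ h => by simpa using h) (fun _ _ h => by simpa using h)
    (fun _ _ h => by simpa using h) (by simp) (by simp) (by simp) (by simp) (by simp)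
    (fun p => if c p then 1 else 2)
    (fun p => Sum.elim (fun B => if B = p.1 then -1 else 0)
      (fun p' => if p' = p then (if c p then 1 else -1) else 0))
  refine ⟨E, hE, fun x x' hx hx' hxx => h x x' hx hx' ?_⟩
  rw [hxx]
  congr 1
  funext p
  rw [Fintype.sum_sum_type]
  simp only [Sum.elim_inl, Sum.elim_inr, ite_mul, zero_mul, Finset.sum_ite_eq', Finset.mem_univ,
    if_true]
  cases c p <;> cases x (top p.1) <;> cases x (data p) <;> simp

/-- The form reads k² qubits, but at most one block has nonzero entries. Summing over blocks gives
the single bits `s i`, so the count stays at most k. -/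
theorem runs_low (hk : k < 2 ^ m) :
    ∃ E : Matrix (Lab k m → Bool) (Lab k m → Bool) ℂ, Runs 20 E ∧
      ∀ x x', (∀ p, x (reg p) = false) → (∀ p, x (par p) = false) →
        ∀ s : Fin k → Bool, (∀ i, ∑ B, ibit (x (diff (B, i))) = ibit (s i)) →
        x' = flipOn low (fun i => decide (s i = true ∧ ∀ i' > i, s i' = false)) x →
        E *ᵥ basis x = basis x' ∧ E *ᵥ basis x' = basis x := by
  obtain ⟨E, hE, h⟩ := runs_linear (fl := low (k := k) (m := m)) (reg := reg) (par := par)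
    (f := diff) (fun _ _ h => by simpa using h) (fun _ _ h => by simpa using h)
    (fun _ _ h => by simpa using h) (by simp) (by simp) (by simp) (by simp) (by simp)
    (fun _ => 1)
    (fun i p => if p.2 = i then -1 else if i < p.2 then 1 else 0)
  refine ⟨E, hE, fun x x' hx hx' s hs hxx => h x x' hx hx' ?_⟩
  rw [hxx]
  congr 1
  funext i
  rw [decide_eq_decide]
  have : 1 + ∑ p : Fin k × Fin k, (if p.2 = i then -1 else if i < p.2 then 1 else 0) *
      ibit (x (diff p)) =
      ∑ i', ibit (if i' = i then !(s i') else if i < i' then s i' else false) := by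
    rw [Fintype.sum_prod_type, Finset.sum_comm]
    have inner : ∀ i', ∑ B, (if ((B, i') : Fin k × Fin k).2 = i then -1 else
        if i < ((B, i') : Fin k × Fin k).2 then 1 else 0) * ibit (x (diff (B, i'))) =
        (if i' = i then -1 else if i < i' then 1 else 0) * ibit (s i') := fun i' => by
      rw [← hs i', Finset.mul_sum]
    rw [Finset.sum_congr rfl fun i' _ => inner i']
    have h1 : (1 : ℤ) = ∑ i', if i' = i then 1 else 0 := by simp
    conv_lhs => rw [h1]
    rw [← Finset.sum_add_distrib]
    refine Finset.sum_congr rfl fun i' _ => ?_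
    rcases lt_trichotomy i i' with hB | hB | hB
    · cases s i' <;> simp [hB, hB.ne']
    · cases s i' <;> simp [hB]
    · simp [hB.ne, hB.not_gt]
  rw [this, two_pow_dvd_sum_ibit (by simpa using hk)]
  constructor
  · rintro ⟨h1, h2⟩ i'
    split_ifs with hB hB'
    · rw [hB, h1]; rfl
    · exact h2 i' hB'
    · rfl
  · intro h
    refine ⟨by simpa using h i, fun i' hi' => ?_⟩
    simpa [(gt_iff_lt.1 hi').ne', gt_iff_lt.1 hi'] using h i'

/-- Once the position of the highest differing bit is given by a block flag and an offset flag, the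
bit of the constant there is a quadratic form in the flags. -/
theorem runs_sign (c : Fin k × Fin k → Bool) :
    ∃ E : Matrix (Lab k m → Bool) (Lab k m → Bool) ℂ, Runs 2 E ∧
      ∀ x, E *ᵥ basis x =
        sgn (decide (Odd (∑ p : Fin k × Fin k, ibit (c p && (x (top p.1) && x (low p.2)))))) •
          basis x := by
  refine ⟨_, runs_quadPhase 0 fun a b => ∑ p : Fin k × Fin k,
    if top p.1 = a ∧ low p.2 = b ∧ c p = true then Real.pi else 0, fun x => ?_⟩
  rw [← exp_int_mul_pi]
  have : Real.pi * ((∑ p : Fin k × Fin k, ibit (c p && (x (top p.1) && x (low p.2))) : ℤ) : ℝ) =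
      ∑ a : Lab k m, (0 : Lab k m → ℝ) a * bit (x a) + ∑ a : Lab k m, ∑ b : Lab k m,
        (∑ p : Fin k × Fin k, if top p.1 = a ∧ low p.2 = b ∧ c p = true then Real.pi else 0) *
        (bit (x a) * bit (x b)) := by
    simp only [Pi.zero_apply, zero_mul, Finset.sum_const_zero, zero_add, Finset.sum_mul]
    have h1 : ∀ a : Lab k m, ∑ b : Lab k m, ∑ p : Fin k × Fin k,
        (if top p.1 = a ∧ low p.2 = b ∧ c p = true then Real.pi else 0) *
          (bit (x a) * bit (x b)) = ∑ p : Fin k × Fin k, if top p.1 = a then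
            (if c p then Real.pi * (bit (x a) * bit (x (low p.2))) else 0) else 0 := fun a => by
      rw [Finset.sum_comm]
      refine Finset.sum_congr rfl fun p _ => ?_
      by_cases ha : top p.1 = a <;> cases c p <;> simp [ha, ite_mul]
    simp only [h1]
    rw [Finset.sum_comm]
    simp only [Finset.sum_ite_eq, Finset.mem_univ, if_true]
    push_cast
    rw [Finset.mul_sum]
    refine Finset.sum_congr rfl fun p _ => ?_
    rw [← bit_eq]
    cases c p <;> cases x (top p.1) <;> cases x (low p.2) <;> simp
  rw [this]
  funext y
  rw [mulVec_diagonal, Pi.smul_apply, smul_eq_mul, basis, Pi.single_apply]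
  split_ifs with h
  · rw [h, quadPhase]
  · rw [mul_zero, mul_zero]

/-- The sign `-1` on the numbers that are smaller than the number with the bits `c`. -/
theorem runs_compare (hk : k < 2 ^ m) (c : Fin k × Fin k → Bool) :
    ∃ E : Matrix (Lab k m → Bool) (Lab k m → Bool) ℂ, Runs 162 E ∧
      ∀ x, (∀ a, (∀ p, data p ≠ a) → x a = false) → ∀ b : Bool,
        ((b = false ∧ ∀ p, x (data p) = c p) ∨ ∃ B i, x (data (B, i)) = !(c (B, i)) ∧
          (∀ i' > i, x (data (B, i')) = c (B, i')) ∧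
          (∀ B' > B, ∀ i', x (data (B', i')) = c (B', i')) ∧ b = c (B, i)) →
        E *ᵥ basis x = sgn b • basis x := by
  obtain ⟨E₁, r₁, h₁⟩ := runs_same (m := m) hk c
  obtain ⟨E₂, r₂, h₂⟩ := runs_top (m := m) hk
  obtain ⟨E₃, r₃, h₃⟩ := runs_diff (m := m) c
  obtain ⟨E₄, r₄, h₄⟩ := runs_low (m := m) hk
  obtain ⟨Z, rZ, hZ⟩ := runs_sign (m := m) c
  -- Compute the flags, apply the sign, erase the flags in reverse order: 8 · 20 + 2 operations.
  refine ⟨E₁ * (E₂ * (E₃ * (E₄ * (Z * (E₄ * (E₃ * (E₂ * E₁))))))),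
    r₁.mul (r₂.mul (r₃.mul (r₄.mul (rZ.mul (r₄.mul (r₃.mul (r₂.mul r₁))))))), ?_⟩
  intro x hx b hb
  set d : Fin k × Fin k → Bool := fun p => xor (x (data p)) (c p) with hd
  have is : Injective (same (k := k) (m := m)) := fun _ _ h => by simpa using h
  have it : Injective (top (k := k) (m := m)) := fun _ _ h => by simpa using h
  have id' : Injective (diff (k := k) (m := m)) := fun _ _ h => by simpa using h
  have il : Injective (low (k := k) (m := m)) := fun _ _ h => by simpa using h
  set x₁ := flipOn same (fun B => decide (∀ i, xor (x (data (B, i))) (c (B, i)) = false)) x with hx₁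
  set x₂ := flipOn top (fun B => decide (x₁ (same B) = false ∧ ∀ B' > B, x₁ (same B') = true)) x₁
    with hx₂
  set x₃ := flipOn diff (fun p => x₂ (top p.1) && xor (x₂ (data p)) (c p)) x₂ with hx₃
  have v₁ : ∀ B, x₁ (same B) = decide (∀ i, d (B, i) = false) := fun B => by
    rw [hx₁, flipOn_apply is, hx _ (by simp), Bool.false_xor]
  have v₂ : ∀ B, x₂ (top B) =
      decide (x₁ (same B) = false ∧ ∀ B' > B, x₁ (same B') = true) := fun B => by
    rw [hx₂, flipOn_apply it, hx₁, flipOn_of_ne _ _ (by simp), hx _ (by simp), Bool.false_xor]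
  have v₃ : ∀ p, x₃ (diff p) = (x₂ (top p.1) && d p) := fun p => by
    have h2 : x₂ (data p) = x (data p) := by
      rw [hx₂, flipOn_of_ne _ _ (by simp), hx₁, flipOn_of_ne _ _ (by simp)]
    rw [hx₃, flipOn_apply id', h2, hx₂, flipOn_of_ne _ x₁ (by simp), hx₁, flipOn_of_ne _ x (by simp),
      hx _ (by simp), Bool.false_xor]
  -- Here `s` is the pattern of differing bits in the highest differing block: zero if the numbers
  -- agree, and `d (B, ·)` otherwise.
  have key : ∀ s : Fin k → Bool, (∀ i, ∑ B, ibit (x₃ (diff (B, i))) = ibit (s i)) →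
      (decide (Odd (∑ p : Fin k × Fin k, ibit (c p && (x₂ (top p.1) &&
        decide (s p.2 = true ∧ ∀ i' > p.2, s i' = false))))) = b) →
      (E₁ * (E₂ * (E₃ * (E₄ * (Z * (E₄ * (E₃ * (E₂ * E₁)))))))) *ᵥ basis x = sgn b • basis x := by
    intro s hs hsum
    set x₄ := flipOn low (fun i => decide (s i = true ∧ ∀ i' > i, s i' = false)) x₃ with hx₄
    obtain ⟨f₁, g₁⟩ := h₁ x x₁ (fun p => hx _ (by simp)) (fun p => hx _ (by simp)) hx₁
    obtain ⟨f₂, g₂⟩ := h₂ x₁ x₂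
      (fun p => by rw [hx₁, flipOn_of_ne _ _ (by simp), hx _ (by simp)])
      (fun p => by rw [hx₁, flipOn_of_ne _ _ (by simp), hx _ (by simp)]) hx₂
    obtain ⟨f₃, g₃⟩ := h₃ x₂ x₃
      (fun p => by
        rw [hx₂, flipOn_of_ne _ _ (by simp), hx₁, flipOn_of_ne _ _ (by simp), hx _ (by simp)])
      (fun p => by
        rw [hx₂, flipOn_of_ne _ _ (by simp), hx₁, flipOn_of_ne _ _ (by simp), hx _ (by simp)]) hx₃
    obtain ⟨f₄, g₄⟩ := h₄ x₃ x₄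
      (fun p => by
        rw [hx₃, flipOn_of_ne _ _ (by simp), hx₂, flipOn_of_ne _ _ (by simp), hx₁,
          flipOn_of_ne _ _ (by simp), hx _ (by simp)])
      (fun p => by
        rw [hx₃, flipOn_of_ne _ _ (by simp), hx₂, flipOn_of_ne _ _ (by simp), hx₁,
          flipOn_of_ne _ _ (by simp), hx _ (by simp)]) s hs hx₄
    have w₁ : ∀ B, x₄ (top B) = x₂ (top B) := fun B => by
      rw [hx₄, flipOn_of_ne _ _ (by simp), hx₃, flipOn_of_ne _ _ (by simp)]
    have w₂ : ∀ i, x₄ (low i) = decide (s i = true ∧ ∀ i' > i, s i' = false) := fun i => by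
      rw [hx₄, flipOn_apply il, hx₃, flipOn_of_ne _ x₂ (by simp), hx₂, flipOn_of_ne _ x₁ (by simp),
        hx₁, flipOn_of_ne _ x (by simp), hx _ (by simp), Bool.false_xor]
    simp only [← Matrix.mulVec_mulVec]
    rw [f₁, f₂, f₃, f₄, hZ x₄]
    simp only [w₁, w₂, hsum, Matrix.mulVec_smul, g₁, g₂, g₃, g₄]
  obtain ⟨hb₀, h⟩ | ⟨B, i, h₀, hi, hB, hb₁⟩ := hb
  · have hd0 : ∀ p, d p = false := fun p => by simp [hd, h p]
    have hv₂ : ∀ B, x₂ (top B) = false := fun B => by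
      rw [v₂, v₁]
      simp [hd0]
    refine key (fun _ => false) (fun i => ?_) ?_
    · simp [v₃, hv₂]
    · simp [hv₂, hb₀]
  · have hdB : d (B, i) = true := by simp [hd, h₀]
    have hdi : ∀ i' > i, d (B, i') = false := fun i' h => by simp [hd, hi i' h]
    have hdB' : ∀ B' > B, ∀ i', d (B', i') = false := fun B' h i' => by simp [hd, hB B' h i']
    have hv₁ : x₁ (same B) = false := by
      rw [v₁, decide_eq_false_iff_not]
      exact fun h => by simpa [hdB] using h i
    have hv₂ : ∀ B', x₂ (top B') = decide (B' = B) := fun B' => by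
      rw [v₂, decide_eq_decide]
      constructor
      · rintro ⟨h1, h2⟩
        rcases lt_trichotomy B' B with h | h | h
        · have := h2 B h
          rw [hv₁] at this
          exact absurd this (by simp)
        · exact h
        · rw [v₁, decide_eq_false_iff_not] at h1
          exact absurd (fun i' => hdB' B' h i') h1
      · rintro rfl
        refine ⟨hv₁, fun B' h => ?_⟩
        rw [v₁, decide_eq_true_iff]
        exact hdB' B' h
    have hlow : ∀ i', decide (d (B, i') = true ∧ ∀ i'' > i', d (B, i'') = false) =
        decide (i' = i) := fun i' => by
      rw [decide_eq_decide]
      constructor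
      · rintro ⟨h1, h2⟩
        rcases lt_trichotomy i' i with h | h | h
        · have := h2 i h
          rw [hdB] at this
          exact absurd this (by simp)
        · exact h
        · rw [hdi i' h] at h1
          exact absurd h1 (by simp)
      · rintro rfl
        exact ⟨hdB, hdi⟩
    refine key (fun i' => d (B, i')) (fun i' => ?_) ?_
    · rw [Finset.sum_eq_single B]
      · simp [v₃, hv₂]
      · intro B' _ h
        simp [v₃, hv₂, h]
      · simp
    · rw [Finset.sum_eq_single (B, i)]
      · simp only [hv₂, hlow, decide_true, Bool.and_true, hb₁]
        cases c (B, i) <;> simp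
      · rintro ⟨B', i'⟩ _ h
        simp only [hv₂, hlow]
        by_cases h1 : B' = B
        · have h2 : i' ≠ i := fun h2 => h (by rw [h1, h2])
          simp [h2]
        · simp [h1]
      · simp

end Compare

open Lab

/-! ### Numbers -/

section Numbers

variable {k m : ℕ}

/-- The number whose bits are held by the data qubits. -/
def num (x : Lab k m → Bool) : ℕ :=
  Nat.ofBits fun j : Fin (k * k) => x (data (finProdFinEquiv.symm j))

theorem testBit_num (x : Lab k m → Bool) (p : Fin k × Fin k) :
    (num x).testBit (finProdFinEquiv p) = x (data p) := by
  rw [num, Nat.testBit_ofBits_lt _ _ (finProdFinEquiv p).2]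
  change x (data (finProdFinEquiv.symm (finProdFinEquiv p))) = _
  rw [Equiv.symm_apply_apply]

theorem num_lt (x : Lab k m → Bool) : num x < 2 ^ (k * k) := Nat.ofBits_lt_two_pow _

/-- The basis states in which all qubits other than the data qubits are zero. -/
def Clean (x : Lab k m → Bool) : Prop := ∀ a, (∀ p, data p ≠ a) → x a = false

/-- The bit is the leading bit of `v ^^^ r`; it decides the order because all higher bits agree. -/
theorem exists_highest_differing_bit {v r : ℕ} (h : v ≠ r) :
    ∃ j, v.testBit j = (!r.testBit j) ∧ (∀ j' > j, v.testBit j' = r.testBit j') ∧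
      decide (v < r) = r.testBit j := by
  obtain ⟨j, hj, hj'⟩ := Nat.exists_most_significant_bit (n := v ^^^ r)
    (fun h0 => h (Nat.xor_eq_zero_iff.1 h0))
  have h1 : ∀ j' > j, v.testBit j' = r.testBit j' := fun j' h => by
    have := hj' j' h
    rw [Nat.testBit_xor] at this
    simpa using this
  rw [Nat.testBit_xor] at hj
  refine ⟨j, ?_, h1, ?_⟩
  · revert hj
    cases v.testBit j <;> cases r.testBit j <;> simp
  · cases hr : r.testBit j
    · rw [hr, Bool.xor_false] at hj
      rw [decide_eq_false_iff_not, not_lt]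
      exact (Nat.lt_of_testBit j hr hj fun j' h => (h1 j' h).symm).le
    · rw [hr, Bool.xor_true] at hj
      rw [decide_eq_true_iff]
      exact Nat.lt_of_testBit j (by simpa using hj) hr h1

/-- The sign `-1` on the numbers smaller than `r`. -/
theorem runs_lt (hk : k < 2 ^ m) {r : ℕ} (hr : r < 2 ^ (k * k)) :
    ∃ E : Matrix (Lab k m → Bool) (Lab k m → Bool) ℂ, Runs 162 E ∧
      ∀ x, Clean x → E *ᵥ basis x = sgn (decide (num x < r)) • basis x := by
  obtain ⟨E, hE, h⟩ := runs_compare (m := m) hk fun p => r.testBit (finProdFinEquiv p)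
  refine ⟨E, hE, fun x hx => h x hx _ ?_⟩
  simp only [← testBit_num]
  by_cases hxr : num x = r
  · left
    simp [hxr]
  · right
    obtain ⟨j, h1, h2, h3⟩ := exists_highest_differing_bit hxr
    -- Both numbers are below 2^(k·k), so they cannot differ in a higher bit.
    have hj : j < k * k := by
      by_contra hj
      have hp : 2 ^ (k * k) ≤ 2 ^ j := Nat.pow_le_pow_right (by norm_num) (not_lt.1 hj)
      rw [Nat.testBit_lt_two_pow ((num_lt x).trans_le hp),
        Nat.testBit_lt_two_pow (hr.trans_le hp)] at h1
      simp at h1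
    obtain ⟨⟨B, i⟩, hp⟩ := finProdFinEquiv.surjective (⟨j, hj⟩ : Fin (k * k))
    have hj' : (finProdFinEquiv (B, i)).val = j := by rw [hp]
    refine ⟨B, i, by rw [hj']; exact h1, fun i' hi' => h2 _ ?_, fun B' hB' i' => h2 _ ?_,
      by rw [hj']; exact h3⟩
    · rw [← hj', finProdFinEquiv_apply_val, finProdFinEquiv_apply_val]
      have : i.val < i'.val := hi'
      simpa using this
    -- The pair (B, i) has weight index i + k·B, so a higher block outweighs any offset inside a
    -- block.
    · rw [← hj', finProdFinEquiv_apply_val, finProdFinEquiv_apply_val]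
      have h4 : B.val + 1 ≤ B'.val := hB'
      have h5 := i.2
      have h6 : k * (B.val + 1) ≤ k * B'.val := Nat.mul_le_mul_left k h4
      rw [Nat.mul_add] at h6
      simp only
      omega

/-- The clean basis state of a number. -/
def ofNum (i : ℕ) : Lab k m → Bool :=
  Sum.elim (fun p => i.testBit (finProdFinEquiv p)) fun _ => false

theorem clean_ofNum (i : ℕ) : Clean (ofNum i : Lab k m → Bool) := by
  rintro (p | a) h
  · exact absurd rfl (h p)
  · rfl

theorem num_ofNum {i : ℕ} (hi : i < 2 ^ (k * k)) : num (ofNum i : Lab k m → Bool) = i := by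
  refine Nat.eq_of_testBit_eq fun j => ?_
  by_cases hj : j < k * k
  · have := testBit_num (ofNum i : Lab k m → Bool) (finProdFinEquiv.symm ⟨j, hj⟩)
    simp only [Equiv.apply_symm_apply] at this
    rw [this]
    change i.testBit (finProdFinEquiv (finProdFinEquiv.symm ⟨j, hj⟩)).val = _
    rw [Equiv.apply_symm_apply]
  · have hp : 2 ^ (k * k) ≤ 2 ^ j := Nat.pow_le_pow_right (by norm_num) (not_lt.1 hj)
    rw [Nat.testBit_lt_two_pow ((num_lt _).trans_le hp), Nat.testBit_lt_two_pow (hi.trans_le hp)]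

theorem ofNum_num {x : Lab k m → Bool} (hx : Clean x) : ofNum (num x) = x := by
  funext a
  rcases a with p | a
  · exact testBit_num x p
  · exact (hx _ (by simp)).symm

/-- Makes the reflection about the zero state an instance of comparison with a constant. -/
theorem num_lt_one_iff {x : Lab k m → Bool} (hx : Clean x) :
    num x < 1 ↔ x = fun _ => false := by
  rw [Nat.lt_one_iff]
  constructor
  · intro h
    rw [← ofNum_num hx, h]
    funext a
    rcases a with p | a <;> simp [ofNum]
  · rintro rfl
    refine Nat.eq_of_testBit_eq fun j => ?_
    by_cases hj : j < k * k
    · have := testBit_num (fun _ => false : Lab k m → Bool) (finProdFinEquiv.symm ⟨j, hj⟩)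
      simp only [Equiv.apply_symm_apply] at this
      rw [this, Nat.zero_testBit]
    · have hp : 2 ^ (k * k) ≤ 2 ^ j := Nat.pow_le_pow_right (by norm_num) (not_lt.1 hj)
      rw [Nat.testBit_lt_two_pow ((num_lt _).trans_le hp), Nat.zero_testBit]

end Numbers

/-! ### Exact amplitude amplification -/

section Amplification

variable {L : Type} [Fintype L] [DecidableEq L]

theorem tensor_conjTranspose (M : L → Matrix Bool Bool ℂ) :
    (tensor M)ᴴ = tensor fun a => (M a)ᴴ := by
  ext x y
  simp [tensor_apply, conjTranspose_apply]

/-- An operation that is diagonal on some of the basis states. -/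
theorem mulVec_of_basis {E : Matrix (L → Bool) (L → Bool) ℂ} {X : Set (L → Bool)}
    {c : (L → Bool) → ℂ} (hE : ∀ x ∈ X, E *ᵥ basis x = c x • basis x) {φ : QState L}
    (hφ : ∀ x, x ∉ X → φ x = 0) : E *ᵥ φ = fun x => c x * φ x := by
  have h : ∀ y, φ y • (E *ᵥ basis y) = (c y * φ y) • basis y := fun y => by
    by_cases hy : y ∈ X
    · rw [hE y hy, smul_smul, mul_comm]
    · rw [hφ y hy, zero_smul, mul_zero, zero_smul]
  conv_lhs => rw [eq_sum_basis φ]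
  rw [mulVec_sum]
  simp only [mulVec_smul, h]
  exact (eq_sum_basis fun x => c x * φ x).symm

/-- If the good part of a state has weight `1 / 4`, then one step of amplitude amplification
yields a multiple of the good part. -/
theorem amplification {U E F : Matrix (L → Bool) (L → Bool) ℂ} {X : Set (L → Bool)}
    {x₀ : L → Bool} (hx₀ : x₀ ∈ X) (hU : U * Uᴴ = 1) (hUX : ∀ x y, U x y ≠ 0 → (x ∈ X ↔ y ∈ X))
    {good : (L → Bool) → Bool} (hE : ∀ x ∈ X, E *ᵥ basis x = sgn (good x) • basis x)
    (hF : ∀ x ∈ X, F *ᵥ basis x = sgn (decide (x = x₀)) • basis x)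
    (hg : ∑ x, (if good x then Complex.normSq (U x x₀) else 0) = 1 / 4) :
    U *ᵥ (F *ᵥ (Uᴴ *ᵥ (E *ᵥ (U *ᵥ basis x₀)))) =
      (-2 : ℂ) • fun x => if good x then U x x₀ else 0 := by
  set g : QState L := fun x => if good x then U x x₀ else 0 with hgd
  have hU' : Uᴴ * U = 1 := mul_eq_one_comm.1 hU
  have hs : ∀ x, x ∉ X → U x x₀ = 0 := fun x hx => by
    by_contra h
    exact hx ((hUX x x₀ h).2 hx₀)
  have hgX : ∀ x, x ∉ X → g x = 0 := fun x hx => by simp [hgd, hs x hx]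
  -- On the support of the state, the sign oracle is the identity minus twice the projection to the
  -- good part `g`.
  have h₁ : E *ᵥ (U *ᵥ basis x₀) = U *ᵥ basis x₀ - (2 : ℂ) • g := by
    rw [mulVec_of_basis hE fun x hx => by rw [mulVec_basis]; exact hs x hx]
    funext x
    simp only [mulVec_basis, Pi.sub_apply, Pi.smul_apply, smul_eq_mul, hgd]
    cases good x
    · simp
    · simp only [sgn_true, if_true]
      ring
  set h : QState L := Uᴴ *ᵥ g with hh
  have h₂ : Uᴴ *ᵥ (E *ᵥ (U *ᵥ basis x₀)) = basis x₀ - (2 : ℂ) • h := by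
    rw [h₁, mulVec_sub, mulVec_smul, mulVec_mulVec, hU', one_mulVec]
  have hhX : ∀ x, x ∉ X → h x = 0 := fun x hx => by
    rw [hh, mulVec, dotProduct]
    refine Finset.sum_eq_zero fun y _ => ?_
    by_cases hy : U y x = 0
    · rw [conjTranspose_apply, hy, star_zero, zero_mul]
    · rw [hgX y fun hyX => hx ((hUX y x hy).1 hyX), mul_zero]
  -- The overlap of `g` with the whole state is its weight.
  have hh0 : h x₀ = 1 / 4 := by
    have : h x₀ = ((∑ x, (if good x then Complex.normSq (U x x₀) else 0) : ℝ) : ℂ) := by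
      rw [hh, mulVec, dotProduct, Complex.ofReal_sum]
      refine Finset.sum_congr rfl fun y _ => ?_
      rw [conjTranspose_apply, hgd]
      by_cases hy : good y = true
      · simp only [if_pos hy]
        rw [Complex.normSq_eq_conj_mul_self]
        rfl
      · simp only [if_neg hy, mul_zero, Complex.ofReal_zero]
    rw [this, hg]
    norm_num
  -- At `x₀` the amplitude is 1 - 2/4 = 1/2, and the reflection makes it -1/2 = -2 · (1/4). This is
  -- where the weight 1/4 is used: the start vector disappears and only `h` remains.
  have h₃ : F *ᵥ (basis x₀ - (2 : ℂ) • h) = (-2 : ℂ) • h := by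
    rw [mulVec_of_basis hF fun x hx => by
      have : x ≠ x₀ := fun hxx => hx (hxx ▸ hx₀)
      simp [basis, hhX x hx, this]]
    funext x
    by_cases hx : x = x₀
    · subst hx
      simp [basis, hh0]
      norm_num
    · simp [basis, hx]
  rw [h₂, h₃, mulVec_smul, hh, mulVec_mulVec, hU, one_mulVec]

end Amplification

/-! ### The start state -/

section Start

/-- A rotation. -/
noncomputable def rotGate (α : ℝ) (hα : α ^ 2 ≤ 1) : unitaryGroup Bool ℂ :=
  ⟨of fun a b => if a = b then (α : ℂ) else sgn b * (√(1 - α ^ 2) : ℝ), by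
    have h : (α : ℂ) * α + ((√(1 - α ^ 2) : ℝ) : ℂ) * ((√(1 - α ^ 2) : ℝ) : ℂ) = 1 := by
      rw [← Complex.ofReal_mul, ← Complex.ofReal_mul, ← Complex.ofReal_add,
        Real.mul_self_sqrt (by linarith)]
      norm_num
      ring_nf
    rw [mem_unitaryGroup_iff]
    ext a b
    cases a <;> cases b <;>
      simp [Matrix.mul_apply, Matrix.star_apply, Complex.conj_ofReal] <;>
      first
      | linear_combination h
      | ring⟩

/-- The gate on the `j`-th qubit in the preparation of the start state. -/
noncomputable def startGate (n : ℕ) (α : ℝ) (hα : α ^ 2 ≤ 1) (j : ℕ) : unitaryGroup Bool ℂ :=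
  if j < n then hadamard else if j = n then rotGate α hα else 1

variable {k m : ℕ}

/-- The gates of the preparation of the start state. -/
noncomputable def startGates (k m n : ℕ) (α : ℝ) (hα : α ^ 2 ≤ 1) :
    Lab k m → unitaryGroup Bool ℂ :=
  Sum.elim (fun p => startGate n α hα (finProdFinEquiv p)) fun _ => 1

/-- The matrix of the preparation of the start state. -/
noncomputable def startMatrix (k m n : ℕ) (α : ℝ) (hα : α ^ 2 ≤ 1) :
    Matrix (Lab k m → Bool) (Lab k m → Bool) ℂ :=
  tensor fun a => (startGates k m n α hα a : Matrix Bool Bool ℂ)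

theorem startMatrix_mul_conjTranspose (n : ℕ) (α : ℝ) (hα : α ^ 2 ≤ 1) :
    startMatrix k m n α hα * (startMatrix k m n α hα)ᴴ = 1 := by
  rw [startMatrix, tensor_conjTranspose, tensor_mul, ← tensor_one]
  congr 1
  funext a
  exact mem_unitaryGroup_iff.1 (startGates k m n α hα a).2

theorem runs_startMatrix (n : ℕ) (α : ℝ) (hα : α ^ 2 ≤ 1) :
    Runs 1 (startMatrix k m n α hα) := .tensor _

theorem runs_startMatrix_conjTranspose (n : ℕ) (α : ℝ) (hα : α ^ 2 ≤ 1) :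
    Runs 1 (startMatrix k m n α hα)ᴴ := by
  rw [startMatrix, tensor_conjTranspose]
  exact .tensor fun a => star (startGates k m n α hα a)

theorem clean_iff_of_startMatrix_ne_zero {n : ℕ} {α : ℝ} {hα : α ^ 2 ≤ 1} {x y : Lab k m → Bool}
    (h : startMatrix k m n α hα x y ≠ 0) : Clean x ↔ Clean y := by
  have hxy : ∀ a, (∀ p, data p ≠ a) → x a = y a := by
    intro a ha
    by_contra hne
    refine h (Finset.prod_eq_zero (Finset.mem_univ a) ?_)
    rcases a with p | a
    · exact absurd rfl (ha p)
    · exact one_apply_ne hne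
  exact forall_congr' fun a => forall_congr' fun ha => by rw [hxy a ha]

/-- The amplitudes of the start state at the numbers below `2 ^ n`. -/
theorem startMatrix_apply {n : ℕ} (hn : n < k * k) (α : ℝ) (hα : α ^ 2 ≤ 1) {x : Lab k m → Bool}
    (hx : Clean x) (hxn : num x < 2 ^ n) :
    startMatrix k m n α hα x (fun _ => false) = (((√2)⁻¹ ^ n * α : ℝ) : ℂ) := by
  rw [startMatrix, tensor_apply, Fintype.prod_sum_type]
  have h₁ : ∀ a, (startGates k m n α hα (.inr a) : Matrix Bool Bool ℂ) (x (.inr a)) false = 1 := by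
    intro a
    rw [hx (.inr a) (by simp)]
    rfl
  have h₂ : ∀ p, (startGates k m n α hα (.inl p) : Matrix Bool Bool ℂ) (x (.inl p)) false =
      (fun j : ℕ => if j < n then (((√2)⁻¹ : ℝ) : ℂ) else if j = n then (α : ℂ) else 1)
        (finProdFinEquiv p) := by
    intro p
    change (startGate n α hα (finProdFinEquiv p) : Matrix Bool Bool ℂ) (x (data p)) false = _
    rw [startGate, ← testBit_num x p]
    dsimp only
    split_ifs with h1 h2
    · rw [hadamard_apply, Bool.and_false, sgn_false, mul_one, Complex.ofReal_inv]
    · rw [h2, Nat.testBit_lt_two_pow hxn]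
      rfl
    · rw [Nat.testBit_lt_two_pow (hxn.trans_le (Nat.pow_le_pow_right (by norm_num) (not_lt.1 h1)))]
      rfl
  rw [Finset.prod_congr rfl fun a _ => h₁ a, Finset.prod_const_one, mul_one,
    Finset.prod_congr rfl fun p _ => h₂ p,
    finProdFinEquiv.prod_comp fun j : Fin (k * k) =>
      (fun j : ℕ => if j < n then (((√2)⁻¹ : ℝ) : ℂ) else if j = n then (α : ℂ) else 1) j,
    Fin.prod_univ_eq_prod_range
      (fun j : ℕ => if j < n then (((√2)⁻¹ : ℝ) : ℂ) else if j = n then (α : ℂ) else 1) (k * k)]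
  obtain ⟨r, hr⟩ := Nat.exists_eq_add_of_lt hn
  rw [hr, show n + r + 1 = n + 1 + r by ring, Finset.prod_range_add, Finset.prod_range_succ,
    Finset.prod_eq_one (s := Finset.range r), mul_one]
  · rw [Finset.prod_congr rfl fun j hj => if_pos (Finset.mem_range.1 hj), Finset.prod_const,
      Finset.card_range, if_neg (lt_irrefl n), if_pos rfl]
    push_cast
    rfl
  · intro j _
    rw [if_neg (by omega), if_neg (by omega)]

theorem sum_clean {q : ℕ} (hq : q ≤ 2 ^ (k * k)) (c : ℝ) :
    (∑ x : Lab k m → Bool, open Classical in if Clean x ∧ num x < q then c else 0) = q * c := by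
  classical
  rw [← Finset.sum_filter, Finset.sum_const, nsmul_eq_mul]
  congr 2
  conv_rhs => rw [← Finset.card_range q]
  refine Finset.card_bij' (fun x _ => num x) (fun i _ => ofNum i) ?_ ?_ ?_ ?_
  · intro x hx
    exact Finset.mem_range.2 (Finset.mem_filter.1 hx).2.2
  · intro i hi
    have hi' := Finset.mem_range.1 hi
    exact Finset.mem_filter.2 ⟨Finset.mem_univ _, clean_ofNum i, by
      rwa [num_ofNum (hi'.trans_le hq)]⟩
  · intro x hx
    exact ofNum_num (Finset.mem_filter.1 hx).2.1
  · intro i hi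
    exact num_ofNum ((Finset.mem_range.1 hi).trans_le hq)

/-- A bounded number of operations prepares a multiple of the uniform superposition of the numbers
below `q`. -/
theorem runs_uniform (hk : k < 2 ^ m) {n q : ℕ} (hn : n < k * k) (hq : q ≤ 2 ^ n)
    (hq' : 2 ^ n ≤ 4 * q) :
    ∃ M : Matrix (Lab k m → Bool) (Lab k m → Bool) ℂ, Runs 327 M ∧ ∃ c : ℂ,
      M *ᵥ basis (fun _ => false) =
        fun x => open Classical in if Clean x ∧ num x < q then c else 0 := by
  classical
  have hq0 : 0 < q := by
    by_contra h
    have : 0 < 2 ^ n := by positivity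
    omega
  have hqr : (0 : ℝ) < q := by exact_mod_cast hq0
  have hkk : 2 ^ n < 2 ^ (k * k) := Nat.pow_lt_pow_right (by norm_num) hn
  have h1k : 1 < 2 ^ (k * k) := by
    have : 0 < 2 ^ n := by positivity
    omega
  -- Chosen so that q · 2^(-n) · α² = 1/4; 2^n ≤ 4q makes α at most 1. The rotated qubit is bit n of
  -- the number, so being below q ≤ 2^n includes that it is 0; hence the requirement n < k·k.
  set α : ℝ := √(2 ^ n / (4 * q)) with hα
  have hα2 : α ^ 2 = 2 ^ n / (4 * q) := Real.sq_sqrt (by positivity)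
  have hα1 : α ^ 2 ≤ 1 := by
    rw [hα2, div_le_one (by positivity)]
    exact_mod_cast hq'
  obtain ⟨E, hE, hEx⟩ := runs_lt (m := m) hk (hq.trans_lt hkk)
  -- The second reflection is the comparison with 1. In total there are 2 · 162 + 3 operations.
  obtain ⟨F, hF, hFx⟩ := runs_lt (m := m) hk h1k
  set U := startMatrix k m n α hα1 with hU
  have hzero : Clean (fun _ => false : Lab k m → Bool) := fun _ _ => rfl
  have key := amplification (X := {x | Clean x}) (good := fun x => decide (num x < q)) (E := E)
    (F := F) (U := U) hzero (startMatrix_mul_conjTranspose n α hα1)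
    (fun x y h => clean_iff_of_startMatrix_ne_zero h) hEx
    (fun x hx => by
      rw [hFx x hx]
      congr 2
      rw [decide_eq_decide]
      exact num_lt_one_iff hx) ?_
  · refine ⟨U * (F * (Uᴴ * (E * U))), (runs_startMatrix n α hα1).mul
      (hF.mul ((runs_startMatrix_conjTranspose n α hα1).mul (hE.mul (runs_startMatrix n α hα1)))),
      -2 * (((√2)⁻¹ ^ n * α : ℝ) : ℂ), ?_⟩
    simp only [← mulVec_mulVec]
    rw [key]
    funext x
    simp only [Pi.smul_apply, smul_eq_mul, decide_eq_true_eq]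
    by_cases hx : Clean x
    · by_cases hxq : num x < q
      · rw [if_pos hxq, if_pos (show Clean x ∧ num x < q from ⟨hx, hxq⟩), hU, startMatrix_apply hn α hα1 hx (hxq.trans_le hq)]
      · rw [if_neg hxq, if_neg (show ¬ (Clean x ∧ num x < q) from fun h => hxq h.2), mul_zero]
    · rw [if_neg (show ¬ (Clean x ∧ num x < q) from fun h => hx h.1)]
      have : U x (fun _ => false) = 0 := by
        by_contra h
        exact hx ((clean_iff_of_startMatrix_ne_zero h).2 hzero)
      rw [this, ite_self, mul_zero]
  · have hsum : ∀ x, (if decide (num x < q) = true then Complex.normSq (U x fun _ => false) else 0) =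
        if Clean x ∧ num x < q then ((√2)⁻¹ ^ n * α) ^ 2 else 0 := by
      intro x
      simp only [decide_eq_true_eq]
      by_cases hx : Clean x
      · by_cases hxq : num x < q
        · rw [if_pos hxq, if_pos (show Clean x ∧ num x < q from ⟨hx, hxq⟩), hU, startMatrix_apply hn α hα1 hx (hxq.trans_le hq),
            Complex.normSq_ofReal, sq]
        · rw [if_neg hxq, if_neg (show ¬ (Clean x ∧ num x < q) from fun h => hxq h.2)]
      · rw [if_neg (show ¬ (Clean x ∧ num x < q) from fun h => hx h.1)]
        have : U x (fun _ => false) = 0 := by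
          by_contra h
          exact hx ((clean_iff_of_startMatrix_ne_zero h).2 hzero)
        rw [this, map_zero, ite_self]
    rw [Finset.sum_congr rfl fun x _ => hsum x]
    have := sum_clean (k := k) (m := m) (hq.trans hkk.le) (((√2)⁻¹ ^ n * α) ^ 2)
    rw [this, mul_pow, hα2, ← pow_mul, mul_comm n 2, pow_mul, inv_pow, Real.sq_sqrt (by norm_num)]
    rw [inv_pow]
    field_simp

end Start

/-! ### The number of gates of a quantum circuit -/

section Size

variable {Q : Type} [Fintype Q] [DecidableEq Q] {G : SimpleGraph Q}

theorem QGate.support_nonempty (g : QGate G) : g.support.Nonempty := by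
  cases g with
  | single u p => exact ⟨p, Finset.mem_singleton_self p⟩
  | cnot c t h => exact ⟨c, Finset.mem_insert_self c {t}⟩

/-- Supports in a layer are nonempty and disjoint, so choosing a qubit of each gate is injective.
Size bounds thus follow from depth and number of qubits. -/
theorem QLayer.length_gates_le {W : Type} (L : QLayer G W) :
    L.gates.length ≤ Fintype.card Q := by
  have h : (L.gates.map fun g => g.gate.support_nonempty.choose).Nodup := by
    rw [List.Nodup, List.pairwise_map]
    refine L.disjoint.imp fun {g g'} hgg' he => ?_
    have h' := g'.gate.support_nonempty.choose_spec
    rw [← he] at h'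
    exact Finset.disjoint_left.1 hgg' g.gate.support_nonempty.choose_spec h'
  simpa using h.length_le_card

theorem Round.quantumSize_le (r : Round G) :
    r.quantumSize ≤ r.quantumDepth * Fintype.card Q := by
  refine (List.sum_le_card_nsmul _ (Fintype.card Q) fun s hs => ?_).trans
    (by rw [List.length_map, smul_eq_mul]; rfl)
  obtain ⟨L, _, rfl⟩ := List.mem_map.1 hs
  exact L.length_gates_le

end Size

/-! ### The uniform superposition -/

theorem uniformSuperposition_apply (q : ℕ) (y : Fin (Nat.clog 2 q) → Bool) :
    uniformSuperposition q y =
      if Nat.ofBits y < q then ((Real.sqrt q : ℝ) : ℂ)⁻¹ else 0 := by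
  have h : ∀ i ∈ Finset.range q,
      ket (Nat.clog 2 q) i y = if Nat.ofBits y = i then 1 else 0 := by
    intro i hi
    refine if_congr ⟨fun h => Nat.eq_of_testBit_eq fun j => ?_, ?_⟩ rfl rfl
    · by_cases hj : j < Nat.clog 2 q
      · rw [Nat.testBit_ofBits_lt _ _ hj, h ⟨j, hj⟩]
      · rw [Nat.testBit_ofBits_ge _ _ (not_lt.1 hj), Nat.testBit_lt_two_pow]
        exact (Finset.mem_range.1 hi).trans_le ((Nat.le_pow_clog (by norm_num) q).trans
          (Nat.pow_le_pow_right (by norm_num) (not_lt.1 hj)))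
    · rintro rfl j
      rw [Nat.testBit_ofBits_lt _ _ j.2]
  rw [uniformSuperposition, Pi.smul_apply, Finset.sum_apply, Finset.sum_congr rfl h,
    Finset.sum_ite_eq]
  simp only [Finset.mem_range, smul_eq_mul, mul_ite, mul_one, mul_zero]

section Output

variable {k m n : ℕ}

/-- The data qubits of the lowest order. -/
def dataEmb (m : ℕ) (hn : n ≤ k * k) : Fin n ↪ Lab k m :=
  ⟨fun j => data (finProdFinEquiv.symm (Fin.castLE hn j)), fun i j h => by
    have := Sum.inl_injective h
    exact Fin.castLE_injective hn (finProdFinEquiv.symm.injective this)⟩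

/-- Being below 2^n says exactly that the data qubits outside the output are zero, as the embedding
in the target state requires. -/
theorem num_eq_ofBits (hn : n ≤ k * k) {x : Lab k m → Bool}
    (hx : Clean x) : (num x < 2 ^ n ↔ ∀ a, (∀ j, dataEmb m hn j ≠ a) → x a = false) ∧
      (num x < 2 ^ n → num x = Nat.ofBits fun j => x (dataEmb m hn j)) := by
  have hbit : ∀ j : Fin n, (num x).testBit j = x (dataEmb m hn j) := fun j => by
    have := testBit_num x (finProdFinEquiv.symm (Fin.castLE hn j))
    rwa [Equiv.apply_symm_apply] at this
  refine ⟨⟨fun h a ha => ?_, fun h => ?_⟩, fun h => Nat.eq_of_testBit_eq fun j => ?_⟩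
  · by_cases hd : ∃ p, data p = a
    · obtain ⟨p, rfl⟩ := hd
      rw [← testBit_num x, Nat.testBit_lt_two_pow]
      refine h.trans_le (Nat.pow_le_pow_right (by norm_num) ?_)
      by_contra hp
      refine ha ⟨finProdFinEquiv p, not_le.1 hp⟩ ?_
      change data (finProdFinEquiv.symm (finProdFinEquiv p)) = _
      rw [Equiv.symm_apply_apply]
    · exact hx a fun p hp => hd ⟨p, hp⟩
  · refine Nat.lt_pow_two_of_testBit _ fun j hj => ?_
    by_cases hjk : j < k * k
    · obtain ⟨p, hp⟩ := finProdFinEquiv.surjective (⟨j, hjk⟩ : Fin (k * k))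
      have hpj : (finProdFinEquiv p).val = j := by rw [hp]
      rw [← hpj, testBit_num]
      refine h _ fun i hi => ?_
      have h1 := Sum.inl_injective hi
      rw [Equiv.symm_apply_eq] at h1
      have h2 := congrArg Fin.val h1
      rw [hpj] at h2
      have h3 : i.val = j := h2
      omega
    · exact Nat.testBit_lt_two_pow
        ((num_lt x).trans_le (Nat.pow_le_pow_right (by norm_num) (not_lt.1 hjk)))
  · by_cases hj : j < n
    · rw [Nat.testBit_ofBits_lt _ _ hj]
      exact hbit ⟨j, hj⟩
    · rw [Nat.testBit_ofBits_ge _ _ (not_lt.1 hj), Nat.testBit_lt_two_pow]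
      exact h.trans_le (Nat.pow_le_pow_right (by norm_num) (not_lt.1 hj))

end Output

theorem place_basis_zero {Q L : Type} [Fintype Q] [DecidableEq Q] [Fintype L] [DecidableEq L]
    (home : L → Q) : place home (basis fun _ => false) = zeroState Q := by
  funext x
  unfold place zeroState
  by_cases hx : x = fun _ => false
  · subst hx
    rw [if_pos rfl, if_pos (show _ ∈ homeStates home from fun _ _ => rfl)]
    exact Pi.single_eq_same _ _
  · rw [if_neg hx]
    split_ifs with h
    · refine Pi.single_eq_of_ne (fun hz => hx (funext fun p => ?_)) _
      by_cases hp : ∃ a, home a = p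
      · obtain ⟨a, rfl⟩ := hp
        exact congrFun hz a
      · exact h p fun a ha => hp ⟨a, ha⟩
    · rfl

open Classical in
/-- The output qubits of the low order data qubits hold the uniform superposition. -/
theorem place_uniform {Q : Type} [Fintype Q] [DecidableEq Q] {k m : ℕ} {home : Lab k m ↪ Q}
    {q : ℕ} (hq : 0 < q) (hn : Nat.clog 2 q ≤ k * k) (c : ℂ) :
    place home (fun z => if Clean z ∧ num z < q then c else 0) =
      (c * ((Real.sqrt q : ℝ) : ℂ)) •
        embed ((dataEmb m hn).trans home) (uniformSuperposition q) := by
  have hq' : ((Real.sqrt q : ℝ) : ℂ) ≠ 0 := by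
    rw [Complex.ofReal_ne_zero]
    exact (Real.sqrt_pos.2 (by exact_mod_cast hq)).ne'
  have hqn : q ≤ 2 ^ Nat.clog 2 q := Nat.le_pow_clog (by norm_num) q
  funext x
  simp only [place, embed, Pi.smul_apply, smul_eq_mul, uniformSuperposition_apply]
  by_cases h : ∀ p, (∀ j, ((dataEmb m hn).trans home) j ≠ p) → x p = false
  · have h₁ : x ∈ homeStates home := fun p hp => h p fun j => hp _
    have h₂ : Clean fun a => x (home a) := fun a ha =>
      h _ fun j hj => ha _ (home.injective hj)
    have h₃ := num_eq_ofBits hn h₂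
    have h₄ := h₃.1.2 fun a ha => h _ fun j hj => ha j (home.injective hj)
    rw [if_pos h₁, if_pos h, h₃.2 h₄]
    simp only [h₂, true_and, mul_ite, mul_zero, mul_assoc, mul_inv_cancel₀ hq', mul_one]
    rfl
  · rw [if_neg h, mul_zero]
    split_ifs with h₁ h₂
    · refine absurd (fun p hp => ?_) h
      by_cases ha : ∃ a, home a = p
      · obtain ⟨a, rfl⟩ := ha
        exact (num_eq_ofBits hn h₂.1).1.1 (h₂.2.trans_le hqn) a fun j hj =>
          hp j (congrArg home hj)
      · exact h₁ p fun a hap => ha ⟨a, hap⟩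
    · rfl
    · rfl

/-! ### The circuits -/

/-- All nine kinds of qubits number O(k²): 14 = 1 + 1 + 1 + 1 + 1 + 1 + 2 + 2 + 4, in the order of
the summands of `Lab`. -/
theorem card_lab_le {k m : ℕ} (hk : 1 ≤ k) (hm : 2 ^ m ≤ 2 * k) :
    Fintype.card (Lab k m) ≤ 14 * (k * k) := by
  have h : Fintype.card (Lab k m) =
      k * k + (k + (k + (k * k + (k + (k * m + (k * 2 ^ m + (k * k * 2 + k * k * 2 ^ 2))))))) := by
    simp [Lab]
  have h1 : k * 2 ^ m ≤ k * (2 * k) := Nat.mul_le_mul_left k hm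
  have hmk : m ≤ k := by
    have := Nat.lt_two_pow_self (n := m - 1)
    rcases Nat.eq_zero_or_pos m with rfl | hm0
    · omega
    · rw [show m = m - 1 + 1 by omega, pow_succ] at hm
      omega
  have h2 : k * m ≤ k * k := Nat.mul_le_mul_left k hmk
  have h3 : k * 1 ≤ k * k := Nat.mul_le_mul_left k hk
  have h4 : k * (2 * k) = 2 * (k * k) := by ring
  omega

/-- A size of the blocks of data qubits for numbers of `n` bits. -/
theorem exists_blockSize {n : ℕ} (hn : 1 ≤ n) :
    ∃ k m, n < k * k ∧ k < 2 ^ m ∧ Fintype.card (Lab k m) ≤ 56 * n := by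
  -- The blocks have about √n bits, so k² ≤ 4n and 14 · 4 = 56.
  refine ⟨Nat.sqrt n + 1, Nat.log 2 (Nat.sqrt n + 1) + 1, Nat.lt_succ_sqrt n,
    Nat.lt_pow_succ_log_self (by norm_num) _, ?_⟩
  refine (card_lab_le (by omega) ?_).trans ?_
  · rw [pow_succ, mul_comm]
    exact Nat.mul_le_mul_left 2 (Nat.pow_log_le_self 2 (by omega))
  · have h1 : Nat.sqrt n * Nat.sqrt n ≤ n := Nat.sqrt_le n
    have h2 : 1 ≤ Nat.sqrt n := Nat.sqrt_pos.2 hn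
    nlinarith

/-- The circuit that prepares the uniform superposition, with explicit bounds. -/
theorem exists_circuit (q : ℕ) : ∃ A : Circuit (Nat.clog 2 q),
    (1 ≤ q → A.Prepares (uniformSuperposition q)) ∧
    A.numQubits ≤ 12544 * Nat.clog 2 q ^ 2 ∧
    A.rounds.length ≤ 2943 ∧ ∀ r ∈ A.rounds, r.quantumDepth ≤ 5 ∧
      r.quantumSize ≤ 62720 * Nat.clog 2 q ^ 2 ∧
      r.classical.depth ≤ 42 * (Nat.log 2 (Nat.clog 2 q) + 1) ∧
      r.classicalSize ≤ 256901120 * Nat.clog 2 q ^ 4 := by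
  -- For q ≤ 1 there are no output qubits and the empty grid works: the state for q = 1 is the
  -- scalar 1.
  rcases lt_or_ge q 2 with hq | hq
  · have h0 : Nat.clog 2 q = 0 := Nat.clog_of_right_le_one (by omega) 2
    have : IsEmpty (Fin (Nat.clog 2 q)) := by rw [h0]; infer_instance
    refine ⟨⟨0, 0, [], Embedding.ofIsEmpty⟩, fun h1 o => ⟨1, ?_⟩, Nat.zero_le _, Nat.zero_le _,
      fun r hr => absurd hr List.not_mem_nil⟩
    have hq1 : q = 1 := by omega
    subst hq1
    funext x
    have hy : ∀ y : Fin (Nat.clog 2 1) → Bool, Nat.ofBits y < 1 := fun y => by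
      refine (Nat.ofBits_lt_two_pow y).trans_le ?_
      rw [h0, pow_zero]
    rw [one_smul, embed, if_pos fun p => p.1.elim0, uniformSuperposition_apply, if_pos (hy _)]
    change zeroState _ x = _
    rw [zeroState, if_pos (Subsingleton.elim _ _)]
    simp
  · set n := Nat.clog 2 q with hn
    have hn1 : 1 ≤ n := Nat.clog_pos (by norm_num) hq
    obtain ⟨k, m, hnk, hk, hcard⟩ := exists_blockSize hn1
    have hq1 : q ≤ 2 ^ n := Nat.le_pow_clog (by norm_num) q
    have hq2 : 2 ^ n ≤ 4 * q := by
      have h1 := Nat.pow_pred_clog_lt_self (b := 2) (by norm_num) hq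
      have h2 : 2 ^ n = 2 ^ (n - 1) * 2 := by rw [← pow_succ]; congr 1; omega
      have h3 : 2 ^ (n - 1) < q := h1
      omega
    obtain ⟨M, hM, c, hc⟩ := runs_uniform (m := m) hk hnk hq1 hq2
    set N := Fintype.card (Lab k m) with hN
    have σ : Lab k m ≃ Fin N := Fintype.equivFin _
    -- Since N ≤ 56n < 112 · 2^(log n), the summand 7 with 2^7 = 128 gives N ≤ 2^e. Parities of at
    -- most N² ≤ 2^(2e) outcomes then have depth 6e.
    set e := 7 + Nat.log 2 n with he
    have hlog : 2 ^ Nat.log 2 n ≤ n := Nat.pow_log_le_self 2 (by omega)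
    have hlog' : n < 2 ^ Nat.log 2 n * 2 := by
      rw [← pow_succ]
      exact Nat.lt_pow_succ_log_self (by norm_num) n
    have hNe : N ≤ 2 ^ e := by
      rw [he, pow_add]
      omega
    have hl : N * N ≤ 2 ^ (2 * e) := by
      rw [two_mul, pow_add]
      exact Nat.mul_le_mul hNe hNe
    have hNN : N * N ≤ 3136 * n ^ 2 :=
      (Nat.mul_le_mul hcard hcard).trans_eq (by ring)
    obtain ⟨P, hP⟩ := hM.lrealizable σ hl
    obtain ⟨hP1, hP2, hP3⟩ := hP 0
    set home : Lab k m ↪ Fin (2 * N) × Fin (2 * N) := ⟨homeVtx σ, homeVtx_injective σ⟩ with hhome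
    refine ⟨⟨2 * N, 2 * N, P 0, (dataEmb m hnk.le).trans home⟩, fun _ o => ?_, ?_, hP1,
      fun r hr => ⟨(hP2 r hr).quantumDepth_le, ?_, ?_, ?_⟩⟩
    · obtain ⟨a, ha⟩ := hP3 (fun _ => false) o
      refine ⟨a * (c * ((Real.sqrt q : ℝ) : ℂ)), ?_⟩
      have hz : zeroState _ = place (homeVtx σ) (basis fun _ => false) :=
        (place_basis_zero (homeVtx σ)).symm
      rw [finalState, ha _ fun x hx => by rw [hz, place_apply_of_notMem _ hx], hz]
      dsimp only
      rw [unplace_place (homeVtx_injective σ), hc, mul_smul]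
      congr 1
      exact place_uniform (home := home) (by omega) hnk.le c
    -- 12544 = 4 · 56².
    · change 2 * N * (2 * N) ≤ _
      nlinarith
    · refine r.quantumSize_le.trans ((Nat.mul_le_mul_right _ (hP2 r hr).quantumDepth_le).trans ?_)
      rw [Fintype.card_prod, Fintype.card_fin]
      nlinarith
    · refine (hP2 r hr).depth_le.trans ?_
      rw [he, ← hn]
      omega
    · refine (hP2 r hr).size_le.trans ?_
      -- 16384 = 2^14, and the classical size constant is 3136 · 5 · 16384.
      have h2e : 2 ^ (2 * e) ≤ 16384 * n ^ 2 := by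
        have : 2 ^ (2 * e) = 16384 * (2 ^ Nat.log 2 n) ^ 2 := by
          rw [mul_comm 2 e, pow_mul, he, pow_add]
          ring
        rw [this]
        exact Nat.mul_le_mul_left _ (Nat.pow_le_pow_left hlog 2)
      exact (Nat.mul_le_mul hNN (Nat.mul_le_mul_left 5 h2e)).trans_eq (by ring)

/-- Rounding up adds at most 1, which is at most log₂ q for q ≥ 2; for q = 1 both sides vanish. -/
theorem clog_le_two_mul_logb {q : ℕ} (hq : 1 ≤ q) :
    (Nat.clog 2 q : ℝ) ≤ 2 * Real.logb 2 q := by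
  rcases hq.eq_or_lt with rfl | hq
  · simp
  · have h0 : (0 : ℝ) < q := by exact_mod_cast (zero_lt_one.trans hq)
    have h1 : (1 : ℝ) ≤ Real.logb 2 q := by
      rw [Real.le_logb_iff_rpow_le (by norm_num) h0, Real.rpow_one]
      exact_mod_cast hq
    have h2 : ((Nat.clog 2 q - 1 : ℕ) : ℝ) ≤ Real.logb 2 q := by
      rw [Real.le_logb_iff_rpow_le (by norm_num) h0, Real.rpow_natCast]
      exact_mod_cast (Nat.pow_pred_clog_lt_self (b := 2) (by norm_num) hq).le
    have h3 : Nat.clog 2 q ≤ (Nat.clog 2 q - 1) + 1 := by omega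
    have h4 : (Nat.clog 2 q : ℝ) ≤ ((Nat.clog 2 q - 1 : ℕ) : ℝ) + 1 := by exact_mod_cast h3
    linarith

theorem mul_pow_le_mul_pow {a b c : ℕ} (hac : a ≤ c) (hbc : b ≤ c) (n : ℕ) :
    a * n ^ b ≤ c * (n + 1) ^ c :=
  Nat.mul_le_mul hac ((Nat.pow_le_pow_left n.le_succ b).trans
    (Nat.pow_le_pow_right n.succ_pos hbc))

end LAQCC

/-! ### The family of circuits and its constants -/

theorem mainTheorem1 :
    ∃ A : (q : ℕ) → LAQCC.Circuit (Nat.clog 2 q),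
      LAQCC.IsLAQCC (fun q : ℕ => Nat.clog 2 q) A ∧
      (∃ C : ℝ, ∀ q : ℕ, 1 ≤ q → ((A q).numQubits : ℝ) ≤ C * (Real.logb 2 (q : ℝ)) ^ 2) ∧
      ∀ q : ℕ, 1 ≤ q → (A q).Prepares (LAQCC.uniformSuperposition q) := by
  choose A hA hqubits hrounds hround using LAQCC.exists_circuit
  refine ⟨A, ?_, ⟨50176, fun q hq => ?_⟩, hA⟩
  -- The largest constant bounds all resources at once. It is kept as a variable because it also
  -- serves as an exponent.
  · obtain ⟨c, hc⟩ : ∃ c : ℕ, 256901120 ≤ c := ⟨_, le_rfl⟩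
    refine ⟨c, fun q => ⟨(hrounds q).trans (by omega), fun r hr => ?_⟩⟩
    obtain ⟨h1, h2, h3, h4⟩ := hround q r hr
    exact ⟨h1.trans (by omega), h2.trans (LAQCC.mul_pow_le_mul_pow (by omega) (by omega) _),
      h3.trans (Nat.mul_le_mul_right _ (by omega)),
      h4.trans (LAQCC.mul_pow_le_mul_pow hc (by omega) _)⟩
  · have h1 : ((A q).numQubits : ℝ) ≤ 12544 * (Nat.clog 2 q : ℝ) ^ 2 := by
      exact_mod_cast hqubits q
    have h2 := pow_le_pow_left₀ (Nat.cast_nonneg _) (LAQCC.clog_le_two_mul_logb hq) 2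
    calc _ ≤ 12544 * (Nat.clog 2 q : ℝ) ^ 2 := h1
      _ ≤ 12544 * (2 * Real.logb 2 q) ^ 2 := by gcongr
      _ = 50176 * Real.logb 2 q ^ 2 := by ring
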